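/- Let $n \ge 2$ be an integer, $d \ge 1$, $\alpha \in \mathbb{R}$, $T > 0$ and $x_0 \in (0,\pi)$, and assume that $n$ is odd if $\alpha > 0$. Let $D$ be the $n \times n$ Jordan block with $d$ on the diagonal, $1$ on the superdiagonal and $0$ elsewhere; let $A$ be the $n \times n$ matrix whose entry in the last row and first column is $\alpha$ and whose other entries are $0$; and let $B = (0,\dots,0,1)^\top \in \mathbb{R}^n$. Consider the system $$ \begin{cases} y_t - D y_{xx} + A y = B\,\delta_{x_0} u & \text{in } (0,T)\times(0,\pi),\\ y(\cdot,0) = y(\cdot,\pi) = 0 & \text{in } (0,T),\\ y(0,\cdot) = y^0 & \text{in } (0,\pi), \end{cases} $$ where $\delta_{x_0}$ is the Dirac distribution at $x_0$, $y^0 \in L^2(0,\pi;\mathbb{R}^n)$, $u \in L^2(0,T)$ is a real scalar control, and solutions are weak solutions $y \in L^2(0,T;H^1_0(0,\pi;\mathbb{R}^n)) \cap C^0([0,T];L^2(0,\pi;\mathbb{R}^n))$. The system is called approximately controllable at time $T$ if for all $y^0, y^T \in L^2(0,\pi;\mathbb{R}^n)$ and every $\varepsilon > 0$ there is $u \in L^2(0,T)$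 such that the associated solution satisfies $\|y(T,\cdot) - y^T\|_{L^2(0,\pi;\mathbb{R}^n)} \le \varepsilon$. Let $L^\star = -D^\star \partial_{xx} + A^\star$ be the operator in $L^2(0,\pi;\mathbb{C}^n)$ with domain $H^2(0,\pi;\mathbb{C}^n) \cap H^1_0(0,\pi;\mathbb{C}^n)$. Then: 1. If $\alpha \ne 0$, the system is approximately controllable at time $T$ if and only if every eigenvalue of $L^\star$ has geometric multiplicity equal to $1$ and $x_0 \ne r\pi$ for every $r \in \mathbb{Q} \cap (0,1)$. 2. If $\alpha = 0$, the system is approximately controllable at time $T$ if and only if $x_0 \ne r\pi$ for every $r \in \mathbb{Q} \cap (0,1)$. -/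

import Mathlib

namespace PointwiseControl

open MeasureTheory Matrix
open scoped ContDiff

/-- Lebesgue measure on the open interval `(0, π)`. -/
noncomputable abbrev domainMeasure : Measure ℝ :=
  volume.restrict (Set.Ioo (0 : ℝ) Real.pi)

/-- The Hilbert space `L²(0, π; 𝕜ⁿ)`, with `𝕜ⁿ` carrying the Euclidean norm. -/
abbrev L2Space (𝕜 : Type) [RCLike 𝕜] (n : ℕ) : Type :=
  Lp (EuclideanSpace 𝕜 (Fin n)) 2 domainMeasure

section Sobolev

variable {E : Type*} [NormedAddCommGroup E] [NormedSpace ℝ E]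

/-- `f ∈ H¹(0, π; E)` with weak derivative `g`: both are square integrable on `(0, π)` and
`∫ φ' f = - ∫ φ g` for all test functions `φ ∈ C_c^∞(0, π)`. -/
structure HasWeakDeriv (f g : ℝ → E) : Prop where
  memLp : MemLp f 2 domainMeasure
  memLp_deriv : MemLp g 2 domainMeasure
  integral_eq : ∀ φ : ℝ → ℝ, ContDiff ℝ ∞ φ → HasCompactSupport φ →
    tsupport φ ⊆ Set.Ioo (0 : ℝ) Real.pi →
    ∫ x, deriv φ x • f x ∂domainMeasure = - ∫ x, φ x • g x ∂domainMeasure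

/-- `f` is the continuous representative on `[0, π]` of an element of `H¹₀(0, π; E)`, and `g` is
its weak derivative. -/
structure IsH10 (f g : ℝ → E) : Prop where
  weakDeriv : HasWeakDeriv f g
  continuousOn : ContinuousOn f (Set.Icc 0 Real.pi)
  left_eq_zero : f 0 = 0
  right_eq_zero : f Real.pi = 0

theorem HasWeakDeriv.add {f g f₂ g₂ : ℝ → E} (h : HasWeakDeriv f g) (h₂ : HasWeakDeriv f₂ g₂) :
    HasWeakDeriv (f + f₂) (g + g₂) where
  memLp := h.memLp.add h₂.memLp
  memLp_deriv := h.memLp_deriv.add h₂.memLp_deriv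
  integral_eq := by
    intro φ hφ hc hs
    have key : ∀ ψ : ℝ → ℝ, Continuous ψ → HasCompactSupport ψ → ∀ k : ℝ → E,
        MemLp k 2 domainMeasure → Integrable (fun x => ψ x • k x) domainMeasure := by
      intro ψ hψ hcψ k hk
      have hk1 : Integrable k domainMeasure := hk.integrable (by norm_num)
      obtain ⟨C, hC⟩ := hcψ.exists_bound_of_continuous hψ
      exact hk1.bdd_smul C hψ.aestronglyMeasurable (Filter.Eventually.of_forall hC)
    have hd : Continuous (deriv φ) := hφ.continuous_deriv (by simp)
    simp only [Pi.add_apply, smul_add]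
    rw [integral_add (key _ hd hc.deriv _ h.memLp) (key _ hd hc.deriv _ h₂.memLp),
      integral_add (key _ hφ.continuous hc _ h.memLp_deriv)
        (key _ hφ.continuous hc _ h₂.memLp_deriv),
      h.integral_eq φ hφ hc hs, h₂.integral_eq φ hφ hc hs, neg_add]

theorem HasWeakDeriv.const_smul [NormedSpace ℂ E] {f g : ℝ → E}
    (h : HasWeakDeriv f g) (c : ℂ) : HasWeakDeriv (c • f) (c • g) where
  memLp := h.memLp.const_smul c
  memLp_deriv := h.memLp_deriv.const_smul c
  integral_eq := by
    intro φ hφ hc hs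
    simp only [Pi.smul_apply]
    simp_rw [smul_comm _ c]
    rw [integral_smul, integral_smul, h.integral_eq φ hφ hc hs, smul_neg]

theorem HasWeakDeriv.zero : HasWeakDeriv (0 : ℝ → E) 0 where
  memLp := MemLp.zero
  memLp_deriv := MemLp.zero
  integral_eq := by
    intro φ _ _ _
    simp

theorem IsH10.add {f g f₂ g₂ : ℝ → E} (h : IsH10 f g) (h₂ : IsH10 f₂ g₂) :
    IsH10 (f + f₂) (g + g₂) where
  weakDeriv := h.weakDeriv.add h₂.weakDeriv
  continuousOn := h.continuousOn.add h₂.continuousOn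
  left_eq_zero := by simp [h.left_eq_zero, h₂.left_eq_zero]
  right_eq_zero := by simp [h.right_eq_zero, h₂.right_eq_zero]

theorem IsH10.const_smul [NormedSpace ℂ E] {f g : ℝ → E}
    (h : IsH10 f g) (c : ℂ) : IsH10 (c • f) (c • g) where
  weakDeriv := h.weakDeriv.const_smul c
  continuousOn := h.continuousOn.const_smul c
  left_eq_zero := by simp [h.left_eq_zero]
  right_eq_zero := by simp [h.right_eq_zero]

theorem IsH10.zero : IsH10 (0 : ℝ → E) 0 where
  weakDeriv := HasWeakDeriv.zero
  continuousOn := continuousOn_const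
  left_eq_zero := rfl
  right_eq_zero := rfl

end Sobolev

/-- The `n × n` Jordan block `D` with `d` on the diagonal and `1` on the superdiagonal. -/
def matD (n : ℕ) (d : ℝ) : Matrix (Fin n) (Fin n) ℝ :=
  fun i j => if i = j then d else if (i : ℕ) + 1 = (j : ℕ) then 1 else 0

/-- The matrix `A` whose only possibly nonzero entry is `α`, in the last row and first column. -/
def matA (n : ℕ) (α : ℝ) : Matrix (Fin n) (Fin n) ℝ :=
  fun i j => if (i : ℕ) + 1 = n ∧ (j : ℕ) = 0 then α else 0

/-- The last vector `B = (0, …, 0, 1)` of the canonical basis. -/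
def vecB (n : ℕ) : EuclideanSpace ℝ (Fin n) :=
  WithLp.toLp 2 fun i => if (i : ℕ) + 1 = n then 1 else 0

/-- The action of a matrix on Euclidean space. -/
def act {𝕜 : Type} [RCLike 𝕜] {n : ℕ} (M : Matrix (Fin n) (Fin n) 𝕜)
    (v : EuclideanSpace 𝕜 (Fin n)) : EuclideanSpace 𝕜 (Fin n) :=
  WithLp.toLp 2 (M *ᵥ v.ofLp)

/-- `y` is the weak solution on `[0, T]` of
`y_t - D y_xx + A y = B δ_{x₀} u`, `y(·, 0) = y(·, π) = 0`, `y(0, ·) = y₀`: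
`y ∈ L²(0, T; H¹₀) ∩ C⁰([0, T]; L²)`, and for every `v ∈ H¹₀(0, π; ℝⁿ)` the equation tested
with `v` holds, in its form integrated in time from `0` to `t`. The function `z` is `y_x`. -/
structure IsWeakSolution (n : ℕ) (d α x₀ T : ℝ) (u : ℝ → ℝ) (y₀ : L2Space ℝ n)
    (y : ℝ → L2Space ℝ n) : Prop where
  continuousOn : ContinuousOn y (Set.Icc 0 T)
  initial : y 0 = y₀
  weak : ∃ z : ℝ → L2Space ℝ n,
    MemLp z 2 (volume.restrict (Set.Ioo (0 : ℝ) T)) ∧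
    (∀ᵐ t ∂(volume.restrict (Set.Ioo (0 : ℝ) T)),
      ∃ w : ℝ → EuclideanSpace ℝ (Fin n), w =ᵐ[domainMeasure] y t ∧ IsH10 w (z t)) ∧
    ∀ v vx : ℝ → EuclideanSpace ℝ (Fin n), IsH10 v vx → ∀ t ∈ Set.Icc 0 T,
      (∫ x, inner ℝ (y t x) (v x) ∂domainMeasure)
        - (∫ x, inner ℝ (y₀ x) (v x) ∂domainMeasure)
        + (∫ s in (0 : ℝ)..t,
            ((∫ x, inner ℝ (act (matD n d) (z s x)) (vx x) ∂domainMeasure)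
              + ∫ x, inner ℝ (act (matA n α) (y s x)) (v x) ∂domainMeasure))
      = ∫ s in (0 : ℝ)..t, u s * inner ℝ (vecB n) (v x₀)

/-- Approximate controllability in `L²(0, π; ℝⁿ)` at time `T`, with controls in `L²(0, T)`. -/
def ApproximatelyControllable (n : ℕ) (d α x₀ T : ℝ) : Prop :=
  ∀ y₀ yT : L2Space ℝ n, ∀ ε : ℝ, 0 < ε →
    ∃ u : ℝ → ℝ, MemLp u 2 (volume.restrict (Set.Ioo (0 : ℝ) T)) ∧
      ∃ y : ℝ → L2Space ℝ n, IsWeakSolution n d α x₀ T u y₀ y ∧ ‖y T - yT‖ ≤ ε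

theorem act_add {𝕜 : Type} [RCLike 𝕜] {n : ℕ} (M : Matrix (Fin n) (Fin n) 𝕜)
    (v w : EuclideanSpace 𝕜 (Fin n)) : act M (v + w) = act M v + act M w := by
  simp [act, Matrix.mulVec_add]

theorem act_smul {𝕜 : Type} [RCLike 𝕜] {n : ℕ} (M : Matrix (Fin n) (Fin n) 𝕜) (c : 𝕜)
    (v : EuclideanSpace 𝕜 (Fin n)) : act M (c • v) = c • act M v := by
  simp [act, Matrix.mulVec_smul]

/-- The graph of the operator `L* f = - D* f'' + A* f` in `L²(0, π; ℂⁿ)`, with domain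
`H²(0, π; ℂⁿ) ∩ H¹₀(0, π; ℂⁿ)`. -/
noncomputable def adjointGraph (n : ℕ) (d α : ℝ) : Submodule ℂ (L2Space ℂ n × L2Space ℂ n) where
  carrier := {p | ∃ f f₁ f₂ : ℝ → EuclideanSpace ℂ (Fin n),
    f =ᵐ[domainMeasure] p.1 ∧ IsH10 f f₁ ∧ HasWeakDeriv f₁ f₂ ∧
    ∀ᵐ x ∂domainMeasure,
      p.2 x = - act ((matD n d).map Complex.ofReal)ᴴ (f₂ x)
        + act ((matA n α).map Complex.ofReal)ᴴ (f x)}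
  add_mem' := by
    rintro p q ⟨f, f₁, f₂, hf, h0, h2, he⟩ ⟨g, g₁, g₂, hg, k0, k2, ke⟩
    refine ⟨f + g, f₁ + g₁, f₂ + g₂, ?_, h0.add k0, h2.add k2, ?_⟩
    · exact (hf.add hg).trans (Lp.coeFn_add p.1 q.1).symm
    · filter_upwards [he, ke, Lp.coeFn_add p.2 q.2] with x hx kx hs
      rw [Prod.snd_add, hs, Pi.add_apply, hx, kx, Pi.add_apply, Pi.add_apply, act_add, act_add]
      abel
  zero_mem' := by
    refine ⟨0, 0, 0, (Lp.coeFn_zero _ _ _).symm, IsH10.zero, HasWeakDeriv.zero, ?_⟩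
    filter_upwards [Lp.coeFn_zero (EuclideanSpace ℂ (Fin n)) 2 domainMeasure] with x hx
    rw [Prod.snd_zero, hx]
    simp [act]
  smul_mem' := by
    rintro c p ⟨f, f₁, f₂, hf, h0, h2, he⟩
    refine ⟨c • f, c • f₁, c • f₂, ?_, h0.const_smul c, h2.const_smul c, ?_⟩
    · exact (hf.const_smul c).trans (Lp.coeFn_smul c p.1).symm
    · filter_upwards [he, Lp.coeFn_smul c p.2] with x hx hs
      rw [Prod.smul_snd, hs, Pi.smul_apply, hx, Pi.smul_apply, Pi.smul_apply, act_smul, act_smul,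
        smul_add, smul_neg]

/-- The geometric eigenspace `{Φ ∈ D(L*) : L* Φ = μ Φ}`. -/
noncomputable def adjointEigenspace (n : ℕ) (d α : ℝ) (μ : ℂ) : Submodule ℂ (L2Space ℂ n) :=
  (adjointGraph n d α).comap (LinearMap.prod LinearMap.id (μ • LinearMap.id))

/-- Every eigenvalue of `L*` has geometric multiplicity `1`. -/
def SimpleEigenvalues (n : ℕ) (d α : ℝ) : Prop :=
  ∀ μ : ℂ, adjointEigenspace n d α μ ≠ ⊥ →
    Module.finrank ℂ (adjointEigenspace n d α μ) = 1

end PointwiseControl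

/-! Sine functions decouple the system: the `k`-th sine coefficient of a solution satisfies `Y' =
-L_k Y + sin_k(x₀) u B` with the matrix `L_k = (k+1)² D + A` (indices start at `0`, so the frequency
is `k + 1`). Both parts of the theorem follow from a criterion of Hautus type,
`approximatelyControllable_iff`: approximate controllability means that the `L_k` have pairwise
disjoint spectra and that no sine mode vanishes at `x₀`, the latter being irrationality of `x₀ / π`.

The structural fact behind it is that `B` is cyclic for every `L_k` (`modeOpℂ_cyclic`). Hence a left
eigenvector of `L_k` orthogonal to `B` is zero, and the eigenvalues of `L_k` are geometrically
simple. The sine coefficients of an eigenfunction of `L*` are left eigenvectors of the `L_k` for the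
same eigenvalue, so a multiple eigenvalue of `L*` can only come from two modes sharing it
(`simpleEigenvalues_iff`). For `α = 0` the matrix `L_k` is triangular with the single eigenvalue
`(k+1)² d`, and disjointness is automatic.

Necessity: a left eigenvector of a mode that is unseen at `x₀`, or a combination of left
eigenvectors of two modes sharing an eigenvalue chosen to annihilate `B`, gives a nonzero functional
whose value along any solution starting at `0` satisfies `ζ' = -μ ζ`, hence vanishes. The reachable
states then lie in a closed hyperplane or smaller subspace.

Sufficiency: weak solutions are built mode by mode for continuous controls
(`exists_isWeakSolution`). If `ψ` is orthogonal to everything reachable from `0`, then `∑ sin_k(x₀)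
⟨exp(-t L_k) B, ψ_k⟩` vanishes on `(0, T)` (`tsum_observation_eq_zero`). The uniqueness result
`eq_zero_of_tsum_expTerm_eq_zero` shows that every term vanishes: by analyticity the sum is zero for
all `t > 0`, and differentiation allows any polynomial `q(L_k)` to be inserted; a product of
characteristic polynomials kills all low modes except the `m`-th; the high modes decay faster than
`exp(-t L_m)` possibly can; so the `m`-th term is zero, and cyclicity of `B` removes the functional
itself. No eigenvector expansion is needed, so Jordan blocks cause no trouble. -/

namespace PointwiseControl

open MeasureTheory Matrix Filter Topology
open scoped ContDiff BoundedContinuousFunction ENNReal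

/-! ### Weak derivatives on `(0, π)` -/

section Sobolev

set_option linter.unusedSectionVars false

variable {E : Type*} [NormedAddCommGroup E] [NormedSpace ℝ E]

/-- The primitive vanishing at `0` of a function on `(0, π)`, extended by constants. -/
noncomputable def primitive (g : ℝ → E) (x : ℝ) : E :=
  ∫ s in (0 : ℝ)..x, (Set.Ioo (0 : ℝ) Real.pi).indicator g s

theorem primitive_continuous {g : ℝ → E} (hg : Integrable g domainMeasure) :
    Continuous (primitive g) := by
  have h : Integrable ((Set.Ioo (0 : ℝ) Real.pi).indicator g) volume :=
    (integrable_indicator_iff measurableSet_Ioo).2 hg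
  exact intervalIntegral.continuous_primitive (fun a b => h.intervalIntegrable) 0

theorem primitive_zero (g : ℝ → E) : primitive g 0 = 0 := by
  simp [primitive]

theorem primitive_pi (g : ℝ → E) : primitive g Real.pi = ∫ x, g x ∂domainMeasure := by
  rw [primitive, intervalIntegral.integral_of_le Real.pi_pos.le, integral_Ioc_eq_integral_Ioo,
    setIntegral_congr_fun measurableSet_Ioo (g := g)]
  intro x hx
  simp [Set.indicator_of_mem hx]

theorem primitive_eq_integral_indicator (g : ℝ → E) {x : ℝ} (hx : x ∈ Set.Ioo 0 Real.pi) :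
    primitive g x = ∫ s, (Set.Iio x).indicator g s ∂domainMeasure := by
  rw [primitive, intervalIntegral.integral_of_le hx.1.le, integral_Ioc_eq_integral_Ioo,
    ← integral_indicator measurableSet_Ioo, ← integral_indicator measurableSet_Ioo]
  congr 1
  ext s
  simp only [Set.indicator_apply, Set.mem_Ioo, Set.mem_Iio]
  by_cases h1 : 0 < s <;> by_cases h2 : s < x <;> by_cases h3 : s < Real.pi <;> simp [h1, h2, h3]

theorem integral_domainMeasure_eq {f : ℝ → E} :
    ∫ x, f x ∂domainMeasure = ∫ x in (0 : ℝ)..Real.pi, f x := by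
  rw [intervalIntegral.integral_of_le Real.pi_pos.le, integral_Ioc_eq_integral_Ioo]

theorem integrable_smul_domainMeasure {φ : ℝ → ℝ} (hφ : Continuous φ) {g : ℝ → E}
    (hg : Integrable g domainMeasure) : Integrable (fun x => φ x • g x) domainMeasure := by
  obtain ⟨C, hC⟩ := (isCompact_Icc (a := (0 : ℝ)) (b := Real.pi)).exists_bound_of_continuousOn
    hφ.continuousOn
  refine hg.bdd_smul C hφ.aestronglyMeasurable ?_
  filter_upwards [ae_restrict_mem measurableSet_Ioo] with x hx
  exact hC x ⟨hx.1.le, hx.2.le⟩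

theorem integrable_domainMeasure_of_continuous {f : ℝ → E} (hf : Continuous f) :
    Integrable f domainMeasure :=
  (hf.continuousOn.integrableOn_Icc (a := 0) (b := Real.pi)).mono_set Set.Ioo_subset_Icc_self

variable [CompleteSpace E]

/-- Fubini on the triangle `s < x`: integrating `φ'` over `(s, π)` leaves `φ(π) - φ(s)`. This needs
only integrability of `g`, not differentiability of its primitive. -/
theorem integral_deriv_smul_primitive {φ : ℝ → ℝ} (hφ : ContDiff ℝ 1 φ) {g : ℝ → E}
    (hg : Integrable g domainMeasure) :
    ∫ x, deriv φ x • primitive g x ∂domainMeasure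
      = φ Real.pi • (∫ x, g x ∂domainMeasure) - ∫ x, φ x • g x ∂domainMeasure := by
  have hd : Continuous (deriv φ) := hφ.continuous_deriv le_rfl
  have hint : Integrable (Function.uncurry fun x s : ℝ =>
      (Set.Iio x).indicator (fun s => deriv φ x • g s) s) (domainMeasure.prod domainMeasure) := by
    have h1 : Integrable (fun z : ℝ × ℝ => deriv φ z.1 • g z.2)
        (domainMeasure.prod domainMeasure) :=
      (integrable_domainMeasure_of_continuous hd).smul_prod hg
    have h2 : MeasurableSet {z : ℝ × ℝ | z.2 < z.1} :=
      measurableSet_lt measurable_snd measurable_fst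
    refine (h1.indicator h2).congr (Eventually.of_forall fun z => ?_)
    simp [Set.indicator_apply, Function.uncurry]
  have hswap := integral_integral_swap hint
  have hL : ∫ x, deriv φ x • primitive g x ∂domainMeasure
      = ∫ x, ∫ s, (Set.Iio x).indicator (fun s => deriv φ x • g s) s ∂domainMeasure
          ∂domainMeasure := by
    refine integral_congr_ae ?_
    filter_upwards [ae_restrict_mem measurableSet_Ioo] with x hx
    rw [primitive_eq_integral_indicator g hx, ← integral_smul]
    congr 1
    ext s
    by_cases h : s < x <;> simp [h]
  have hR : ∫ s, ∫ x, (Set.Iio x).indicator (fun s => deriv φ x • g s) s ∂domainMeasure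
      ∂domainMeasure = ∫ s, (φ Real.pi • g s - φ s • g s) ∂domainMeasure := by
    refine integral_congr_ae ?_
    filter_upwards [ae_restrict_mem measurableSet_Ioo] with s hs
    have e1 : (fun x : ℝ => (Set.Iio x).indicator (fun s => deriv φ x • g s) s)
        = fun x => (Set.Ioi s).indicator (deriv φ) x • g s := by
      ext x
      by_cases h : s < x <;> simp [h]
    have e2 : ∫ x, (Set.Ioi s).indicator (deriv φ) x ∂domainMeasure = φ Real.pi - φ s := by
      rw [← intervalIntegral.integral_deriv_eq_sub
        (fun x _ => (hφ.differentiable one_ne_zero).differentiableAt)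
        (hd.intervalIntegrable _ _), intervalIntegral.integral_of_le hs.2.le,
        integral_Ioc_eq_integral_Ioo, ← integral_indicator measurableSet_Ioo,
        ← integral_indicator measurableSet_Ioo]
      congr 1
      ext x
      simp only [Set.indicator_apply, Set.mem_Ioo, Set.mem_Ioi]
      have := hs.1
      by_cases h1 : s < x
      · simp [h1, this.trans h1]
      · simp [h1]
    rw [e1, integral_smul_const, e2, sub_smul]
  have hc : Integrable (fun s => φ Real.pi • g s) domainMeasure := hg.smul (φ Real.pi)
  rw [hL, hswap, hR, integral_sub hc (integrable_smul_domainMeasure hφ.continuous hg),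
    integral_smul]

theorem exists_testFunction_integral_one : ∃ ρ : ℝ → ℝ, ContDiff ℝ ∞ ρ ∧ HasCompactSupport ρ ∧
    tsupport ρ ⊆ Set.Ioo (0 : ℝ) Real.pi ∧ ∫ x, ρ x = 1 := by
  let b : ContDiffBump (Real.pi / 2) := ⟨Real.pi / 8, Real.pi / 4, by positivity, by
    linarith [Real.pi_pos]⟩
  refine ⟨b.normed volume, b.contDiff_normed, b.hasCompactSupport_normed, ?_, b.integral_normed⟩
  rw [b.tsupport_normed_eq, Real.closedBall_eq_Icc]
  change Set.Icc (Real.pi / 2 - Real.pi / 4) (Real.pi / 2 + Real.pi / 4) ⊆ _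
  intro x hx
  have := Real.pi_pos
  constructor <;> linarith [hx.1, hx.2]

theorem exists_Icc_of_tsupport_subset {φ : ℝ → ℝ} {a b : ℝ} (hab : a < b)
    (hc : HasCompactSupport φ) (hs : tsupport φ ⊆ Set.Ioo a b) :
    ∃ a' b', a < a' ∧ b' < b ∧ ∀ x, x < a' ∨ b' < x → φ x = 0 := by
  rcases (tsupport φ).eq_empty_or_nonempty with h | h
  -- For empty support the bounds are taken in the wrong order, `a' = b > a = b'`, so that the two
  -- half-lines cover everything.
  · refine ⟨b, a, hab, hab, fun x _ => ?_⟩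
    rw [tsupport_eq_empty_iff.1 h, Pi.zero_apply]
  · have hc' : IsCompact (tsupport φ) := hc
    obtain ⟨p, hp, hpl⟩ := hc'.exists_isLeast h
    obtain ⟨q, hq, hql⟩ := hc'.exists_isGreatest h
    refine ⟨p, q, (hs hp).1, (hs hq).2, fun x hx => ?_⟩
    by_contra hne
    have hx' : x ∈ tsupport φ := subset_tsupport _ hne
    rcases hx with h | h
    · exact absurd (hpl hx') (not_le.2 h)
    · exact absurd (hql hx') (not_le.2 h)

/-- A mean-zero test function is the derivative of a test function. -/
theorem exists_testFunction_deriv_eq {θ : ℝ → ℝ} (hθ : ContDiff ℝ ∞ θ) (hc : HasCompactSupport θ)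
    (hs : tsupport θ ⊆ Set.Ioo (0 : ℝ) Real.pi) (h0 : ∫ x, θ x = 0) :
    ∃ φ : ℝ → ℝ, ContDiff ℝ ∞ φ ∧ HasCompactSupport φ ∧ tsupport φ ⊆ Set.Ioo (0 : ℝ) Real.pi ∧
      deriv φ = θ := by
  obtain ⟨a, b, ha, hb, hab⟩ := exists_Icc_of_tsupport_subset Real.pi_pos hc hs
  set φ : ℝ → ℝ := fun x => ∫ s in (0 : ℝ)..x, θ s
  have hd : ∀ x, HasDerivAt φ (θ x) x := fun x =>
    intervalIntegral.integral_hasDerivAt_right (hθ.continuous.intervalIntegrable _ _)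
      hθ.continuous.stronglyMeasurable.stronglyMeasurableAtFilter hθ.continuous.continuousAt
  have hde : deriv φ = θ := funext fun x => (hd x).deriv
  have hzero : ∀ x, x ∉ Set.Icc a b → φ x = 0 := by
    intro x hx
    rw [Set.mem_Icc, not_and_or, not_le, not_le] at hx
    have hl : ∀ y < a, φ y = 0 := by
      intro y hy
      refine intervalIntegral.integral_zero_ae (Eventually.of_forall fun s hsm => hab s (Or.inl ?_))
      rcases Set.mem_uIoc.1 hsm with h | h
      · linarith [h.2]
      · linarith [h.2]
    rcases hx with hx | hx
    · exact hl x hx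
    · have h1 : ∫ s, θ s = ∫ s in (0 : ℝ)..x, θ s := by
        have hx0 : (0 : ℝ) ≤ x ∨ x < 0 := le_or_gt 0 x
        rcases hx0 with hx0 | hx0
        · rw [intervalIntegral.integral_of_le hx0, setIntegral_eq_integral_of_forall_compl_eq_zero]
          intro s hs'
          refine hab s ?_
          rw [Set.mem_Ioc, not_and_or, not_lt, not_le] at hs'
          rcases hs' with h | h
          · exact Or.inl (by linarith)
          · exact Or.inr (by linarith)
        -- Here `b < x < 0 < a`, so the half-lines on which `θ` vanishes cover the line.
        · have : θ = 0 := by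
            ext s
            refine hab s ?_
            by_contra hcon
            push Not at hcon
            linarith [hcon.1, hcon.2]
          simp [this]
      change ∫ s in (0 : ℝ)..x, θ s = 0
      rw [← h1, h0]
  have hsub : tsupport φ ⊆ Set.Icc a b :=
    closure_minimal (fun x hx => by_contra fun h => hx (hzero x h)) isClosed_Icc
  refine ⟨φ, ?_, ?_, ?_, hde⟩
  · exact contDiff_infty_iff_deriv.2 ⟨fun x => (hd x).differentiableAt, hde ▸ hθ⟩
  · exact isCompact_Icc.of_isClosed_subset (isClosed_tsupport φ) hsub
  · exact fun x hx => ⟨ha.trans_le (hsub hx).1, (hsub hx).2.trans_lt hb⟩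

theorem HasWeakDeriv.integrable {f g : ℝ → E} (h : HasWeakDeriv f g) :
    Integrable f domainMeasure :=
  h.memLp.integrable (by norm_num)

theorem HasWeakDeriv.integrable_deriv {f g : ℝ → E} (h : HasWeakDeriv f g) :
    Integrable g domainMeasure :=
  h.memLp_deriv.integrable (by norm_num)

theorem integral_smul_domainMeasure_eq {φ : ℝ → ℝ} {g : ℝ → E}
    (hs : tsupport φ ⊆ Set.Ioo (0 : ℝ) Real.pi) :
    ∫ x, φ x • g x ∂domainMeasure = ∫ x, φ x • g x := by
  refine setIntegral_eq_integral_of_forall_compl_eq_zero fun x hx => ?_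
  rw [image_eq_zero_of_notMem_tsupport fun h => hx (hs h), zero_smul]

/-- A function with integrable weak derivative is a.e. a primitive of it. -/
theorem HasWeakDeriv.exists_eq_primitive {f g : ℝ → E} (h : HasWeakDeriv f g) :
    ∃ c : E, ∀ᵐ x ∂domainMeasure, f x = c + primitive g x := by
  obtain ⟨ρ, hρ, hρc, hρs, hρ1⟩ := exists_testFunction_integral_one
  set k : ℝ → E := fun x => f x - primitive g x
  have hG := integrable_domainMeasure_of_continuous (primitive_continuous h.integrable_deriv)
  have hk : Integrable k domainMeasure := h.integrable.sub hG
  set c : E := ∫ x, ρ x • k x ∂domainMeasure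
  have key : ∀ ψ : ℝ → ℝ, ContDiff ℝ ∞ ψ → HasCompactSupport ψ →
      tsupport ψ ⊆ Set.Ioo (0 : ℝ) Real.pi → ∫ x, ψ x • (k x - c) = 0 := by
    intro ψ hψ hψc hψs
    have hψi : Integrable ψ := hψ.continuous.integrable_of_hasCompactSupport hψc
    have hρi : Integrable ρ := hρ.continuous.integrable_of_hasCompactSupport hρc
    set m : ℝ := ∫ x, ψ x
    -- The du Bois-Reymond argument: removing the mean of `ψ` with the fixed bump `ρ` makes it a
    -- derivative of a test function, against which `k` integrates to `0`; the removed part accounts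
    -- for the constant `c`.
    set θ : ℝ → ℝ := fun x => ψ x - m * ρ x
    have hθ : ContDiff ℝ ∞ θ := hψ.sub (contDiff_const.mul hρ)
    have hθsub : tsupport θ ⊆ tsupport ψ ∪ tsupport ρ := by
      refine closure_minimal (fun x hx => ?_) ((isClosed_tsupport _).union (isClosed_tsupport _))
      by_contra hcon
      rw [Set.mem_union, not_or] at hcon
      refine hx ?_
      simp [θ, image_eq_zero_of_notMem_tsupport hcon.1, image_eq_zero_of_notMem_tsupport hcon.2]
    have hθc : HasCompactSupport θ :=
      (hψc.isCompact.union hρc.isCompact).of_isClosed_subset (isClosed_tsupport _) hθsub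
    have hθs : tsupport θ ⊆ Set.Ioo (0 : ℝ) Real.pi :=
      hθsub.trans (Set.union_subset hψs hρs)
    have hθ0 : ∫ x, θ x = 0 := by
      rw [integral_sub hψi (hρi.const_mul m), integral_const_mul, hρ1, mul_one, sub_self]
    obtain ⟨φ, hφ, hφc, hφs, hφd⟩ := exists_testFunction_deriv_eq hθ hθc hθs hθ0
    have e1 : ∫ x, θ x • k x ∂domainMeasure = 0 := by
      have hφpi : φ Real.pi = 0 :=
        image_eq_zero_of_notMem_tsupport fun hm => lt_irrefl _ (hφs hm).2
      have a1 := h.integral_eq φ hφ hφc hφs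
      have a2 := integral_deriv_smul_primitive (hφ.of_le (by simp)) h.integrable_deriv
      rw [hφd] at a1 a2
      simp only [k, smul_sub]
      rw [integral_sub (integrable_smul_domainMeasure hθ.continuous h.integrable)
        (integrable_smul_domainMeasure hθ.continuous hG), a1, a2, hφpi]
      simp
    have e2 : ∫ x, ψ x • k x ∂domainMeasure = m • c := by
      have : ∫ x, θ x • k x ∂domainMeasure = ∫ x, ψ x • k x ∂domainMeasure - m • c := by
        have hm : Integrable (fun x => m • ρ x • k x) domainMeasure :=
          (integrable_smul_domainMeasure hρ.continuous hk).smul m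
        simp only [θ, sub_smul, mul_smul]
        rw [integral_sub (integrable_smul_domainMeasure hψ.continuous hk) hm, integral_smul]
      rw [e1] at this
      exact (sub_eq_zero.1 this.symm)
    have e3 : ∫ x, ψ x • c ∂domainMeasure = m • c := by
      rw [integral_smul_domainMeasure_eq hψs, integral_smul_const]
    rw [← integral_smul_domainMeasure_eq hψs]
    simp only [smul_sub]
    rw [integral_sub (integrable_smul_domainMeasure hψ.continuous hk)
      (integrable_smul_domainMeasure hψ.continuous (integrable_const c)), e2, e3, sub_self]
  have hloc : LocallyIntegrableOn (fun x => k x - c) (Set.Ioo (0 : ℝ) Real.pi) volume :=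
    IntegrableOn.locallyIntegrableOn (hk.sub (integrable_const c))
  have := isOpen_Ioo.ae_eq_zero_of_integral_contDiff_smul_eq_zero hloc key
  refine ⟨c, (ae_restrict_iff' measurableSet_Ioo).2 ?_⟩
  filter_upwards [this] with x hx hxm
  have := sub_eq_zero.1 (hx hxm)
  rw [← this]
  simp [k]

/-- Integration by parts against a smooth function, with the boundary values of the primitive. -/
theorem integral_smul_eq_of_ae_eq_primitive {f g : ℝ → E} {c : E}
    (hg : Integrable g domainMeasure) (hf : ∀ᵐ x ∂domainMeasure, f x = c + primitive g x)
    {φ : ℝ → ℝ} (hφ : ContDiff ℝ 1 φ) :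
    ∫ x, φ x • g x ∂domainMeasure = φ Real.pi • (c + ∫ x, g x ∂domainMeasure) - φ 0 • c
      - ∫ x, deriv φ x • f x ∂domainMeasure := by
  have hd : Continuous (deriv φ) := hφ.continuous_deriv le_rfl
  have h1 : ∫ x, deriv φ x • f x ∂domainMeasure = (φ Real.pi - φ 0) • c
      + ∫ x, deriv φ x • primitive g x ∂domainMeasure := by
    rw [integral_congr_ae (g := fun x => deriv φ x • c + deriv φ x • primitive g x)
      (hf.mono fun x hx => by simp only [hx, smul_add]), integral_add
      (integrable_smul_domainMeasure hd (integrable_const c))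
      (integrable_smul_domainMeasure hd
        (integrable_domainMeasure_of_continuous (primitive_continuous hg))), integral_smul_const,
      integral_domainMeasure_eq, intervalIntegral.integral_deriv_eq_sub
        (fun x _ => (hφ.differentiable one_ne_zero).differentiableAt)
        (hd.intervalIntegrable _ _)]
  rw [h1, integral_deriv_smul_primitive hφ hg]
  simp only [smul_add, sub_smul]
  abel

theorem HasWeakDeriv.integral_smul_eq {f g : ℝ → E} (h : HasWeakDeriv f g)
    {φ : ℝ → ℝ} (hφ : ContDiff ℝ 1 φ) (h0 : φ 0 = 0) (hpi : φ Real.pi = 0) :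
    ∫ x, φ x • g x ∂domainMeasure = - ∫ x, deriv φ x • f x ∂domainMeasure := by
  obtain ⟨c, hc⟩ := h.exists_eq_primitive
  rw [integral_smul_eq_of_ae_eq_primitive h.integrable_deriv hc hφ, h0, hpi]
  simp

theorem eqOn_Icc_of_ae_eq {f g : ℝ → E} (hf : ContinuousOn f (Set.Icc 0 Real.pi))
    (hg : ContinuousOn g (Set.Icc 0 Real.pi)) (h : f =ᵐ[domainMeasure] g) :
    Set.EqOn f g (Set.Icc 0 Real.pi) := by
  have h1 : Set.EqOn f g (Set.Ioo 0 Real.pi) :=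
    Measure.eqOn_open_of_ae_eq h isOpen_Ioo (hf.mono Set.Ioo_subset_Icc_self)
      (hg.mono Set.Ioo_subset_Icc_self)
  have := h1.of_subset_closure hf hg Set.Ioo_subset_Icc_self
    (by rw [closure_Ioo Real.pi_pos.ne])
  exact this

/-- The boundary terms vanish because of `f`, so `φ` is free at the ends and may be a cosine. The
companion `HasWeakDeriv.integral_smul_eq` puts the boundary condition on `φ` and serves for sines
against a second derivative. -/
theorem IsH10.integral_smul_eq {f g : ℝ → E} (h : IsH10 f g) {φ : ℝ → ℝ} (hφ : ContDiff ℝ 1 φ) :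
    ∫ x, φ x • g x ∂domainMeasure = - ∫ x, deriv φ x • f x ∂domainMeasure := by
  obtain ⟨c, hc⟩ := h.weakDeriv.exists_eq_primitive
  have hG := primitive_continuous h.weakDeriv.integrable_deriv
  have heq := eqOn_Icc_of_ae_eq h.continuousOn (continuous_const.add hG).continuousOn hc
  have e0 := heq (Set.left_mem_Icc.2 Real.pi_pos.le)
  have e1 := heq (Set.right_mem_Icc.2 Real.pi_pos.le)
  rw [h.left_eq_zero, Pi.add_apply, primitive_zero, add_zero] at e0
  rw [h.right_eq_zero, Pi.add_apply, primitive_pi] at e1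
  rw [integral_smul_eq_of_ae_eq_primitive h.weakDeriv.integrable_deriv hc hφ, ← e1, ← e0]
  simp

end Sobolev

/-! ### Uniqueness for series of exponentials of operators -/

section ExponentialSeries

set_option linter.unusedSectionVars false

section Norm

variable {𝕜 E : Type*} [RCLike 𝕜] [NormedAddCommGroup E] [NormedSpace 𝕜 E] [CompleteSpace E]

theorem norm_exp_le_exp_norm (A : E →L[𝕜] E) : ‖NormedSpace.exp A‖ ≤ Real.exp ‖A‖ := by
  rw [NormedSpace.exp_eq_tsum 𝕜, Real.exp_eq_exp_ℝ, NormedSpace.exp_eq_tsum_div]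
  refine tsum_of_norm_bounded (Real.summable_pow_div_factorial ‖A‖).hasSum fun j => ?_
  rw [norm_smul, norm_inv, RCLike.norm_natCast, div_eq_inv_mul]
  gcongr
  rcases j.eq_zero_or_pos with rfl | hj
  · rw [pow_zero, pow_zero]
    exact ContinuousLinearMap.norm_id_le
  · exact norm_pow_le' _ hj

theorem exp_add_eq_mul {A B : E →L[𝕜] E} (h : Commute A B) :
    NormedSpace.exp (A + B) = NormedSpace.exp A * NormedSpace.exp B := by
  let _ : NormedAlgebra ℚ (E →L[𝕜] E) := .restrictScalars ℚ 𝕜 _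
  exact NormedSpace.exp_add_of_commute h

end Norm

/-! ### Analytic continuation and decay of series of operator exponentials -/

variable {E : Type*} [NormedAddCommGroup E] [NormedSpace ℂ E]

/-- The set on which series of exponentials with parabolic decay converge uniformly. -/
def truncatedSector (δ R : ℝ) : Set ℂ := {z | δ < z.re - ‖z‖ / 2 ∧ ‖z‖ < R}

theorem isOpen_truncatedSector (δ R : ℝ) : IsOpen (truncatedSector δ R) :=
  (isOpen_lt continuous_const (Complex.continuous_re.sub (continuous_norm.div_const 2))).inter
    (isOpen_lt continuous_norm continuous_const)

/-- `Re z - ‖z‖ / 2` is concave and `‖z‖` is convex. Convexity supplies the connectedness for the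
identity theorem. -/
theorem convex_truncatedSector (δ R : ℝ) : Convex ℝ (truncatedSector δ R) := by
  intro z hz w hw a b ha hb hab
  have h1 : ‖a • z + b • w‖ ≤ a * ‖z‖ + b * ‖w‖ := by
    refine (norm_add_le _ _).trans ?_
    rw [norm_smul, norm_smul, Real.norm_of_nonneg ha, Real.norm_of_nonneg hb]
  have h2 : (a • z + b • w).re = a * z.re + b * w.re := by simp
  have hz1 := hz.1
  have hz2 := hz.2
  have hw1 := hw.1
  have hw2 := hw.2
  refine ⟨?_, h1.trans_lt ?_⟩
  · rw [h2]
    rcases ha.eq_or_lt with rfl | ha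
    · have hb1 : b = 1 := by linarith
      subst hb1
      linarith
    · have : b = 1 - a := by linarith
      subst this
      nlinarith [mul_lt_mul_of_pos_left hz1 ha, mul_le_mul_of_nonneg_left hw1.le hb]
  · rcases ha.eq_or_lt with rfl | ha
    · have hb1 : b = 1 := by linarith
      subst hb1
      linarith
    · have : b = 1 - a := by linarith
      subst this
      nlinarith [mul_lt_mul_of_pos_left hz2 ha, mul_le_mul_of_nonneg_left hw2.le hb]

theorem ofReal_mem_truncatedSector {δ R t : ℝ} (ht : 0 ≤ t) (h1 : 2 * δ < t) (h2 : t < R) :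
    (t : ℂ) ∈ truncatedSector δ R := by
  have : ‖(t : ℂ)‖ = t := by rw [Complex.norm_real, Real.norm_of_nonneg ht]
  refine ⟨?_, ?_⟩
  · rw [this, Complex.ofReal_re]
    linarith
  · rwa [this]

theorem summable_pow_mul_exp_neg_sq (p : ℕ) {δ : ℝ} (hδ : 0 < δ) :
    Summable fun k : ℕ => ((k : ℝ) + 1) ^ p * Real.exp (-δ * ((k : ℝ) + 1) ^ 2) := by
  have h := (summable_nat_add_iff 1).2 (Real.summable_pow_mul_exp_neg_nat_mul p hδ)
  refine Summable.of_nonneg_of_le (fun k => by positivity) (fun k => ?_) h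
  push_cast
  have hk : (0 : ℝ) ≤ k := k.cast_nonneg
  refine mul_le_mul_of_nonneg_left (Real.exp_le_exp.2 ?_) (by positivity)
  nlinarith [mul_nonneg hδ.le hk, mul_nonneg hδ.le (mul_nonneg hk hk)]

/-- A polynomial in `L k` costs only a power of `k + 1`, which the exponential decay in `(k + 1)²`
absorbs. -/
theorem exists_norm_aeval_le {L : ℕ → E →L[ℂ] E} {C : ℝ}
    (hL : ∀ k : ℕ, ‖L k‖ ≤ C * ((k : ℝ) + 1) ^ 2) (q : Polynomial ℂ) :
    ∃ (D : ℝ) (p : ℕ), 0 ≤ D ∧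
      ∀ k : ℕ, ‖Polynomial.aeval (L k) q‖ ≤ D * ((k : ℝ) + 1) ^ p := by
  induction q using Polynomial.induction_on' with
  | add q r hq hr =>
    obtain ⟨D, p, hD, h⟩ := hq
    obtain ⟨D', p', hD', h'⟩ := hr
    refine ⟨D + D', max p p', add_nonneg hD hD', fun k => ?_⟩
    have hk : (1 : ℝ) ≤ (k : ℝ) + 1 := by linarith [k.cast_nonneg (α := ℝ)]
    rw [map_add, add_mul]
    refine (norm_add_le _ _).trans (add_le_add ((h k).trans ?_) ((h' k).trans ?_))
    · exact mul_le_mul_of_nonneg_left (pow_le_pow_right₀ hk (le_max_left _ _)) hD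
    · exact mul_le_mul_of_nonneg_left (pow_le_pow_right₀ hk (le_max_right _ _)) hD'
  | monomial j a =>
    have hC : 0 ≤ C := by simpa using (norm_nonneg _).trans (hL 0)
    refine ⟨‖a‖ * C ^ j, 2 * j, by positivity, fun k => ?_⟩
    rw [Polynomial.aeval_monomial, Algebra.algebraMap_eq_smul_one, smul_one_mul, norm_smul,
      mul_assoc, pow_mul, ← mul_pow]
    gcongr
    rcases j.eq_zero_or_pos with rfl | hj
    · rw [pow_zero, pow_zero]
      exact ContinuousLinearMap.norm_id_le
    · exact (norm_pow_le' _ hj).trans (pow_le_pow_left₀ (norm_nonneg _) (hL k) j)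

/-- The terms `f (q(L) exp(-z L) b)` of a series of exponentials. -/
noncomputable def expTerm (L : E →L[ℂ] E) (f : E →L[ℂ] ℂ) (b : E) (q : Polynomial ℂ) (z : ℂ) : ℂ :=
  f (Polynomial.aeval L q (NormedSpace.exp (-z • L) b))

variable [CompleteSpace E]

theorem hasDerivAt_exp_neg_smul (L : E →L[ℂ] E) (z : ℂ) :
    HasDerivAt (fun z : ℂ => NormedSpace.exp (-z • L)) (-(L * NormedSpace.exp (-z • L))) z := by
  have h := (hasDerivAt_exp_smul_const' (𝕂 := ℂ) L (-z)).scomp z (hasDerivAt_neg z)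
  simpa [Function.comp_def] using h

/-- Differentiation in `z` multiplies the polynomial by `-X`; this is how polynomials in `L` enter
the vanishing series. -/
theorem hasDerivAt_expTerm (L : E →L[ℂ] E) (f : E →L[ℂ] ℂ) (b : E) (q : Polynomial ℂ) (z : ℂ) :
    HasDerivAt (expTerm L f b q) (-expTerm L f b (q * Polynomial.X) z) z := by
  have h := (hasDerivAt_exp_neg_smul L z).clm_apply (hasDerivAt_const z b)
  have h2 := (f.comp (Polynomial.aeval L q)).hasFDerivAt.comp_hasDerivAt z h
  convert! h2 using 1
  simp [expTerm]

variable {L : ℕ → E →L[ℂ] E} {f : ℕ → E →L[ℂ] ℂ} {b : E} {C c : ℝ}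

theorem exists_norm_expTerm_le
    (hexp : ∀ (k : ℕ) (z : ℂ), 0 ≤ z.re → ‖NormedSpace.exp (-z • L k)‖
      ≤ C * Real.exp (c * ‖z‖ - ((k : ℝ) + 1) ^ 2 * (z.re - ‖z‖ / 2)))
    (hL : ∀ k : ℕ, ‖L k‖ ≤ C * ((k : ℝ) + 1) ^ 2) (hf : ∀ k, ‖f k‖ ≤ C) (q : Polynomial ℂ) :
    ∃ (D : ℝ) (p : ℕ), 0 ≤ D ∧ ∀ (k : ℕ) (z : ℂ), 0 ≤ z.re →
      ‖expTerm (L k) (f k) b q z‖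
      ≤ D * ((k : ℝ) + 1) ^ p
        * Real.exp (c * ‖z‖ - ((k : ℝ) + 1) ^ 2 * (z.re - ‖z‖ / 2)) := by
  obtain ⟨D, p, hD, h⟩ := exists_norm_aeval_le hL q
  have hC : 0 ≤ C := (norm_nonneg _).trans (hf 0)
  refine ⟨C * D * C * ‖b‖, p, by positivity, fun k z hz => ?_⟩
  calc ‖expTerm (L k) (f k) b q z‖
      ≤ ‖f k‖ * (‖Polynomial.aeval (L k) q‖ * (‖NormedSpace.exp (-z • L k)‖ * ‖b‖)) := by
        refine (f k).le_opNorm_of_le (ContinuousLinearMap.le_opNorm_of_le _ ?_)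
        exact ContinuousLinearMap.le_opNorm _ _
    _ ≤ C * ((D * ((k : ℝ) + 1) ^ p)
          * ((C * Real.exp (c * ‖z‖ - ((k : ℝ) + 1) ^ 2 * (z.re - ‖z‖ / 2))) * ‖b‖)) := by
        gcongr
        · exact hf k
        · exact h k
        · exact hexp k z hz
    _ = _ := by ring

section

variable (hc : 0 ≤ c)
  (hexp : ∀ (k : ℕ) (z : ℂ), 0 ≤ z.re → ‖NormedSpace.exp (-z • L k)‖
      ≤ C * Real.exp (c * ‖z‖ - ((k : ℝ) + 1) ^ 2 * (z.re - ‖z‖ / 2)))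
  (hL : ∀ k : ℕ, ‖L k‖ ≤ C * ((k : ℝ) + 1) ^ 2) (hf : ∀ k, ‖f k‖ ≤ C)

include hc hexp hL hf

theorem exists_summable_bound_expTerm (q : Polynomial ℂ) {δ : ℝ} (hδ : 0 < δ) (R : ℝ) :
    ∃ u : ℕ → ℝ, Summable u ∧
      ∀ k, ∀ z ∈ truncatedSector δ R, ‖expTerm (L k) (f k) b q z‖ ≤ u k := by
  obtain ⟨D, p, hD, h⟩ := exists_norm_expTerm_le (b := b) hexp hL hf q
  refine ⟨_, (summable_pow_mul_exp_neg_sq p hδ).mul_left (D * Real.exp (c * R)), fun k z hz => ?_⟩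
  have hre : 0 ≤ z.re := by linarith [hz.1, norm_nonneg z]
  refine (h k z hre).trans ?_
  have h1 : c * ‖z‖ - ((k : ℝ) + 1) ^ 2 * (z.re - ‖z‖ / 2) ≤ c * R + -δ * ((k : ℝ) + 1) ^ 2 := by
    have := hz.1
    have := mul_le_mul_of_nonneg_left hz.2.le hc
    nlinarith [mul_le_mul_of_nonneg_left hz.1.le (sq_nonneg ((k : ℝ) + 1))]
  calc _ ≤ D * ((k : ℝ) + 1) ^ p * Real.exp (c * R + -δ * ((k : ℝ) + 1) ^ 2) := by gcongr
    _ = _ := by rw [Real.exp_add]; ring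

theorem summable_expTerm (q : Polynomial ℂ) {z : ℂ} (hz : 0 < z.re - ‖z‖ / 2) :
    Summable fun k => expTerm (L k) (f k) b q z := by
  obtain ⟨u, hu, h⟩ := exists_summable_bound_expTerm (b := b) hc hexp hL hf q (half_pos hz)
    (‖z‖ + 1)
  exact Summable.of_norm_bounded hu fun k => h k z ⟨half_lt_self hz, lt_add_one _⟩

theorem differentiableOn_tsum_expTerm (q : Polynomial ℂ) {δ : ℝ} (hδ : 0 < δ) (R : ℝ) :
    DifferentiableOn ℂ (fun z => ∑' k, expTerm (L k) (f k) b q z) (truncatedSector δ R) := by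
  obtain ⟨u, hu, h⟩ := exists_summable_bound_expTerm (b := b) hc hexp hL hf q hδ R
  exact Complex.differentiableOn_tsum_of_summable_norm hu
    (fun k z _ => (hasDerivAt_expTerm _ _ _ _ z).differentiableAt.differentiableWithinAt)
    (isOpen_truncatedSector δ R) h

/-- Identity theorem, with zeros accumulating at `T / 2`. This point lies in the sector because on
the positive axis `Re z - ‖z‖ / 2` is half of `z`, whence the condition `4 * δ < T`. -/
theorem tsum_expTerm_eqOn_zero {T : ℝ} (hT : 0 < T)
    (h0 : ∀ t ∈ Set.Ioo 0 T, ∑' k, expTerm (L k) (f k) b 1 (t : ℂ) = 0)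
    {δ : ℝ} (hδ : 0 < δ) (hδT : 4 * δ < T) {R : ℝ} (hR : T < R) :
    Set.EqOn (fun z => ∑' k, expTerm (L k) (f k) b 1 z) 0 (truncatedSector δ R) := by
  have han := (differentiableOn_tsum_expTerm (b := b) hc hexp hL hf 1 hδ R).analyticOnNhd
    (isOpen_truncatedSector δ R)
  refine han.eqOn_zero_of_preconnected_of_frequently_eq_zero
    (convex_truncatedSector δ R).isPreconnected
    (ofReal_mem_truncatedSector (t := T / 2) (by positivity) (by linarith) (by linarith)) ?_
  have htend : Tendsto (fun t : ℝ => (t : ℂ)) (𝓝[≠] (T / 2)) (𝓝[≠] ((T / 2 : ℝ) : ℂ)) := by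
    refine tendsto_nhdsWithin_of_tendsto_nhds_of_eventually_within _ ?_ ?_
    · exact (Complex.continuous_ofReal.tendsto _).mono_left nhdsWithin_le_nhds
    · filter_upwards [self_mem_nhdsWithin] with t ht
      simpa using fun h => ht (Complex.ofReal_injective (by simpa using h))
  refine htend.frequently (Eventually.frequently ?_)
  filter_upwards [nhdsWithin_le_nhds (Ioo_mem_nhds (half_pos hT) (half_lt_self hT))] with t ht
  exact h0 t ht

/-- Analyticity carries the vanishing to all positive times, termwise differentiation inserts the
powers of `X`, and linearity gives every polynomial. -/
theorem tsum_expTerm_eq_zero {T : ℝ} (hT : 0 < T)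
    (h0 : ∀ t ∈ Set.Ioo 0 T, ∑' k, expTerm (L k) (f k) b 1 (t : ℂ) = 0) (q : Polynomial ℂ)
    {t : ℝ} (ht : 0 < t) : ∑' k, expTerm (L k) (f k) b q (t : ℂ) = 0 := by
  -- Small enough that one sector contains both `T / 2` and `t`.
  set δ := min t T / 8
  have hδ : 0 < δ := by
    have := lt_min ht hT
    positivity
  have hδT : 4 * δ < T := by
    have := min_le_right t T
    simp only [δ]
    linarith
  have hδt : 2 * δ < t := by
    have := min_le_left t T
    simp only [δ]
    linarith
  set R := t + T + 1
  have hmem : (t : ℂ) ∈ truncatedSector δ R :=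
    ofReal_mem_truncatedSector ht.le hδt (by simp only [R]; linarith)
  suffices H : ∀ z ∈ truncatedSector δ R, ∑' k, expTerm (L k) (f k) b q z = 0 from H _ hmem
  have hmono : ∀ j : ℕ, ∀ z ∈ truncatedSector δ R,
      ∑' k, expTerm (L k) (f k) b (Polynomial.X ^ j) z = 0 := by
    intro j
    induction j with
    | zero =>
      intro z hz
      rw [pow_zero]
      exact tsum_expTerm_eqOn_zero hc hexp hL hf hT h0 hδ hδT (by simp only [R]; linarith) hz
    | succ j ih =>
      intro z hz
      obtain ⟨u, hu, h⟩ := exists_summable_bound_expTerm (b := b) hc hexp hL hf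
        (Polynomial.X ^ j) hδ R
      have h1 := Complex.hasSum_deriv_of_summable_norm hu
        (fun k z _ => (hasDerivAt_expTerm _ _ _ _ z).differentiableAt.differentiableWithinAt)
        (isOpen_truncatedSector δ R) h hz
      have h2 : deriv (fun w => ∑' k, expTerm (L k) (f k) b (Polynomial.X ^ j) w) z = 0 := by
        have : (fun w => ∑' k, expTerm (L k) (f k) b (Polynomial.X ^ j) w) =ᶠ[𝓝 z] fun _ => 0 := by
          filter_upwards [(isOpen_truncatedSector δ R).mem_nhds hz] with w hw using ih w hw
        rw [this.deriv_eq, deriv_const]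
      rw [h2] at h1
      simp only [(hasDerivAt_expTerm _ _ _ _ z).deriv] at h1
      have h3 := h1.neg.tsum_eq
      simpa [pow_succ] using h3
  intro z hz
  have hz0 : 0 < z.re - ‖z‖ / 2 := hδ.trans hz.1
  induction q using Polynomial.induction_on' with
  | add q r hq hr =>
    have : ∀ k, expTerm (L k) (f k) b (q + r) z
        = expTerm (L k) (f k) b q z + expTerm (L k) (f k) b r z := by
      intro k
      simp [expTerm]
    simp only [this]
    rw [Summable.tsum_add (summable_expTerm hc hexp hL hf q hz0)
      (summable_expTerm hc hexp hL hf r hz0), hq, hr, add_zero]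
  | monomial j a =>
    have : ∀ k, expTerm (L k) (f k) b (Polynomial.monomial j a) z
        = a * expTerm (L k) (f k) b (Polynomial.X ^ j) z := by
      intro k
      simp [expTerm, Polynomial.aeval_monomial, Algebra.algebraMap_eq_smul_one]
    simp only [this]
    rw [tsum_mul_left, hmono j z hz, mul_zero]

/-- Once `q` kills the other modes below `K`, the `m`-th term is minus the tail `k ≥ K`, which
decays at any prescribed rate if `K` is large. The bound `K` must not depend on `q`, since `q` is
built from the modes below `K` afterwards. -/
theorem exists_norm_expTerm_le_exp
    (h0 : ∀ q : Polynomial ℂ, ∀ t : ℝ, 0 < t → ∑' k, expTerm (L k) (f k) b q (t : ℂ) = 0)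
    (m : ℕ) (σ : ℝ) :
    ∃ K : ℕ, ∀ q : Polynomial ℂ, (∀ k < K, k ≠ m → Polynomial.aeval (L k) q = 0) →
      ∃ D : ℝ, ∀ t : ℝ, 1 ≤ t →
        ‖expTerm (L m) (f m) b q (t : ℂ)‖ ≤ D * Real.exp (-σ * t) := by
  -- This gives `K ≥ 1`, hence `K² ≥ K ≥ 2 (|σ| + c)`: half of `K²` pays for both the growth rate
  -- `c` and the decay rate `σ`.
  obtain ⟨K, hK⟩ := exists_nat_ge (2 * (|σ| + c) + 1)
  refine ⟨K, fun q hq => ?_⟩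
  obtain ⟨D, p, hD, h⟩ := exists_norm_expTerm_le (b := b) hexp hL hf q
  have hs := summable_pow_mul_exp_neg_sq p (one_half_pos (α := ℝ))
  set A := ∑' k : ℕ, ((k : ℝ) + 1) ^ p * Real.exp (-(1 / 2) * ((k : ℝ) + 1) ^ 2)
  refine ⟨D * Real.exp ((K : ℝ) ^ 2 / 2) * A, fun t ht => ?_⟩
  have ht0 : 0 < t := by linarith
  have hnorm : ‖(t : ℂ)‖ = t := by rw [Complex.norm_real, Real.norm_of_nonneg ht0.le]
  have hsum := summable_expTerm (b := b) hc hexp hL hf q (z := (t : ℂ))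
    (by rw [hnorm, Complex.ofReal_re]; linarith)
  have hz := h0 q t ht0
  rw [hsum.tsum_eq_add_tsum_ite m] at hz
  rw [eq_neg_of_add_eq_zero_left hz, norm_neg]
  have hb := (hs.mul_left (D * Real.exp ((K : ℝ) ^ 2 / 2) * Real.exp (-σ * t))).hasSum
  rw [tsum_mul_left] at hb
  refine (tsum_of_norm_bounded hb fun k => ?_).trans_eq (by ring)
  split_ifs with hk
  · rw [norm_zero]
    positivity
  · rcases lt_or_ge k K with hkK | hkK
    · rw [expTerm, hq k hkK hk]
      simp only [_root_.zero_apply, map_zero, norm_zero]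
      positivity
    · refine (h k t (by rw [Complex.ofReal_re]; exact ht0.le)).trans ?_
      -- Split `(k+1)² t / 2` at `t = 1`: one unit of time is kept for summability in `k`, and on
      -- the remaining `t - 1` the square is bounded below by `K²`.
      have e1 : c * ‖(t : ℂ)‖ - ((k : ℝ) + 1) ^ 2 * ((t : ℂ).re - ‖(t : ℂ)‖ / 2)
          ≤ (K : ℝ) ^ 2 / 2 + -σ * t + -(1 / 2) * ((k : ℝ) + 1) ^ 2 := by
        rw [hnorm, Complex.ofReal_re]
        have h1 : (K : ℝ) ≤ k := by exact_mod_cast hkK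
        have h2 : (K : ℝ) ^ 2 ≤ ((k : ℝ) + 1) ^ 2 := by
          have : (0 : ℝ) ≤ K := K.cast_nonneg
          nlinarith
        have h3 : 2 * (|σ| + c) ≤ (K : ℝ) ^ 2 := by
          have := abs_nonneg σ
          nlinarith
        have h4 := le_abs_self σ
        nlinarith [mul_le_mul_of_nonneg_right h2 (sub_nonneg.2 ht),
          mul_le_mul_of_nonneg_right h3 ht0.le, mul_le_mul_of_nonneg_right h4 ht0.le]
      calc _ ≤ D * ((k : ℝ) + 1) ^ p * Real.exp ((K : ℝ) ^ 2 / 2 + -σ * t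
                + -(1 / 2) * ((k : ℝ) + 1) ^ 2) := by gcongr
        _ = _ := by
          rw [Real.exp_add, Real.exp_add]
          ring

/-- A series of exponentials `∑ f_k(exp(-t L_k) b)` which vanishes on a time interval has only zero
terms when the `L_k` have pairwise coprime annihilating polynomials and `b` is cyclic for each of
them. -/
theorem eq_zero_of_tsum_expTerm_eq_zero {T : ℝ} (hT : 0 < T)
    (h0 : ∀ t ∈ Set.Ioo 0 T, ∑' k, expTerm (L k) (f k) b 1 (t : ℂ) = 0)
    (P : ℕ → Polynomial ℂ) (hP : ∀ k, Polynomial.aeval (L k) (P k) = 0)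
    (hcop : ∀ k l, k ≠ l → IsUnit (Polynomial.aeval (L l) (P k)))
    (hcyc : ∀ k, ∀ W : Submodule ℂ E, b ∈ W → (∀ v ∈ W, L k v ∈ W) → W = ⊤) (m : ℕ) :
    f m = 0 := by
  -- Strictly above `‖L m‖`, which bounds the rate at which `exp(-t L_m)` can decay.
  set σ := ‖L m‖ + 1
  obtain ⟨K, hK⟩ := exists_norm_expTerm_le_exp hc hexp hL hf
    (fun q t ht => tsum_expTerm_eq_zero hc hexp hL hf hT h0 q ht) m σ
  set Q : Polynomial ℂ := ∏ k ∈ (Finset.range K).erase m, P k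
  have hQ : ∀ k < K, k ≠ m → Polynomial.aeval (L k) Q = 0 := by
    intro k hk hkm
    obtain ⟨r, hr⟩ := Finset.dvd_prod_of_mem P (Finset.mem_erase.2 ⟨hkm, Finset.mem_range.2 hk⟩)
    simp only [Q]
    rw [hr, map_mul, hP, zero_mul]
  have hQu : IsUnit (Polynomial.aeval (L m) Q) := by
    refine Finset.prod_induction P (fun r => IsUnit (Polynomial.aeval (L m) r))
      (fun r s hr hs => by rw [map_mul]; exact hr.mul hs) (by simp) fun k hk => ?_
    exact hcop k m (Finset.mem_erase.1 hk).1
  -- The decay estimate is known for `b` only. Asking for it with every factor `X ^ j` makes the set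
  -- of good vectors invariant under `L m`, so cyclicity extends it to all vectors.
  let W : Submodule ℂ E :=
    { carrier := {v | ∀ j : ℕ, ∃ D : ℝ, ∀ t : ℝ, 1 ≤ t →
        ‖expTerm (L m) (f m) v (Q * Polynomial.X ^ j) (t : ℂ)‖ ≤ D * Real.exp (-σ * t)}
      add_mem' := by
        intro v w hv hw j
        obtain ⟨D, hD⟩ := hv j
        obtain ⟨D', hD'⟩ := hw j
        refine ⟨D + D', fun t ht => ?_⟩
        have : expTerm (L m) (f m) (v + w) (Q * Polynomial.X ^ j) (t : ℂ)
            = expTerm (L m) (f m) v (Q * Polynomial.X ^ j) (t : ℂ)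
              + expTerm (L m) (f m) w (Q * Polynomial.X ^ j) (t : ℂ) := by
          simp only [expTerm, map_add]
        rw [this, add_mul]
        exact (norm_add_le _ _).trans (add_le_add (hD t ht) (hD' t ht))
      zero_mem' := fun j => ⟨0, fun t _ => by simp [expTerm]⟩
      smul_mem' := by
        intro a v hv j
        obtain ⟨D, hD⟩ := hv j
        refine ⟨‖a‖ * D, fun t ht => ?_⟩
        have : expTerm (L m) (f m) (a • v) (Q * Polynomial.X ^ j) (t : ℂ)
            = a * expTerm (L m) (f m) v (Q * Polynomial.X ^ j) (t : ℂ) := by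
          simp only [expTerm, map_smul, smul_eq_mul]
        rw [this, norm_mul, mul_assoc]
        exact mul_le_mul_of_nonneg_left (hD t ht) (norm_nonneg _) }
  have hW : W = ⊤ := by
    refine hcyc m W ?_ ?_
    · intro j
      refine hK _ fun k hk hkm => ?_
      rw [map_mul, hQ k hk hkm, zero_mul]
    · intro v hv j
      obtain ⟨D, hD⟩ := hv (j + 1)
      refine ⟨D, fun t ht => ?_⟩
      have hcomm : Commute (L m) (NormedSpace.exp (-(t : ℂ) • L m)) :=
        ((Commute.refl (L m)).smul_right _).exp_right
      have : NormedSpace.exp (-(t : ℂ) • L m) (L m v) = L m (NormedSpace.exp (-(t : ℂ) • L m) v) :=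
        (congrArg (fun A : E →L[ℂ] E => A v) hcomm.eq).symm
      have : expTerm (L m) (f m) (L m v) (Q * Polynomial.X ^ j) (t : ℂ)
          = expTerm (L m) (f m) v (Q * Polynomial.X ^ (j + 1)) (t : ℂ) := by
        simp only [expTerm, this, pow_succ, map_mul, Polynomial.aeval_X,
          mul_apply_eq_comp]
      rw [this]
      exact hD t ht
  set ℓ : Set.Ici (1 : ℝ) → E →L[ℂ] ℂ := fun t =>
    ((Real.exp (σ * t) : ℝ) : ℂ) • (f m).comp
      ((Polynomial.aeval (L m) Q).comp (NormedSpace.exp (-((t : ℝ) : ℂ) • L m)))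
  have hbd : ∀ v, ∃ D, ∀ t, ‖ℓ t v‖ ≤ D := by
    intro v
    have hv : v ∈ W := hW ▸ Submodule.mem_top
    obtain ⟨D, hD⟩ := hv 0
    refine ⟨D, fun t => ?_⟩
    have h1 := hD t t.2
    have h2 : ℓ t v = ((Real.exp (σ * t) : ℝ) : ℂ)
        * expTerm (L m) (f m) v (Q * Polynomial.X ^ 0) ((t : ℝ) : ℂ) := by
      simp [ℓ, expTerm]
    rw [h2, norm_mul, Complex.norm_real, Real.norm_of_nonneg (Real.exp_pos _).le]
    calc _ ≤ Real.exp (σ * t) * (D * Real.exp (-σ * t)) := by gcongr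
      _ = D := by
        rw [mul_left_comm, ← Real.exp_add]
        simp
  -- The constants so far depend on the vector; a uniform one is needed to insert the time-dependent
  -- vector `exp(t L_m) v`, which undoes the evolution at a cost of only `exp(t ‖L m‖)`.
  obtain ⟨D, hD⟩ := banach_steinhaus hbd
  have hzero : ∀ v, f m (Polynomial.aeval (L m) Q v) = 0 := by
    intro v
    have hle : ∀ t : ℝ, 1 ≤ t → ‖f m (Polynomial.aeval (L m) Q v)‖
        ≤ D * ‖v‖ * Real.exp (-t) := by
      intro t ht
      have h1 : f m (Polynomial.aeval (L m) Q v)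
          = ((Real.exp (-(σ * t)) : ℝ) : ℂ) * ℓ ⟨t, ht⟩ (NormedSpace.exp ((t : ℂ) • L m) v) := by
        have h2 : NormedSpace.exp (-(t : ℂ) • L m) (NormedSpace.exp ((t : ℂ) • L m) v) = v := by
          have : NormedSpace.exp (-(t : ℂ) • L m) * NormedSpace.exp ((t : ℂ) • L m) = 1 := by
            rw [← exp_add_eq_mul (((Commute.refl (L m)).smul_left _).smul_right _), neg_smul,
              neg_add_cancel, NormedSpace.exp_zero]
          exact congrArg (fun A : E →L[ℂ] E => A v) this
        simp only [ℓ, _root_.smul_apply, ContinuousLinearMap.comp_apply, h2,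
          smul_eq_mul]
        rw [← mul_assoc, ← Complex.ofReal_mul, ← Real.exp_add]
        simp
      rw [h1, norm_mul, Complex.norm_real, Real.norm_of_nonneg (Real.exp_pos _).le]
      have h3 : ‖NormedSpace.exp ((t : ℂ) • L m) v‖ ≤ Real.exp (t * ‖L m‖) * ‖v‖ := by
        refine ContinuousLinearMap.le_of_opNorm_le _ ((norm_exp_le_exp_norm _).trans_eq ?_) v
        rw [norm_smul, Complex.norm_real, Real.norm_of_nonneg (by linarith)]
      calc _ ≤ Real.exp (-(σ * t)) * (D * (Real.exp (t * ‖L m‖) * ‖v‖)) := by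
            gcongr
            exact ContinuousLinearMap.le_of_opNorm_le_of_le _ (hD _) h3
        _ = D * ‖v‖ * Real.exp (-(σ * t) + t * ‖L m‖) := by
            rw [Real.exp_add]
            ring
        _ = D * ‖v‖ * Real.exp (-t) := by
            congr 2
            simp only [σ]
            ring
    have hlim : Tendsto (fun t : ℝ => D * ‖v‖ * Real.exp (-t)) atTop (𝓝 0) := by
      simpa using Real.tendsto_exp_neg_atTop_nhds_zero.const_mul (D * ‖v‖)
    exact norm_le_zero_iff.1
      (ge_of_tendsto hlim (eventually_atTop.2 ⟨1, fun t ht => hle t ht⟩))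
  ext v
  -- Since `Q(L_m)` is invertible, every vector is in its range, where `f m` has been shown to
  -- vanish.
  obtain ⟨u, hu⟩ := hQu
  have := hzero ((↑u⁻¹ : E →L[ℂ] E) v)
  rw [← hu, ← mul_apply_eq_comp, Units.mul_inv] at this
  simpa using this

end

end ExponentialSeries

/-! ### The matrices of the sine modes -/

section ModeMatrix

variable (n : ℕ) (d α : ℝ)

/-- The real matrix `(k+1)² D + A` of the `k`-th sine mode. -/
noncomputable def modeMatrix (k : ℕ) : Matrix (Fin n) (Fin n) ℝ :=
  ((k : ℝ) + 1) ^ 2 • matD n d + matA n α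

/-- The complex matrix `(k+1)² D + A` of the `k`-th sine mode. -/
noncomputable def modeMatrixℂ (k : ℕ) : Matrix (Fin n) (Fin n) ℂ :=
  (modeMatrix n d α k).map Complex.ofReal

/-- The operator of the `k`-th sine mode on `ℝⁿ`. -/
noncomputable def modeOp (k : ℕ) : EuclideanSpace ℝ (Fin n) →L[ℝ] EuclideanSpace ℝ (Fin n) :=
  Matrix.toEuclideanCLM (n := Fin n) (𝕜 := ℝ) (modeMatrix n d α k)

/-- The operator of the `k`-th sine mode on `ℂⁿ`. -/
noncomputable def modeOpℂ (k : ℕ) : EuclideanSpace ℂ (Fin n) →L[ℂ] EuclideanSpace ℂ (Fin n) :=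
  Matrix.toEuclideanCLM (n := Fin n) (𝕜 := ℂ) (modeMatrixℂ n d α k)

/-- The inclusion `ℝⁿ → ℂⁿ`. -/
noncomputable def toComplex (n : ℕ) : EuclideanSpace ℝ (Fin n) →L[ℝ] EuclideanSpace ℂ (Fin n) :=
  LinearMap.toContinuousLinearMap
    { toFun := fun v => WithLp.toLp 2 fun i => (v i : ℂ)
      map_add' := fun v w => by ext i; simp
      map_smul' := fun c v => by ext i; simp }

@[simp]
theorem toComplex_apply (v : EuclideanSpace ℝ (Fin n)) (i : Fin n) :
    toComplex n v i = (v i : ℂ) := rfl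

theorem norm_toComplex (v : EuclideanSpace ℝ (Fin n)) : ‖toComplex n v‖ = ‖v‖ := by
  simp [EuclideanSpace.norm_eq]

theorem inner_toComplex (v w : EuclideanSpace ℝ (Fin n)) :
    inner ℂ (toComplex n v) (toComplex n w) = ((inner ℝ v w : ℝ) : ℂ) := by
  simp [PiLp.inner_apply]

theorem modeOp_apply (k : ℕ) (v : EuclideanSpace ℝ (Fin n)) :
    modeOp n d α k v = act (modeMatrix n d α k) v := rfl

theorem modeOpℂ_apply (k : ℕ) (v : EuclideanSpace ℂ (Fin n)) :
    modeOpℂ n d α k v = act (modeMatrixℂ n d α k) v := rfl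

theorem modeOp_eq_act_add (k : ℕ) (v : EuclideanSpace ℝ (Fin n)) :
    modeOp n d α k v = ((k : ℝ) + 1) ^ 2 • act (matD n d) v + act (matA n α) v := by
  rw [modeOp_apply, modeMatrix]
  simp [act, Matrix.add_mulVec, Matrix.smul_mulVec]

theorem modeOpℂ_toComplex (k : ℕ) (v : EuclideanSpace ℝ (Fin n)) :
    modeOpℂ n d α k (toComplex n v) = toComplex n (modeOp n d α k v) := by
  ext i
  simp [modeOpℂ_apply, modeOp_apply, act, Matrix.mulVec, dotProduct, modeMatrixℂ]

theorem hasSum_exp_apply {𝕜 E : Type*} [RCLike 𝕜] [NormedAddCommGroup E] [NormedSpace 𝕜 E]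
    [CompleteSpace E] (A : E →L[𝕜] E) (v : E) :
    HasSum (fun j : ℕ => ((j.factorial : 𝕜)⁻¹) • (A ^ j) v) (NormedSpace.exp A v) := by
  have h := NormedSpace.exp_series_hasSum_exp' (𝕂 := 𝕜) A
  simpa using h.mapL (ContinuousLinearMap.apply 𝕜 E v)

theorem exp_modeOpℂ_toComplex (k : ℕ) (t : ℝ) (v : EuclideanSpace ℝ (Fin n)) :
    NormedSpace.exp (-(t : ℂ) • modeOpℂ n d α k) (toComplex n v)
      = toComplex n (NormedSpace.exp (-t • modeOp n d α k) v) := by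
  have h1 := hasSum_exp_apply (-(t : ℂ) • modeOpℂ n d α k) (toComplex n v)
  have h2 := (hasSum_exp_apply (-t • modeOp n d α k) v).mapL (toComplex n)
  refine h1.unique ?_
  convert! h2 using 1
  ext j : 1
  have hpow : ∀ j : ℕ, ((-(t : ℂ) • modeOpℂ n d α k) ^ j) (toComplex n v)
      = toComplex n (((-t • modeOp n d α k) ^ j) v) := by
    intro j
    induction j with
    | zero => simp
    | succ j ih =>
      rw [pow_succ', pow_succ', mul_apply_eq_comp, mul_apply_eq_comp, ih]
      generalize ((-t • modeOp n d α k) ^ j) v = w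
      rw [_root_.smul_apply, _root_.smul_apply, modeOpℂ_toComplex, map_smul]
      ext i
      simp
  rw [hpow, map_smul]
  ext i
  simp

theorem matD_eq_add : ∃ N : Matrix (Fin n) (Fin n) ℝ, matD n d = d • 1 + N ∧
    ∀ i j, N i j = if (i : ℕ) + 1 = (j : ℕ) then 1 else 0 := by
  refine ⟨Matrix.of fun i j => if (i : ℕ) + 1 = (j : ℕ) then 1 else 0, ?_, fun i j => rfl⟩
  ext i j
  by_cases h : i = j
  · subst h
    simp [matD]
  · simp [matD, h]

/-- Up to conjugation by a fixed matrix, `(k+1)² D + A - (k+1)² d` is at most `(k+1)²/2` up to a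
bounded term. -/
theorem exists_modeOpℂ_conj : ∃ (U : (EuclideanSpace ℂ (Fin n) →L[ℂ] EuclideanSpace ℂ (Fin n))ˣ)
    (c : ℝ), 0 ≤ c ∧ ∀ k : ℕ, ∃ R : EuclideanSpace ℂ (Fin n) →L[ℂ] EuclideanSpace ℂ (Fin n),
      ‖R‖ ≤ ((k : ℝ) + 1) ^ 2 / 2 + c ∧
      modeOpℂ n d α k = U * ((((((k : ℝ) + 1) ^ 2 * d : ℝ) : ℂ)) • 1 + R) * (↑U⁻¹) := by
  obtain ⟨N, hD, hN⟩ := matD_eq_add n d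
  set N' := Matrix.toEuclideanCLM (n := Fin n) (𝕜 := ℂ) (N.map Complex.ofReal)
  -- Conjugation by `diag(η^i)` multiplies the superdiagonal part by `η`; this choice makes its norm
  -- at most `1/2`. The `+ 1` covers `N' = 0`.
  set η : ℝ := 1 / (2 * (‖N'‖ + 1)) with hη
  have hη0 : 0 < η := by positivity
  have hηN : η * ‖N'‖ ≤ 1 / 2 := by
    rw [hη, div_mul_eq_mul_div, one_mul, div_le_iff₀ (by positivity)]
    linarith [norm_nonneg N']
  have hηc : (η : ℂ) ≠ 0 := by exact_mod_cast hη0.ne'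
  let S : (Matrix (Fin n) (Fin n) ℂ)ˣ :=
    { val := Matrix.diagonal fun i => (η : ℂ) ^ (i : ℕ)
      inv := Matrix.diagonal fun i => ((η : ℂ) ^ (i : ℕ))⁻¹
      val_inv := by
        rw [Matrix.diagonal_mul_diagonal, ← Matrix.diagonal_one]
        congr 1
        ext i
        exact mul_inv_cancel₀ (pow_ne_zero _ hηc)
      inv_val := by
        rw [Matrix.diagonal_mul_diagonal, ← Matrix.diagonal_one]
        congr 1
        ext i
        exact inv_mul_cancel₀ (pow_ne_zero _ hηc) }
  set Sv : Matrix (Fin n) (Fin n) ℂ := S.val with hSv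
  set Si : Matrix (Fin n) (Fin n) ℂ := (S⁻¹).val with hSi
  have hvi : Sv * Si = 1 := S.mul_inv
  let A' : Matrix (Fin n) (Fin n) ℂ := Si * (matA n α).map Complex.ofReal * Sv
  have hconj : Si * N.map Complex.ofReal * Sv
      = (η : ℂ) • N.map Complex.ofReal := by
    change Matrix.diagonal _ * _ * Matrix.diagonal _ = _
    ext i j
    rw [Matrix.mul_diagonal, Matrix.diagonal_mul, Matrix.smul_apply, Matrix.map_apply, hN]
    split_ifs with h
    · rw [← h, pow_succ]
      field_simp
      simp
    · simp
  let Φ : Matrix (Fin n) (Fin n) ℂ →*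
      (EuclideanSpace ℂ (Fin n) →L[ℂ] EuclideanSpace ℂ (Fin n)) :=
    (Matrix.toEuclideanCLM (n := Fin n) (𝕜 := ℂ) : _ →* _)
  refine ⟨Units.map Φ S, ‖Matrix.toEuclideanCLM (n := Fin n) (𝕜 := ℂ) A'‖, norm_nonneg _,
    fun k => ⟨Matrix.toEuclideanCLM (n := Fin n) (𝕜 := ℂ)
      (((((k : ℝ) + 1) ^ 2 * η : ℝ) : ℂ) • N.map Complex.ofReal + A'), ?_, ?_⟩⟩
  · rw [map_add, map_smul]
    refine (norm_add_le _ _).trans (add_le_add ?_ le_rfl)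
    rw [norm_smul, Complex.norm_real, Real.norm_of_nonneg (by positivity), mul_assoc]
    change _ * (η * ‖N'‖) ≤ _
    nlinarith [sq_nonneg ((k : ℝ) + 1)]
  · have hM : modeMatrixℂ n d α k = Sv * (((((k : ℝ) + 1) ^ 2 * d : ℝ) : ℂ) • 1
        + (((((k : ℝ) + 1) ^ 2 * η : ℝ) : ℂ) • N.map Complex.ofReal + A')) * Si := by
      have h1 : N.map Complex.ofReal = Sv * ((η : ℂ) • N.map Complex.ofReal) * Si := by
        rw [← hconj]
        simp only [← mul_assoc, hvi, one_mul]
        rw [mul_assoc, hvi, mul_one]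
      have h2 : (matA n α).map Complex.ofReal = Sv * A' * Si := by
        simp only [A', ← mul_assoc, hvi, one_mul]
        rw [mul_assoc, hvi, mul_one]
      have h3 : modeMatrixℂ n d α k = ((((k : ℝ) + 1) ^ 2 * d : ℝ) : ℂ) • 1
          + ((((k : ℝ) + 1) ^ 2 : ℝ) : ℂ) • N.map Complex.ofReal
          + (matA n α).map Complex.ofReal := by
        ext i j
        rw [modeMatrixℂ, modeMatrix, hD]
        by_cases h : i = j
        · subst h
          simp
        · simp [h]
      rw [h3]
      conv_lhs => rw [h1, h2]
      simp only [mul_add, add_mul, Matrix.mul_smul, Matrix.smul_mul, mul_one, hvi,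
        smul_smul, Complex.ofReal_mul, add_assoc]
    unfold modeOpℂ
    rw [hM, map_mul, map_mul, map_add, map_smul, map_one]
    rfl

-- The scalar part contributes `exp(-(k+1)² d Re z)` and the remainder at most `exp(‖z‖ ((k+1)²/2 +
-- c))`; `d ≥ 1` and `Re z ≥ 0` combine them. The conjugating matrix does not depend on `k`, so
-- neither does the constant. In real time this is decay at rate `(k+1)²/2` up to `exp(c t)`.
variable {d} in
theorem exists_norm_exp_modeOpℂ_le (hd : 1 ≤ d) : ∃ C c : ℝ, 0 ≤ C ∧ 0 ≤ c ∧
    ∀ (k : ℕ) (z : ℂ), 0 ≤ z.re → ‖NormedSpace.exp (-z • modeOpℂ n d α k)‖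
      ≤ C * Real.exp (c * ‖z‖ - ((k : ℝ) + 1) ^ 2 * (z.re - ‖z‖ / 2)) := by
  obtain ⟨U, c, hc, h⟩ := exists_modeOpℂ_conj n d α
  refine ⟨‖(U : EuclideanSpace ℂ (Fin n) →L[ℂ] EuclideanSpace ℂ (Fin n))‖
    * ‖(↑U⁻¹ : EuclideanSpace ℂ (Fin n) →L[ℂ] EuclideanSpace ℂ (Fin n))‖, c, by positivity, hc,
    fun k z hz => ?_⟩
  obtain ⟨R, hR, hM⟩ := h k
  let _ : NormedAlgebra ℚ (EuclideanSpace ℂ (Fin n) →L[ℂ] EuclideanSpace ℂ (Fin n)) :=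
    .restrictScalars ℚ ℂ _
  set a : ℂ := -z * ((((k : ℝ) + 1) ^ 2 * d : ℝ) : ℂ)
  have h1 : -z • modeOpℂ n d α k = U * (algebraMap ℂ _ a + -z • R) * (↑U⁻¹) := by
    rw [hM, Algebra.algebraMap_eq_smul_one]
    simp only [mul_add, add_mul, smul_add, mul_smul_comm, smul_mul_assoc, smul_smul, a]
  have h2 : NormedSpace.exp (algebraMap ℂ (EuclideanSpace ℂ (Fin n) →L[ℂ] EuclideanSpace ℂ (Fin n))
      a + -z • R) = Complex.exp a • NormedSpace.exp (-z • R) := by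
    rw [exp_add_eq_mul (Algebra.commute_algebraMap_left a _), ← NormedSpace.algebraMap_exp_comm,
      ← Complex.exp_eq_exp_ℂ, Algebra.algebraMap_eq_smul_one, smul_one_mul]
  rw [h1, NormedSpace.exp_units_conj, h2]
  have h3 : ‖Complex.exp a • NormedSpace.exp (-z • R)‖
      ≤ Real.exp (c * ‖z‖ - ((k : ℝ) + 1) ^ 2 * (z.re - ‖z‖ / 2)) := by
    rw [norm_smul, Complex.norm_exp]
    refine (mul_le_mul_of_nonneg_left (norm_exp_le_exp_norm _) (Real.exp_pos _).le).trans ?_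
    rw [← Real.exp_add, Real.exp_le_exp, norm_smul, norm_neg]
    have e1 : a.re = -z.re * (((k : ℝ) + 1) ^ 2 * d) := by
      rw [Complex.re_mul_ofReal, Complex.neg_re]
    rw [e1]
    have e2 := mul_le_mul_of_nonneg_left hR (norm_nonneg z)
    have e3 : z.re * ((k : ℝ) + 1) ^ 2 * 1 ≤ z.re * ((k : ℝ) + 1) ^ 2 * d :=
      mul_le_mul_of_nonneg_left hd (by positivity)
    nlinarith
  calc _ ≤ ‖(U : EuclideanSpace ℂ (Fin n) →L[ℂ] EuclideanSpace ℂ (Fin n))‖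
        * ‖Complex.exp a • NormedSpace.exp (-z • R)‖
        * ‖(↑U⁻¹ : EuclideanSpace ℂ (Fin n) →L[ℂ] EuclideanSpace ℂ (Fin n))‖ :=
        (norm_mul_le _ _).trans (mul_le_mul_of_nonneg_right (norm_mul_le _ _) (norm_nonneg _))
    _ ≤ ‖(U : EuclideanSpace ℂ (Fin n) →L[ℂ] EuclideanSpace ℂ (Fin n))‖
        * Real.exp (c * ‖z‖ - ((k : ℝ) + 1) ^ 2 * (z.re - ‖z‖ / 2))
        * ‖(↑U⁻¹ : EuclideanSpace ℂ (Fin n) →L[ℂ] EuclideanSpace ℂ (Fin n))‖ := by gcongr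
    _ = _ := by ring

variable {d} in
theorem exists_norm_exp_modeOp_le (hd : 1 ≤ d) : ∃ C c : ℝ, 0 ≤ C ∧ 0 ≤ c ∧
    ∀ (k : ℕ) (t : ℝ), 0 ≤ t → ∀ v, ‖NormedSpace.exp (-t • modeOp n d α k) v‖
      ≤ C * Real.exp (c * t) * Real.exp (-(((k : ℝ) + 1) ^ 2 / 2) * t) * ‖v‖ := by
  obtain ⟨C, c, hC, hc, h⟩ := exists_norm_exp_modeOpℂ_le n α hd
  refine ⟨C, c, hC, hc, fun k t ht v => ?_⟩
  rw [← norm_toComplex, ← exp_modeOpℂ_toComplex, ← norm_toComplex n v]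
  refine ContinuousLinearMap.le_of_opNorm_le _ ((h k t (by simpa using ht)).trans_eq ?_) _
  rw [Complex.norm_real, Real.norm_of_nonneg ht, Complex.ofReal_re, mul_assoc, ← Real.exp_add]
  congr 2
  ring

theorem exists_norm_modeOpℂ_le : ∃ C : ℝ, 0 ≤ C ∧
    ∀ k : ℕ, ‖modeOpℂ n d α k‖ ≤ C * ((k : ℝ) + 1) ^ 2 := by
  set D' := Matrix.toEuclideanCLM (n := Fin n) (𝕜 := ℂ) ((matD n d).map Complex.ofReal)
  set A' := Matrix.toEuclideanCLM (n := Fin n) (𝕜 := ℂ) ((matA n α).map Complex.ofReal)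
  refine ⟨‖D'‖ + ‖A'‖, by positivity, fun k => ?_⟩
  have h : modeOpℂ n d α k = ((((k : ℝ) + 1) ^ 2 : ℝ) : ℂ) • D' + A' := by
    rw [modeOpℂ, ← map_smul, ← map_add]
    congr 1
    ext i j
    simp [modeMatrixℂ, modeMatrix]
  rw [h]
  refine (norm_add_le _ _).trans ?_
  rw [norm_smul, Complex.norm_real, Real.norm_of_nonneg (by positivity), add_mul, mul_comm]
  gcongr
  have hk : (0 : ℝ) ≤ k := k.cast_nonneg
  nlinarith [norm_nonneg A', mul_nonneg (norm_nonneg A') hk,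
    mul_nonneg (norm_nonneg A') (mul_nonneg hk hk)]

theorem modeMatrix_apply_of_pos (k : ℕ) (i j : Fin n) (hj : 0 < (j : ℕ)) :
    modeMatrix n d α k i j = ((k : ℝ) + 1) ^ 2 * (if i = j then d else 0)
      + ((k : ℝ) + 1) ^ 2 * (if (i : ℕ) + 1 = (j : ℕ) then 1 else 0) := by
  have hA : matA n α i j = 0 := by simp [matA, hj.ne']
  rw [modeMatrix, Matrix.add_apply, hA, Matrix.smul_apply, matD]
  by_cases h : i = j
  · subst h
    simp
  · simp [h]

theorem modeOpℂ_single (k : ℕ) (i j : Fin n) (hij : (i : ℕ) + 1 = j) :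
    modeOpℂ n d α k (EuclideanSpace.single j 1)
      = (((((k : ℝ) + 1) ^ 2 * d : ℝ) : ℂ)) • EuclideanSpace.single j (1 : ℂ)
        + ((((k : ℝ) + 1) ^ 2 : ℝ) : ℂ) • EuclideanSpace.single i (1 : ℂ) := by
  ext l
  have h1 : modeOpℂ n d α k (EuclideanSpace.single j 1) l = (modeMatrix n d α k l j : ℂ) := by
    simp [modeOpℂ_apply, act, modeMatrixℂ]
  rw [h1, modeMatrix_apply_of_pos n d α k l j (by omega)]
  have h2 : ((l : ℕ) + 1 = (j : ℕ)) ↔ l = i := by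
    rw [Fin.ext_iff]
    omega
  simp only [h2]
  simp only [mul_ite, mul_zero, mul_one, PiLp.add_apply, PiLp.smul_apply, PiLp.single_apply,
    smul_eq_mul, Complex.ofReal_add, apply_ite Complex.ofReal, Complex.ofReal_zero]

/-- The last basis vector is cyclic for every mode. -/
theorem modeOpℂ_cyclic (k : ℕ) (W : Submodule ℂ (EuclideanSpace ℂ (Fin n)))
    (hB : toComplex n (vecB n) ∈ W) (hW : ∀ v ∈ W, modeOpℂ n d α k v ∈ W) : W = ⊤ := by
  -- Descend from the last basis vector, `m` being the distance to it. The coupling `α` sits in the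
  -- first column, so a vector `e_j` with `j > 0` is sent to a combination of `e_j` and `e_{j-1}`,
  -- with coefficient `(k+1)² ≠ 0` on the latter.
  have key : ∀ (m : ℕ) (j : Fin n), (j : ℕ) + m + 1 = n → EuclideanSpace.single j (1 : ℂ) ∈ W := by
    intro m
    induction m with
    | zero =>
      intro j hj
      convert hB using 1
      ext i
      have : i = j ↔ (i : ℕ) + 1 = n := by
        rw [Fin.ext_iff]
        omega
      by_cases h : (i : ℕ) + 1 = n <;> simp [vecB, this, h]
    | succ m ih =>
      intro i hi
      set j : Fin n := ⟨i + 1, by omega⟩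
      have hj : EuclideanSpace.single j (1 : ℂ) ∈ W := ih j (by simp only [j]; omega)
      have h1 := W.sub_mem (hW _ hj) (W.smul_mem (((((k : ℝ) + 1) ^ 2 * d : ℝ) : ℂ)) hj)
      rw [modeOpℂ_single n d α k i j rfl, add_sub_cancel_left] at h1
      refine (W.smul_mem_iff ?_).1 h1
      rw [Complex.ofReal_ne_zero]
      positivity
  refine Submodule.eq_top_iff'.2 fun v => ?_
  rw [← (EuclideanSpace.basisFun (Fin n) ℂ).sum_repr v]
  refine W.sum_mem fun i _ => W.smul_mem _ ?_
  rw [EuclideanSpace.basisFun_apply]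
  exact key (n - 1 - i) i (by omega)

/-- Distinct modes have no common eigenvalue. -/
def DisjointModeSpectra : Prop :=
  ∀ k l : ℕ, k ≠ l → Disjoint (spectrum ℂ (modeMatrixℂ n d α k)) (spectrum ℂ (modeMatrixℂ n d α l))

/-- Left eigenvectors are the right notion here: `L*` acts on a sine mode through the transpose of
the mode matrix. -/
theorem mem_spectrum_iff_exists_vecMul (M : Matrix (Fin n) (Fin n) ℂ) (μ : ℂ) :
    μ ∈ spectrum ℂ M ↔ ∃ V : Fin n → ℂ, V ≠ 0 ∧ V ᵥ* M = μ • V := by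
  rw [spectrum.mem_iff, Matrix.isUnit_iff_isUnit_det, isUnit_iff_ne_zero, not_not,
    ← Matrix.exists_vecMul_eq_zero_iff]
  refine exists_congr fun V => and_congr_right fun _ => ?_
  rw [Matrix.vecMul_sub, Algebra.algebraMap_eq_smul_one, Matrix.vecMul_smul, Matrix.vecMul_one,
    sub_eq_zero, eq_comm]

/-- Hautus test: the kernel of the functional `V` is invariant under the mode matrix, so if it
contains the cyclic vector `B` it is everything. -/
theorem eq_zero_of_vecMul_eq {k : ℕ} {μ : ℂ} {V : Fin n → ℂ}
    (hV : V ᵥ* modeMatrixℂ n d α k = μ • V)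
    (h0 : V ⬝ᵥ (toComplex n (vecB n)).ofLp = 0) : V = 0 := by
  let W : Submodule ℂ (EuclideanSpace ℂ (Fin n)) :=
    { carrier := {v | V ⬝ᵥ v.ofLp = 0}
      add_mem' := by
        intro v w (hv : _ = _) (hw : _ = _)
        simp [hv, hw]
      zero_mem' := by simp
      smul_mem' := by
        intro c v (hv : _ = _)
        simp [hv] }
  have hW : W = ⊤ := by
    refine modeOpℂ_cyclic n d α k W h0 fun v (hv : _ = _) => ?_
    change V ⬝ᵥ (modeMatrixℂ n d α k *ᵥ v.ofLp) = 0
    rw [Matrix.dotProduct_mulVec, hV, smul_dotProduct, hv, smul_zero]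
  ext i
  have : EuclideanSpace.single i (1 : ℂ) ∈ W := hW ▸ Submodule.mem_top
  have h : V ⬝ᵥ (EuclideanSpace.single i (1 : ℂ)).ofLp = 0 := this
  simpa using h

theorem aeval_modeOpℂ (k : ℕ) (p : Polynomial ℂ) : Polynomial.aeval (modeOpℂ n d α k) p
    = Matrix.toEuclideanCLM (n := Fin n) (𝕜 := ℂ) (Polynomial.aeval (modeMatrixℂ n d α k) p) :=
  Polynomial.aeval_algHom_apply
    ((Matrix.toEuclideanCLM (n := Fin n) (𝕜 := ℂ)).toAlgEquiv.toAlgHom) (modeMatrixℂ n d α k) p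

theorem aeval_modeOpℂ_charpoly (k : ℕ) :
    Polynomial.aeval (modeOpℂ n d α k) (modeMatrixℂ n d α k).charpoly = 0 := by
  rw [aeval_modeOpℂ, Matrix.aeval_self_charpoly, map_zero]

-- By spectral mapping, a zero eigenvalue of `χ_k(L_l)` would be an eigenvalue of `L_l` that is a
-- root of `χ_k`, hence common to both modes. Positivity of `n` makes the degree of `χ_k` positive,
-- as the mapping theorem requires.
variable {n d α} in
theorem DisjointModeSpectra.isUnit_aeval (hn : 0 < n) (h : DisjointModeSpectra n d α) {k l : ℕ}
    (hkl : k ≠ l) :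
    IsUnit (Polynomial.aeval (modeOpℂ n d α l) (modeMatrixℂ n d α k).charpoly) := by
  rw [aeval_modeOpℂ]
  refine IsUnit.map (Matrix.toEuclideanCLM (n := Fin n) (𝕜 := ℂ)) ?_
  by_contra hcon
  have h0 : (0 : ℂ) ∈ spectrum ℂ
      (Polynomial.aeval (modeMatrixℂ n d α l) (modeMatrixℂ n d α k).charpoly) := by
    rwa [spectrum.zero_mem_iff]
  rw [spectrum.map_polynomial_aeval_of_degree_pos] at h0
  · obtain ⟨μ, hμ, hμ0⟩ := h0
    refine Set.disjoint_left.1 (h k l hkl) ?_ hμ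
    exact Matrix.mem_spectrum_iff_isRoot_charpoly.2 hμ0
  · rw [Matrix.charpoly_degree_eq_dim]
    simpa using hn

theorem disjointModeSpectra_of_eq_zero {d : ℝ} (hd : d ≠ 0) : DisjointModeSpectra n d 0 := by
  have key : ∀ k : ℕ, ∀ μ ∈ spectrum ℂ (modeMatrixℂ n d 0 k),
      μ = ((((k : ℝ) + 1) ^ 2 * d : ℝ) : ℂ) := by
    intro k μ hμ
    rw [Matrix.mem_spectrum_iff_isRoot_charpoly, Matrix.charpoly_of_isUpperTriangular] at hμ
    · rw [Polynomial.IsRoot, Polynomial.eval_prod, Finset.prod_eq_zero_iff] at hμ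
      obtain ⟨i, -, hi⟩ := hμ
      rw [Polynomial.eval_sub, Polynomial.eval_X, Polynomial.eval_C, sub_eq_zero] at hi
      rw [hi]
      simp [modeMatrixℂ, modeMatrix, matD, matA]
    · intro i j hij
      have hij' : j < i := hij
      have h1 : i ≠ j := hij'.ne'
      have h2 : ¬ (i : ℕ) + 1 = (j : ℕ) := by
        rw [Fin.lt_def] at hij'
        omega
      simp [modeMatrixℂ, modeMatrix, matD, matA, h1, h2]
  intro k l hkl
  refine Set.disjoint_left.2 fun μ hk hl => hkl ?_
  have h := (key k μ hk).symm.trans (key l μ hl)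
  rw [Complex.ofReal_inj] at h
  have h2 := mul_right_cancel₀ hd h
  have h3 : (k : ℝ) + 1 = l + 1 := (pow_left_inj₀ (by positivity) (by positivity) two_ne_zero).1 h2
  exact_mod_cast add_right_cancel h3

end ModeMatrix

/-! ### Sine and cosine modes -/

section Modes

/-- The normalized sine functions, `k`-th one of frequency `k + 1`. -/
noncomputable def sinMode (k : ℕ) (x : ℝ) : ℝ := √(2 / Real.pi) * Real.sin (((k : ℝ) + 1) * x)

/-- The normalized cosine functions, `k`-th one of frequency `k + 1`. -/
noncomputable def cosMode (k : ℕ) (x : ℝ) : ℝ := √(2 / Real.pi) * Real.cos (((k : ℝ) + 1) * x)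

theorem contDiff_sinMode (k : ℕ) {m : WithTop ℕ∞} : ContDiff ℝ m (sinMode k) := by
  unfold sinMode
  fun_prop

theorem contDiff_cosMode (k : ℕ) {m : WithTop ℕ∞} : ContDiff ℝ m (cosMode k) := by
  unfold cosMode
  fun_prop

theorem hasDerivAt_sinMode (k : ℕ) (x : ℝ) :
    HasDerivAt (sinMode k) (((k : ℝ) + 1) * cosMode k x) x := by
  have h := ((Real.hasDerivAt_sin (((k : ℝ) + 1) * x)).comp x
    ((hasDerivAt_id x).const_mul ((k : ℝ) + 1))).const_mul √(2 / Real.pi)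
  convert! h using 1
  simp [cosMode]
  ring

theorem hasDerivAt_cosMode (k : ℕ) (x : ℝ) :
    HasDerivAt (cosMode k) (-(((k : ℝ) + 1) * sinMode k x)) x := by
  have h := ((Real.hasDerivAt_cos (((k : ℝ) + 1) * x)).comp x
    ((hasDerivAt_id x).const_mul ((k : ℝ) + 1))).const_mul √(2 / Real.pi)
  convert! h using 1
  simp [sinMode]
  ring

theorem deriv_sinMode (k : ℕ) : deriv (sinMode k) = fun x => ((k : ℝ) + 1) * cosMode k x :=
  funext fun x => (hasDerivAt_sinMode k x).deriv

theorem deriv_cosMode (k : ℕ) : deriv (cosMode k) = fun x => -(((k : ℝ) + 1) * sinMode k x) :=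
  funext fun x => (hasDerivAt_cosMode k x).deriv

theorem sinMode_zero (k : ℕ) : sinMode k 0 = 0 := by simp [sinMode]

theorem sinMode_pi (k : ℕ) : sinMode k Real.pi = 0 := by
  have := Real.sin_nat_mul_pi (k + 1)
  push_cast at this
  simp [sinMode, this]

theorem abs_sinMode_le (k : ℕ) (x : ℝ) : |sinMode k x| ≤ √(2 / Real.pi) := by
  rw [sinMode, abs_mul, abs_of_nonneg (Real.sqrt_nonneg _)]
  exact mul_le_of_le_one_right (Real.sqrt_nonneg _) (Real.abs_sin_le_one _)

theorem abs_cosMode_le (k : ℕ) (x : ℝ) : |cosMode k x| ≤ √(2 / Real.pi) := by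
  rw [cosMode, abs_mul, abs_of_nonneg (Real.sqrt_nonneg _)]
  exact mul_le_of_le_one_right (Real.sqrt_nonneg _) (Real.abs_cos_le_one _)

theorem sinMode_eq_zero_iff (k : ℕ) (x : ℝ) : sinMode k x = 0 ↔ Real.sin (((k : ℝ) + 1) * x) = 0 := by
  have : √(2 / Real.pi) ≠ 0 := by
    have := Real.pi_pos
    positivity
  rw [sinMode, mul_eq_zero, or_iff_right this]

theorem integral_cos_int_mul (m : ℤ) :
    ∫ x in (0 : ℝ)..Real.pi, Real.cos (m * x) = if m = 0 then Real.pi else 0 := by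
  split_ifs with h
  · simp [h]
  · have hm : (m : ℝ) ≠ 0 := by exact_mod_cast h
    rw [intervalIntegral.integral_comp_mul_left (fun x => Real.cos x) hm, integral_cos]
    simp [Real.sin_int_mul_pi]

theorem integral_sinMode_mul (j k : ℕ) :
    ∫ x, sinMode j x * sinMode k x ∂domainMeasure = if j = k then 1 else 0 := by
  have h1 : ∀ x, sinMode j x * sinMode k x = (1 / Real.pi) *
      (Real.cos (((j - k : ℤ) : ℝ) * x) - Real.cos (((j + k + 2 : ℤ) : ℝ) * x)) := by
    intro x
    have e1 : ((j - k : ℤ) : ℝ) * x = ((j : ℝ) + 1) * x - ((k : ℝ) + 1) * x := by push_cast; ring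
    have e2 : ((j + k + 2 : ℤ) : ℝ) * x = ((j : ℝ) + 1) * x + ((k : ℝ) + 1) * x := by
      push_cast; ring
    rw [e1, e2, Real.cos_sub, Real.cos_add, sinMode, sinMode]
    have : √(2 / Real.pi) * √(2 / Real.pi) = 2 / Real.pi :=
      Real.mul_self_sqrt (by have := Real.pi_pos; positivity)
    linear_combination (Real.sin (((j : ℝ) + 1) * x) * Real.sin (((k : ℝ) + 1) * x)) * this
  rw [integral_domainMeasure_eq]
  simp only [h1]
  rw [intervalIntegral.integral_const_mul, intervalIntegral.integral_sub
    (Continuous.intervalIntegrable (by fun_prop) _ _)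
    (Continuous.intervalIntegrable (by fun_prop) _ _), integral_cos_int_mul, integral_cos_int_mul,
    if_neg (by omega : ¬ (j + k + 2 : ℤ) = 0)]
  have hpi := Real.pi_ne_zero
  by_cases h : j = k
  · simp [h, hpi]
  · have : ¬ (j - k : ℤ) = 0 := by omega
    simp [h, this]

theorem integral_cosMode_mul (j k : ℕ) :
    ∫ x, cosMode j x * cosMode k x ∂domainMeasure = if j = k then 1 else 0 := by
  have h1 : ∀ x, cosMode j x * cosMode k x = (1 / Real.pi) *
      (Real.cos (((j - k : ℤ) : ℝ) * x) + Real.cos (((j + k + 2 : ℤ) : ℝ) * x)) := by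
    intro x
    have e1 : ((j - k : ℤ) : ℝ) * x = ((j : ℝ) + 1) * x - ((k : ℝ) + 1) * x := by push_cast; ring
    have e2 : ((j + k + 2 : ℤ) : ℝ) * x = ((j : ℝ) + 1) * x + ((k : ℝ) + 1) * x := by
      push_cast; ring
    rw [e1, e2, Real.cos_sub, Real.cos_add, cosMode, cosMode]
    have : √(2 / Real.pi) * √(2 / Real.pi) = 2 / Real.pi :=
      Real.mul_self_sqrt (by have := Real.pi_pos; positivity)
    linear_combination (Real.cos (((j : ℝ) + 1) * x) * Real.cos (((k : ℝ) + 1) * x)) * this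
  rw [integral_domainMeasure_eq]
  simp only [h1]
  rw [intervalIntegral.integral_const_mul, intervalIntegral.integral_add
    (Continuous.intervalIntegrable (by fun_prop) _ _)
    (Continuous.intervalIntegrable (by fun_prop) _ _), integral_cos_int_mul, integral_cos_int_mul,
    if_neg (by omega : ¬ (j + k + 2 : ℤ) = 0)]
  have hpi := Real.pi_ne_zero
  by_cases h : j = k
  · simp [h, hpi]
  · have : ¬ (j - k : ℤ) = 0 := by omega
    simp [h, this]

/-- A complex square integrable function orthogonal to all sines vanishes. -/
theorem ae_eq_zero_of_integral_sinMode_smul {f : ℝ → ℂ} (hf : MemLp f 2 domainMeasure)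
    (h : ∀ k, ∫ x, sinMode k x • f x ∂domainMeasure = 0) : f =ᵐ[domainMeasure] 0 := by
  have hsin : ∀ m : ℤ, ∫ x, (Real.sin (m * x) : ℂ) * f x ∂domainMeasure = 0 := by
    have hnat : ∀ k : ℕ, ∫ x, (Real.sin (((k : ℝ) + 1) * x) : ℂ) * f x ∂domainMeasure = 0 := by
      intro k
      have hk := h k
      have hne : √(2 / Real.pi) ≠ 0 := by
        have := Real.pi_pos
        positivity
      simp only [sinMode, mul_smul] at hk
      rw [integral_smul, smul_eq_zero, or_iff_right hne] at hk
      simpa using hk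
    intro m
    obtain ⟨k, rfl | rfl⟩ := m.eq_nat_or_neg
    · rcases k with _ | k
      · simp
      · have := hnat k
        push_cast at this ⊢
        exact this
    · rcases k with _ | k
      · simp
      · have := hnat k
        rw [← neg_eq_zero, ← integral_neg] at this
        rw [← this]
        congr 1
        ext x
        push_cast
        rw [neg_mul, Complex.sin_neg, neg_mul]
  set g : ℝ → ℂ := (Set.Ioo 0 Real.pi).indicator f
  have hg : MemLp g 2 volume := (memLp_indicator_iff_restrict measurableSet_Ioo).2 hf
  have hgn : MemLp (fun x => g (-x)) 2 volume :=
    hg.comp_measurePreserving (Measure.measurePreserving_neg volume)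
  -- The odd extension to `(-π, π)`: its Fourier coefficients are multiples of the sine integrals,
  -- so Parseval forces it to vanish.
  set F : ℝ → ℂ := fun x => g x - g (-x)
  have hF : MemLp F 2 volume := hg.sub hgn
  have hpi := Real.pi_pos
  have hab : -Real.pi < Real.pi := by linarith
  have hsub : Set.Ioo 0 Real.pi ⊆ Set.Ioc (-Real.pi) Real.pi :=
    fun x hx => ⟨by linarith [hx.1], hx.2.le⟩
  have hcoef : ∀ m : ℤ, fourierCoeffOn hab F m = 0 := by
    intro m
    rw [fourierCoeffOn_eq_integral]
    refine smul_eq_zero_of_right _ ?_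
    set e : ℝ → ℂ := fun x => Complex.exp (-(m * x : ℝ) * Complex.I)
    have he : ∀ x : ℝ, fourier (-m) (x : AddCircle (Real.pi - -Real.pi)) = e x := by
      intro x
      rw [fourier_coe_apply]
      simp only [e]
      congr 1
      have : (Real.pi : ℂ) ≠ 0 := by exact_mod_cast hpi.ne'
      push_cast
      field_simp
      ring
    have hec : Continuous e := by
      simp only [e]
      fun_prop
    have hgi : IntervalIntegrable g volume (-Real.pi) Real.pi := by
      rw [intervalIntegrable_iff_integrableOn_Ioc_of_le hab.le]
      exact (hg.restrict _).integrable (by norm_num)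
    have hgni : IntervalIntegrable (fun x => g (-x)) volume (-Real.pi) Real.pi := by
      rw [intervalIntegrable_iff_integrableOn_Ioc_of_le hab.le]
      exact (hgn.restrict _).integrable (by norm_num)
    have hec' : Continuous fun x => e (-x) := hec.comp continuous_neg
    simp only [he, F, smul_eq_mul, mul_sub]
    rw [intervalIntegral.integral_sub (hgi.continuousOn_mul hec.continuousOn)
      (hgni.continuousOn_mul hec.continuousOn)]
    have h1 : ∫ x in (-Real.pi)..Real.pi, e x * g (-x)
        = ∫ x in (-Real.pi)..Real.pi, e (-x) * g x := by
      have := intervalIntegral.integral_comp_neg (a := -Real.pi) (b := Real.pi)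
        (fun x => e (-x) * g x)
      simpa using this
    rw [h1, ← intervalIntegral.integral_sub (hgi.continuousOn_mul hec.continuousOn)
      (hgi.continuousOn_mul hec'.continuousOn)]
    -- After reflecting the second half, only `e(x) - e(-x) = -2i sin(m x)` is left against `f`.
    have h2 : ∀ x, e x * g x - e (-x) * g x
        = (Set.Ioo 0 Real.pi).indicator (fun x => (-2 * Complex.I) * ((Real.sin (m * x) : ℂ) * f x))
          x := by
      intro x
      by_cases hx : x ∈ Set.Ioo 0 Real.pi
      · simp only [g, Set.indicator_of_mem hx, e]
        rw [← sub_mul, ← mul_assoc]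
        congr 1
        rw [show (-((m * -x : ℝ) : ℂ)) * Complex.I = ((m * x : ℝ) : ℂ) * Complex.I by
          push_cast; ring, Complex.exp_mul_I, neg_mul, ← neg_mul, Complex.exp_mul_I,
          Complex.cos_neg, Complex.sin_neg, Complex.ofReal_sin]
        ring
      · simp [g, Set.indicator_of_notMem hx]
    simp only [h2]
    rw [intervalIntegral.integral_of_le hab.le, setIntegral_indicator measurableSet_Ioo,
      Set.inter_eq_right.2 hsub, integral_const_mul, hsin,
      mul_zero]
  have hsum := tsum_sq_fourierCoeffOn hab (hF.restrict _)
  simp only [hcoef, norm_zero, ne_eq, OfNat.ofNat_ne_zero, not_false_eq_true, zero_pow, tsum_zero]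
    at hsum
  have hint : ∫ x in (-Real.pi)..Real.pi, ‖F x‖ ^ 2 = 0 := by
    have : (Real.pi - -Real.pi)⁻¹ ≠ 0 := by
      have : 0 < Real.pi - -Real.pi := by linarith
      positivity
    exact (smul_eq_zero.1 hsum.symm).resolve_left this
  rw [intervalIntegral.integral_of_le hab.le, setIntegral_eq_zero_iff_of_nonneg_ae
    (Eventually.of_forall fun x => sq_nonneg _) (hF.restrict _).integrable_norm_pow'] at hint
  filter_upwards [ae_restrict_of_ae_restrict_of_subset hsub hint,
    ae_restrict_mem measurableSet_Ioo] with x hx hxm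
  have h1 : F x = f x := by
    have : -x ∉ Set.Ioo 0 Real.pi := fun h => by linarith [h.1, hxm.1]
    simp [F, g, Set.indicator_of_mem hxm, Set.indicator_of_notMem this]
  rw [h1] at hx
  simpa using hx

/-- The scalar case applies to real and imaginary parts of the coordinates; real-linear functionals
with complex values treat `𝕜 = ℝ` and `𝕜 = ℂ` together. -/
theorem ae_eq_zero_of_integral_sinMode_smul_vec {𝕜 : Type} [RCLike 𝕜] {n : ℕ}
    {f : ℝ → EuclideanSpace 𝕜 (Fin n)} (hf : MemLp f 2 domainMeasure)
    (h : ∀ k, ∫ x, sinMode k x • f x ∂domainMeasure = 0) : f =ᵐ[domainMeasure] 0 := by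
  have hfi : Integrable f domainMeasure := hf.integrable (by norm_num)
  have key : ∀ ℓ : EuclideanSpace 𝕜 (Fin n) →L[ℝ] ℂ, (fun x => ℓ (f x)) =ᵐ[domainMeasure] 0 := by
    intro ℓ
    refine ae_eq_zero_of_integral_sinMode_smul (ℓ.comp_memLp' hf) fun k => ?_
    have := ℓ.integral_comp_comm (integrable_smul_domainMeasure
      (contDiff_sinMode k (m := 0)).continuous hfi)
    rw [h k, map_zero] at this
    simpa using this
  have hre : ∀ i, ∀ᵐ x ∂domainMeasure, RCLike.re (f x i) = 0 := by
    intro i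
    have := key (Complex.ofRealCLM.comp (RCLike.reCLM.comp
      ((EuclideanSpace.proj i : _ →L[𝕜] 𝕜).restrictScalars ℝ)))
    filter_upwards [this] with x hx
    simpa using hx
  have him : ∀ i, ∀ᵐ x ∂domainMeasure, RCLike.im (f x i) = 0 := by
    intro i
    have := key (Complex.ofRealCLM.comp (RCLike.imCLM.comp
      ((EuclideanSpace.proj i : _ →L[𝕜] 𝕜).restrictScalars ℝ)))
    filter_upwards [this] with x hx
    simpa using hx
  filter_upwards [ae_all_iff.2 hre, ae_all_iff.2 him] with x h1 h2
  ext i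
  exact RCLike.ext (by simpa using h1 i) (by simpa using h2 i)

end Modes

/-! ### Orthogonal expansions in `L²(0, π; ℝⁿ)` -/

section OrthogonalFamily

set_option linter.unusedSectionVars false

variable {H G : Type*} [NormedAddCommGroup H] [InnerProductSpace ℝ H]
  [NormedAddCommGroup G] [InnerProductSpace ℝ G] {V : ℕ → G →ₗᵢ[ℝ] H}

theorem hasSum_norm_sq_of_orthogonalFamily (hV : OrthogonalFamily ℝ (fun _ : ℕ => G) V)
    {a : ℕ → G} {x : H} (h : HasSum (fun k => V k (a k)) x) :
    HasSum (fun k => ‖a k‖ ^ 2) (‖x‖ ^ 2) := by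
  have h1 := (h.norm.pow 2)
  refine h1.congr fun s => ?_
  exact (hV.norm_sum a s)

variable [CompleteSpace H]

theorem exists_hasSum_of_orthogonalFamily (hV : OrthogonalFamily ℝ (fun _ : ℕ => G) V)
    {a : ℕ → G} (h : Summable fun k => ‖a k‖ ^ 2) :
    HasSum (fun k => V k (a k)) (∑' k, V k (a k)) :=
  ((hV.summable_iff_norm_sq_summable a).2 h).hasSum

variable [CompleteSpace G]

/-- Bessel's inequality: a finite partial sum `w` satisfies `⟨w, y⟩ = ‖w‖²`, so Cauchy–Schwarz gives
`‖w‖ ≤ ‖y‖`. -/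
theorem summable_norm_sq_adjoint (hV : OrthogonalFamily ℝ (fun _ : ℕ => G) V) (y : H) :
    Summable fun k => ‖(V k).toContinuousLinearMap.adjoint y‖ ^ 2 := by
  refine summable_of_sum_le (c := ‖y‖ ^ 2) (fun k => sq_nonneg _) fun s => ?_
  set a := fun k => (V k).toContinuousLinearMap.adjoint y
  set w := ∑ k ∈ s, V k (a k)
  have h1 : ‖w‖ ^ 2 = ∑ k ∈ s, ‖a k‖ ^ 2 := hV.norm_sum a s
  have h2 : inner ℝ w y = ‖w‖ ^ 2 := by
    rw [h1, sum_inner]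
    refine Finset.sum_congr rfl fun k _ => ?_
    rw [← real_inner_self_eq_norm_sq]
    exact ((V k).toContinuousLinearMap.adjoint_inner_right (a k) y).symm
  have h3 : ‖w‖ ^ 2 ≤ ‖w‖ * ‖y‖ := h2 ▸ real_inner_le_norm w y
  have h4 : ‖w‖ ≤ ‖y‖ := by
    by_contra hcon
    push Not at hcon
    have : 0 < ‖w‖ := (norm_nonneg y).trans_lt hcon
    nlinarith
  change ∑ k ∈ s, ‖a k‖ ^ 2 ≤ _
  rw [← h1]
  gcongr

theorem adjoint_apply_of_orthogonalFamily (hV : OrthogonalFamily ℝ (fun _ : ℕ => G) V)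
    (j k : ℕ) (v : G) :
    (V j).toContinuousLinearMap.adjoint (V k v) = if k = j then v else 0 := by
  refine ext_inner_left ℝ fun w => ?_
  rw [ContinuousLinearMap.adjoint_inner_right]
  change inner ℝ (V j w) (V k v) = _
  split_ifs with h
  · subst h
    exact (V k).inner_map_map w v
  · rw [inner_zero_right]
    exact hV (Ne.symm h) w v

theorem adjoint_eq_of_hasSum (hV : OrthogonalFamily ℝ (fun _ : ℕ => G) V)
    {a : ℕ → G} {x : H} (h : HasSum (fun k => V k (a k)) x) (j : ℕ) :
    (V j).toContinuousLinearMap.adjoint x = a j := by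
  have h1 := h.mapL ((V j).toContinuousLinearMap.adjoint)
  simp only [adjoint_apply_of_orthogonalFamily hV] at h1
  exact h1.unique (hasSum_ite_eq j (a j) |>.congr_fun fun k => by
    split_ifs with hk
    · rw [hk]
    · rfl)

/-- Continuity of a sum over an orthogonal family with square-summably dominated terms. -/
theorem continuousOn_tsum_of_orthogonalFamily (hV : OrthogonalFamily ℝ (fun _ : ℕ => G) V)
    {a : ℕ → ℝ → G} {s : Set ℝ} (ha : ∀ k, ContinuousOn (a k) s) {b : ℕ → ℝ}
    (hb : Summable fun k => b k ^ 2) (hab : ∀ k, ∀ t ∈ s, ‖a k t‖ ≤ b k) :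
    ContinuousOn (fun t => ∑' k, V k (a k t)) s := by
  intro t₀ ht₀
  have hsum : ∀ t ∈ s, HasSum (fun k => V k (a k t)) (∑' k, V k (a k t)) := by
    intro t ht
    refine exists_hasSum_of_orthogonalFamily hV ?_
    exact Summable.of_nonneg_of_le (fun k => sq_nonneg _)
      (fun k => pow_le_pow_left₀ (norm_nonneg _) (hab k t ht) 2) hb
  -- Pythagoras turns continuity into a limit of a numerical series, dominated by `4 b_k²`.
  have hdiff : ∀ t ∈ s, ‖(∑' k, V k (a k t)) - ∑' k, V k (a k t₀)‖ ^ 2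
      = ∑' k, ‖a k t - a k t₀‖ ^ 2 := by
    intro t ht
    have h1 := (hsum t ht).sub (hsum t₀ ht₀)
    simp only [← map_sub] at h1
    exact (hasSum_norm_sq_of_orthogonalFamily hV h1).tsum_eq.symm
  have hlim : Tendsto (fun t => ∑' k, ‖a k t - a k t₀‖ ^ 2) (𝓝[s] t₀) (𝓝 (∑' _ : ℕ, (0 : ℝ))) := by
    refine tendsto_tsum_of_dominated_convergence (hb.mul_left 4) (fun k => ?_) ?_
    · have := ((ha k t₀ ht₀).sub_const (a k t₀)).norm.pow 2
      simpa using this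
    · filter_upwards [self_mem_nhdsWithin] with t ht k
      rw [Real.norm_of_nonneg (sq_nonneg _)]
      have h1 := norm_sub_le (a k t) (a k t₀)
      have h2 := hab k t ht
      have h3 := hab k t₀ ht₀
      nlinarith [norm_nonneg (a k t - a k t₀)]
  rw [tsum_zero] at hlim
  rw [ContinuousWithinAt, tendsto_iff_norm_sub_tendsto_zero]
  have h2 : Tendsto (fun t => ‖(∑' k, V k (a k t)) - ∑' k, V k (a k t₀)‖ ^ 2) (𝓝[s] t₀) (𝓝 0) := by
    refine hlim.congr' ?_
    filter_upwards [self_mem_nhdsWithin] with t ht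
    exact (hdiff t ht).symm
  simpa [Real.sqrt_sq (norm_nonneg _)] using h2.sqrt

end OrthogonalFamily

/-! ### Sine and cosine coefficients of vector-valued functions -/

section Modes

variable {n : ℕ}

/-- The function `φ • v` as an element of `L²(0, π; ℝⁿ)`, for `φ` bounded and continuous. -/
noncomputable def lpMode (n : ℕ) (φ : ℝ →ᵇ ℝ) : EuclideanSpace ℝ (Fin n) →ₗ[ℝ] L2Space ℝ n where
  toFun v := BoundedContinuousFunction.toLp 2 domainMeasure ℝ
    (φ • BoundedContinuousFunction.const ℝ v)
  map_add' v w := by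
    rw [← map_add]
    congr 1
    ext x : 1
    exact smul_add (φ x) v w
  map_smul' c v := by
    rw [← map_smul]
    congr 1
    ext x : 1
    exact smul_comm (φ x) c v

theorem coeFn_lpMode (φ : ℝ →ᵇ ℝ) (v : EuclideanSpace ℝ (Fin n)) :
    lpMode n φ v =ᵐ[domainMeasure] fun x => φ x • v :=
  BoundedContinuousFunction.coeFn_toLp 2 domainMeasure ℝ _

theorem L2Space.integrable {𝕜 : Type} [RCLike 𝕜] (y : L2Space 𝕜 n) : Integrable y domainMeasure :=
  (Lp.memLp y).integrable (by norm_num)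

theorem inner_lpMode (φ : ℝ →ᵇ ℝ) (v : EuclideanSpace ℝ (Fin n)) (y : L2Space ℝ n) :
    inner ℝ (lpMode n φ v) y = inner ℝ v (∫ x, φ x • y x ∂domainMeasure) := by
  rw [L2.inner_def, ← integral_inner (integrable_smul_domainMeasure φ.continuous y.integrable)]
  refine integral_congr_ae ?_
  filter_upwards [coeFn_lpMode φ v] with x hx
  rw [hx, real_inner_smul_left, real_inner_smul_right]

theorem inner_lpMode_lpMode (φ ψ : ℝ →ᵇ ℝ) (v w : EuclideanSpace ℝ (Fin n)) :
    inner ℝ (lpMode n φ v) (lpMode n ψ w)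
      = (∫ x, φ x * ψ x ∂domainMeasure) * inner ℝ v w := by
  rw [inner_lpMode]
  have : ∫ x, φ x • lpMode n ψ w x ∂domainMeasure = (∫ x, φ x * ψ x ∂domainMeasure) • w := by
    rw [← integral_smul_const]
    refine integral_congr_ae ?_
    filter_upwards [coeFn_lpMode ψ w] with x hx
    rw [hx, smul_smul]
  rw [this, real_inner_smul_right]

/-- The isometry `v ↦ φ • v` for a normalized function `φ`. -/
noncomputable def lpModeₗᵢ (n : ℕ) (φ : ℝ →ᵇ ℝ) (h : ∫ x, φ x * φ x ∂domainMeasure = 1) :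
    EuclideanSpace ℝ (Fin n) →ₗᵢ[ℝ] L2Space ℝ n where
  toLinearMap := lpMode n φ
  norm_map' v := by
    have := inner_lpMode_lpMode φ φ v v
    rw [h, one_mul, real_inner_self_eq_norm_sq, real_inner_self_eq_norm_sq] at this
    exact (pow_left_inj₀ (norm_nonneg _) (norm_nonneg _) two_ne_zero).1 this

/-- `sinMode` as a bounded continuous function. -/
noncomputable def sinB (k : ℕ) : ℝ →ᵇ ℝ :=
  BoundedContinuousFunction.ofNormedAddCommGroup (sinMode k) (contDiff_sinMode k (m := 0)).continuous
    _ (abs_sinMode_le k)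

/-- `cosMode` as a bounded continuous function. -/
noncomputable def cosB (k : ℕ) : ℝ →ᵇ ℝ :=
  BoundedContinuousFunction.ofNormedAddCommGroup (cosMode k) (contDiff_cosMode k (m := 0)).continuous
    _ (abs_cosMode_le k)

@[simp] theorem sinB_apply (k : ℕ) (x : ℝ) : sinB k x = sinMode k x := rfl

@[simp] theorem cosB_apply (k : ℕ) (x : ℝ) : cosB k x = cosMode k x := rfl

/-- The isometric embedding of `ℝⁿ` as the `k`-th sine mode. -/
noncomputable def sinV (n k : ℕ) : EuclideanSpace ℝ (Fin n) →ₗᵢ[ℝ] L2Space ℝ n :=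
  lpModeₗᵢ n (sinB k) (by simpa using integral_sinMode_mul k k)

/-- The isometric embedding of `ℝⁿ` as the `k`-th cosine mode. -/
noncomputable def cosV (n k : ℕ) : EuclideanSpace ℝ (Fin n) →ₗᵢ[ℝ] L2Space ℝ n :=
  lpModeₗᵢ n (cosB k) (by simpa using integral_cosMode_mul k k)

theorem orthogonalFamily_sinV :
    OrthogonalFamily ℝ (fun _ : ℕ => EuclideanSpace ℝ (Fin n)) (sinV n) := by
  intro j k hjk v w
  change inner ℝ (lpMode n (sinB j) v) (lpMode n (sinB k) w) = 0
  have := integral_sinMode_mul j k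
  rw [if_neg hjk] at this
  rw [inner_lpMode_lpMode]
  simp [this]

theorem orthogonalFamily_cosV :
    OrthogonalFamily ℝ (fun _ : ℕ => EuclideanSpace ℝ (Fin n)) (cosV n) := by
  intro j k hjk v w
  change inner ℝ (lpMode n (cosB j) v) (lpMode n (cosB k) w) = 0
  have := integral_cosMode_mul j k
  rw [if_neg hjk] at this
  rw [inner_lpMode_lpMode]
  simp [this]

/-- The `k`-th sine coefficient. -/
noncomputable def sinCoef (n k : ℕ) : L2Space ℝ n →L[ℝ] EuclideanSpace ℝ (Fin n) :=
  (sinV n k).toContinuousLinearMap.adjoint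

/-- The `k`-th cosine coefficient. -/
noncomputable def cosCoef (n k : ℕ) : L2Space ℝ n →L[ℝ] EuclideanSpace ℝ (Fin n) :=
  (cosV n k).toContinuousLinearMap.adjoint

theorem sinCoef_eq_integral (k : ℕ) (y : L2Space ℝ n) :
    sinCoef n k y = ∫ x, sinMode k x • y x ∂domainMeasure := by
  refine ext_inner_left ℝ fun v => ?_
  rw [sinCoef, ContinuousLinearMap.adjoint_inner_right]
  exact inner_lpMode (sinB k) v y

theorem cosCoef_eq_integral (k : ℕ) (y : L2Space ℝ n) :
    cosCoef n k y = ∫ x, cosMode k x • y x ∂domainMeasure := by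
  refine ext_inner_left ℝ fun v => ?_
  rw [cosCoef, ContinuousLinearMap.adjoint_inner_right]
  exact inner_lpMode (cosB k) v y

theorem inner_sinV_left (k : ℕ) (v : EuclideanSpace ℝ (Fin n)) (y : L2Space ℝ n) :
    inner ℝ (sinV n k v) y = inner ℝ v (sinCoef n k y) :=
  ((sinV n k).toContinuousLinearMap.adjoint_inner_right v y).symm

theorem eq_zero_of_sinCoef_eq_zero {y : L2Space ℝ n} (h : ∀ k, sinCoef n k y = 0) : y = 0 := by
  rw [Lp.eq_zero_iff_ae_eq_zero]
  refine ae_eq_zero_of_integral_sinMode_smul_vec (Lp.memLp y) fun k => ?_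
  rw [← sinCoef_eq_integral, h k]

/-- Bessel gives convergence; the limit and `y` have the same sine coefficients, so completeness of
the sines identifies them. -/
theorem hasSum_sinV (y : L2Space ℝ n) : HasSum (fun k => sinV n k (sinCoef n k y)) y := by
  have h : HasSum (fun k => sinV n k (sinCoef n k y)) (∑' k, sinV n k (sinCoef n k y)) :=
    exists_hasSum_of_orthogonalFamily orthogonalFamily_sinV
    (summable_norm_sq_adjoint orthogonalFamily_sinV y)
  have h0 : (∑' k, sinV n k (sinCoef n k y)) - y = 0 := by
    refine eq_zero_of_sinCoef_eq_zero fun j => ?_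
    rw [map_sub, sub_eq_zero]
    exact adjoint_eq_of_hasSum orthogonalFamily_sinV h j
  rw [sub_eq_zero] at h0
  rw [h0] at h
  exact h

theorem summable_norm_sq_sinCoef (y : L2Space ℝ n) : Summable fun k => ‖sinCoef n k y‖ ^ 2 :=
  summable_norm_sq_adjoint orthogonalFamily_sinV y

theorem summable_norm_sq_cosCoef (y : L2Space ℝ n) : Summable fun k => ‖cosCoef n k y‖ ^ 2 :=
  summable_norm_sq_adjoint orthogonalFamily_cosV y

/-- An absolutely convergent sine series represents the corresponding `L²` sum. -/
theorem ae_eq_tsum_sinMode_smul {a : ℕ → EuclideanSpace ℝ (Fin n)} (ha : Summable fun k => ‖a k‖)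
    {y : L2Space ℝ n} (hy : HasSum (fun k => sinV n k (a k)) y) :
    (fun x => ∑' k, sinMode k x • a k) =ᵐ[domainMeasure] y := by
  set g : ℕ → ℝ →ᵇ EuclideanSpace ℝ (Fin n) := fun k =>
    sinB k • BoundedContinuousFunction.const ℝ (a k)
  have hg : Summable g := by
    refine Summable.of_norm_bounded (ha.mul_left √(2 / Real.pi)) fun k => ?_
    refine (BoundedContinuousFunction.norm_le (by positivity)).2 fun x => ?_
    change ‖sinMode k x • a k‖ ≤ _
    rw [norm_smul]
    exact mul_le_mul_of_nonneg_right (abs_sinMode_le k x) (norm_nonneg _)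
  have h1 := hg.hasSum.mapL (BoundedContinuousFunction.toLp 2 domainMeasure ℝ)
  have h2 : BoundedContinuousFunction.toLp 2 domainMeasure ℝ (∑' k, g k) = y := h1.unique hy
  rw [← h2]
  refine EventuallyEq.trans (Eventually.of_forall fun x => ?_)
    (BoundedContinuousFunction.coeFn_toLp 2 domainMeasure ℝ (∑' k, g k)).symm
  have h3 := hg.hasSum.mapL (BoundedContinuousFunction.evalCLM ℝ x)
  exact h3.tsum_eq

theorem continuous_tsum_sinMode_smul {a : ℕ → EuclideanSpace ℝ (Fin n)}
    (ha : Summable fun k => ‖a k‖) : Continuous fun x => ∑' k, sinMode k x • a k := by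
  refine continuous_tsum (fun k => ((contDiff_sinMode k (m := 0)).continuous).smul continuous_const)
    (ha.mul_left √(2 / Real.pi)) fun k x => ?_
  rw [norm_smul]
  exact mul_le_mul_of_nonneg_right (abs_sinMode_le k x) (norm_nonneg _)

end Modes

/-! ### Existence of weak solutions -/

section ModeSolution

variable {n : ℕ} {d α x₀ : ℝ}

theorem exists_norm_modeOp_le (n : ℕ) (d α : ℝ) : ∃ C : ℝ, 0 ≤ C ∧
    ∀ (k : ℕ) (v : EuclideanSpace ℝ (Fin n)), ‖modeOp n d α k v‖ ≤ C * ((k : ℝ) + 1) ^ 2 * ‖v‖ := by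
  obtain ⟨C, hC, h⟩ := exists_norm_modeOpℂ_le n d α
  refine ⟨C, hC, fun k v => ?_⟩
  rw [← norm_toComplex, ← modeOpℂ_toComplex, ← norm_toComplex n v]
  exact ContinuousLinearMap.le_of_opNorm_le _ (h k) _

theorem hasDerivAt_exp_smul_modeOp (k : ℕ) (t : ℝ) :
    HasDerivAt (fun t : ℝ => NormedSpace.exp (t • modeOp n d α k))
      (modeOp n d α k * NormedSpace.exp (t • modeOp n d α k)) t :=
  hasDerivAt_exp_smul_const' (𝕂 := ℝ) (modeOp n d α k) t

theorem hasDerivAt_exp_neg_smul_modeOp (k : ℕ) (t : ℝ) :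
    HasDerivAt (fun t : ℝ => NormedSpace.exp (-t • modeOp n d α k))
      (-(modeOp n d α k * NormedSpace.exp (-t • modeOp n d α k))) t := by
  have h := (hasDerivAt_exp_smul_modeOp (n := n) (d := d) (α := α) k (-t)).scomp t (hasDerivAt_neg t)
  simpa [Function.comp_def] using h

theorem continuous_exp_smul_modeOp_apply (k : ℕ) (v : EuclideanSpace ℝ (Fin n)) :
    Continuous fun t : ℝ => NormedSpace.exp (t • modeOp n d α k) v :=
  continuous_iff_continuousAt.2 fun t =>
    ((hasDerivAt_exp_smul_modeOp k t).clm_apply (hasDerivAt_const t v)).continuousAt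

theorem exp_neg_smul_mul_exp_smul (k : ℕ) (s t : ℝ) :
    NormedSpace.exp (-t • modeOp n d α k) * NormedSpace.exp (s • modeOp n d α k)
      = NormedSpace.exp (-(t - s) • modeOp n d α k) := by
  rw [← exp_add_eq_mul (((Commute.refl _).smul_left _).smul_right _), ← add_smul]
  congr 2
  ring

theorem exp_zero_smul_modeOp (k : ℕ) :
    NormedSpace.exp ((0 : ℝ) • modeOp n d α k) = 1 := by
  have h : (0 : ℝ) • modeOp n d α k = 0 := zero_smul ℝ (modeOp n d α k)
  rw [h, NormedSpace.exp_zero]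

/-- The `k`-th sine coefficient of the solution with initial coefficient `w` and control `u`. -/
noncomputable def modeSol (n : ℕ) (d α x₀ : ℝ) (k : ℕ) (w : EuclideanSpace ℝ (Fin n)) (u : ℝ → ℝ)
    (t : ℝ) : EuclideanSpace ℝ (Fin n) :=
  NormedSpace.exp (-t • modeOp n d α k)
    (w + ∫ s in (0 : ℝ)..t, (sinMode k x₀ * u s) • NormedSpace.exp (s • modeOp n d α k) (vecB n))

theorem modeSol_zero (k : ℕ) (w : EuclideanSpace ℝ (Fin n)) (u : ℝ → ℝ) :
    modeSol n d α x₀ k w u 0 = w := by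
  rw [modeSol, intervalIntegral.integral_same, add_zero, neg_zero, exp_zero_smul_modeOp]
  rfl

variable {u : ℝ → ℝ} (hu : Continuous u)

include hu

theorem hasDerivAt_modeSol (k : ℕ) (w : EuclideanSpace ℝ (Fin n)) (t : ℝ) :
    HasDerivAt (modeSol n d α x₀ k w u)
      (-modeOp n d α k (modeSol n d α x₀ k w u t) + (sinMode k x₀ * u t) • vecB n) t := by
  have hc : Continuous fun s => (sinMode k x₀ * u s) •
      NormedSpace.exp (s • modeOp n d α k) (vecB n) :=
    (continuous_const.mul hu).smul (continuous_exp_smul_modeOp_apply k _)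
  have h1 : HasDerivAt (fun t => w + ∫ s in (0 : ℝ)..t, (sinMode k x₀ * u s) •
      NormedSpace.exp (s • modeOp n d α k) (vecB n))
      ((sinMode k x₀ * u t) • NormedSpace.exp (t • modeOp n d α k) (vecB n)) t :=
    (intervalIntegral.integral_hasDerivAt_right (hc.intervalIntegrable _ _)
      hc.stronglyMeasurable.stronglyMeasurableAtFilter hc.continuousAt).const_add w
  have h2 := (hasDerivAt_exp_neg_smul_modeOp (n := n) (d := d) (α := α) k t).clm_apply h1
  convert! h2 using 1
  have h3 : NormedSpace.exp (-t • modeOp n d α k)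
      (NormedSpace.exp (t • modeOp n d α k) (vecB n)) = vecB n := by
    have := exp_neg_smul_mul_exp_smul (n := n) (d := d) (α := α) k t t
    rw [sub_self, neg_zero, exp_zero_smul_modeOp] at this
    exact congrArg (fun A : EuclideanSpace ℝ (Fin n) →L[ℝ] EuclideanSpace ℝ (Fin n) =>
      A (vecB n)) this
  rw [map_smul, h3]
  rfl

theorem continuous_modeSol (k : ℕ) (w : EuclideanSpace ℝ (Fin n)) :
    Continuous (modeSol n d α x₀ k w u) :=
  continuous_iff_continuousAt.2 fun t => (hasDerivAt_modeSol hu k w t).continuousAt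

/-- Duhamel's formula. The definition keeps the exponential outside the integral to make it easy to
differentiate; here the kernel is the decaying one, as estimates require. -/
theorem modeSol_eq_add (k : ℕ) (w : EuclideanSpace ℝ (Fin n)) (t : ℝ) :
    modeSol n d α x₀ k w u t = NormedSpace.exp (-t • modeOp n d α k) w
      + ∫ s in (0 : ℝ)..t, (sinMode k x₀ * u s) •
          NormedSpace.exp (-(t - s) • modeOp n d α k) (vecB n) := by
  have hc : Continuous fun s => (sinMode k x₀ * u s) •
      NormedSpace.exp (s • modeOp n d α k) (vecB n) :=
    (continuous_const.mul hu).smul (continuous_exp_smul_modeOp_apply k _)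
  rw [modeSol, map_add, ← ContinuousLinearMap.intervalIntegral_comp_comm _
    (hc.intervalIntegrable _ _)]
  congr 1
  refine intervalIntegral.integral_congr fun s _ => ?_
  simp only [map_smul]
  rw [← exp_neg_smul_mul_exp_smul]
  rfl

omit hu in
theorem integral_exp_neg_mul_le {a : ℝ} (ha : 0 < a) (t : ℝ) :
    ∫ s in (0 : ℝ)..t, Real.exp (-a * s) ≤ 1 / a := by
  rw [intervalIntegral.integral_comp_mul_left (fun x => Real.exp x) (neg_ne_zero.2 ha.ne'),
    integral_exp, mul_zero, Real.exp_zero, smul_eq_mul, inv_neg, neg_mul, ← mul_neg, neg_sub,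
    one_div]
  refine mul_le_of_le_one_right (by positivity) ?_
  linarith [Real.exp_pos (-a * t)]

omit hu in
theorem integral_exp_neg_mul_sub_le {a : ℝ} (ha : 0 < a) (t : ℝ) :
    ∫ s in (0 : ℝ)..t, Real.exp (-a * (t - s)) ≤ 1 / a := by
  rw [intervalIntegral.integral_comp_sub_left (fun x => Real.exp (-a * x)) t, sub_self, sub_zero]
  exact integral_exp_neg_mul_le ha t

/-- The numbers `sin_k(x₀)` do not decay, but a continuous control is bounded on `[0, T]`, and
integrating the kernel `exp(-(k+1)² (t-s) / 2)` gains `2 / (k+1)²`. This is enough regularity for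
the forced part to lie in `H¹₀`. -/
theorem exists_norm_modeSol_le (n : ℕ) (α x₀ : ℝ) (hd : 1 ≤ d) (T : ℝ) :
    ∃ C : ℝ, 0 ≤ C ∧ ∀ (k : ℕ) (w : EuclideanSpace ℝ (Fin n)), ∀ t ∈ Set.Icc 0 T,
      ‖modeSol n d α x₀ k w u t‖ ≤ C * (Real.exp (-(((k : ℝ) + 1) ^ 2 / 2) * t) * ‖w‖
        + 1 / ((k : ℝ) + 1) ^ 2) := by
  obtain ⟨C, c, hC, hc, h⟩ := exists_norm_exp_modeOp_le n α hd
  obtain ⟨M, hM⟩ := (isCompact_Icc (a := (0 : ℝ)) (b := T)).exists_bound_of_continuousOn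
    hu.continuousOn
  set C₁ := C * Real.exp (c * T)
  have hC₁ : 0 ≤ C₁ := by positivity
  have h' : ∀ (k : ℕ) (t : ℝ), t ∈ Set.Icc 0 T → ∀ v,
      ‖NormedSpace.exp (-t • modeOp n d α k) v‖
        ≤ C₁ * Real.exp (-(((k : ℝ) + 1) ^ 2 / 2) * t) * ‖v‖ := by
    intro k t ht v
    refine (h k t ht.1 v).trans ?_
    have := mul_le_mul_of_nonneg_left ht.2 hc
    simp only [C₁]
    gcongr
  set C₂ := √(2 / Real.pi) * |M| * C₁ * ‖vecB n‖
  have hC₂ : 0 ≤ C₂ := by positivity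
  refine ⟨C₁ + 2 * C₂, by positivity, fun k w t ht => ?_⟩
  have ha : 0 < ((k : ℝ) + 1) ^ 2 / 2 := by positivity
  have hint : ‖∫ s in (0 : ℝ)..t, (sinMode k x₀ * u s) •
      NormedSpace.exp (-(t - s) • modeOp n d α k) (vecB n)‖ ≤ 2 * C₂ * (1 / ((k : ℝ) + 1) ^ 2) := by
    calc _ ≤ ∫ s in (0 : ℝ)..t, C₂ * Real.exp (-(((k : ℝ) + 1) ^ 2 / 2) * (t - s)) := by
          refine intervalIntegral.norm_integral_le_of_norm_le ht.1
            (Eventually.of_forall fun s hs => ?_) (Continuous.intervalIntegrable (by fun_prop) _ _)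
          have hs1 : t - s ∈ Set.Icc 0 T := ⟨by linarith [hs.2], by linarith [hs.1, ht.2]⟩
          have hs2 : |u s| ≤ |M| :=
            (hM s ⟨hs.1.le, hs.2.trans ht.2⟩).trans (le_abs_self M)
          rw [norm_smul, norm_mul, Real.norm_eq_abs, Real.norm_eq_abs]
          calc _ ≤ √(2 / Real.pi) * |M| *
                (C₁ * Real.exp (-(((k : ℝ) + 1) ^ 2 / 2) * (t - s)) * ‖vecB n‖) := by
                gcongr
                · exact abs_sinMode_le k x₀
                · exact h' k _ hs1 _
            _ = _ := by
              simp only [C₂]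
              ring
      _ = C₂ * ∫ s in (0 : ℝ)..t, Real.exp (-(((k : ℝ) + 1) ^ 2 / 2) * (t - s)) :=
          intervalIntegral.integral_const_mul _ _
      _ ≤ C₂ * (1 / (((k : ℝ) + 1) ^ 2 / 2)) := by
          gcongr
          exact integral_exp_neg_mul_sub_le ha t
      _ = _ := by field_simp
  rw [modeSol_eq_add hu]
  refine (norm_add_le _ _).trans ?_
  have h1 := h' k t ht w
  have e1 : 0 ≤ Real.exp (-(((k : ℝ) + 1) ^ 2 / 2) * t) * ‖w‖ := by positivity
  have e2 : 0 ≤ 1 / ((k : ℝ) + 1) ^ 2 := by positivity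
  nlinarith [mul_nonneg hC₁ e2, mul_nonneg hC₂ e1]

/-- The equation of the `k`-th sine coefficient in integrated form. -/
theorem inner_modeSol_eq (k : ℕ) (w v : EuclideanSpace ℝ (Fin n)) (t : ℝ) :
    inner ℝ (modeSol n d α x₀ k w u t) v - inner ℝ w v
      + ∫ s in (0 : ℝ)..t, inner ℝ (modeOp n d α k (modeSol n d α x₀ k w u s)) v
      = (∫ s in (0 : ℝ)..t, u s) * inner ℝ (vecB n) (sinMode k x₀ • v) := by
  have hY := continuous_modeSol (n := n) (d := d) (α := α) (x₀ := x₀) hu k w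
  have hc1 : Continuous fun s => inner ℝ (modeOp n d α k (modeSol n d α x₀ k w u s)) v :=
    ((modeOp n d α k).continuous.comp hY).inner continuous_const
  have hc2 : Continuous fun s => u s * inner ℝ (vecB n) (sinMode k x₀ • v) :=
    hu.mul continuous_const
  have hderiv : ∀ s, HasDerivAt (fun s => inner ℝ (modeSol n d α x₀ k w u s) v)
      (-inner ℝ (modeOp n d α k (modeSol n d α x₀ k w u s)) v
        + u s * inner ℝ (vecB n) (sinMode k x₀ • v)) s := by
    intro s
    have h := (hasDerivAt_modeSol (n := n) (d := d) (α := α) (x₀ := x₀) hu k w s).inner ℝ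
      (hasDerivAt_const s v)
    convert! h using 1
    rw [inner_zero_right, zero_add, inner_add_left, inner_neg_left, real_inner_smul_left,
      real_inner_smul_right]
    ring
  have hc1n : IntervalIntegrable
      (fun s => -inner ℝ (modeOp n d α k (modeSol n d α x₀ k w u s)) v) volume 0 t :=
    hc1.neg.intervalIntegrable _ _
  have hftc := intervalIntegral.integral_eq_sub_of_hasDerivAt (a := 0) (b := t)
    (fun s _ => hderiv s) (hc1n.add (hc2.intervalIntegrable _ _))
  rw [intervalIntegral.integral_add hc1n (hc2.intervalIntegrable _ _),
    intervalIntegral.integral_neg, modeSol_zero, intervalIntegral.integral_mul_const] at hftc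
  linarith

end ModeSolution

/-! ### Summing the modes to a weak solution -/

section WeakSolution

variable {n : ℕ} {d α x₀ : ℝ}

theorem integral_deriv_mul_sinMode (k : ℕ) {φ : ℝ → ℝ} (hφ : ContDiff ℝ 1 φ) :
    ∫ x, deriv φ x * sinMode k x ∂domainMeasure
      = -(((k : ℝ) + 1) * ∫ x, φ x * cosMode k x ∂domainMeasure) := by
  have hd : Continuous (deriv φ) := hφ.continuous_deriv le_rfl
  have hc : Continuous fun x => ((k : ℝ) + 1) * cosMode k x :=
    continuous_const.mul (contDiff_cosMode k (m := 0)).continuous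
  have h := intervalIntegral.integral_mul_deriv_eq_deriv_mul (a := 0) (b := Real.pi)
    (u := φ) (v := sinMode k) (fun x _ => (hφ.differentiable one_ne_zero x).hasDerivAt)
    (fun x _ => hasDerivAt_sinMode k x) (hd.intervalIntegrable _ _) (hc.intervalIntegrable _ _)
  rw [sinMode_pi, sinMode_zero, mul_zero, mul_zero, sub_zero, zero_sub] at h
  rw [integral_domainMeasure_eq, integral_domainMeasure_eq,
    ← intervalIntegral.integral_const_mul, ← neg_eq_iff_eq_neg, ← h]
  exact intervalIntegral.integral_congr fun x _ => by ring

theorem exists_bcf_eq {φ : ℝ → ℝ} (hφ : Continuous φ) (hc : HasCompactSupport φ) :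
    ∃ ψ : ℝ →ᵇ ℝ, ∀ x, ψ x = φ x := by
  obtain ⟨C, hC⟩ := hc.exists_bound_of_continuous hφ
  exact ⟨BoundedContinuousFunction.ofNormedAddCommGroup φ hφ C hC, fun x => rfl⟩

/-- Termwise weak differentiation of a sine series. -/
theorem hasWeakDeriv_of_hasSum {a : ℕ → EuclideanSpace ℝ (Fin n)} {y z : L2Space ℝ n}
    (hy : HasSum (fun k => sinV n k (a k)) y)
    (hz : HasSum (fun k => cosV n k (((k : ℝ) + 1) • a k)) z) : HasWeakDeriv y z where
  memLp := Lp.memLp y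
  memLp_deriv := Lp.memLp z
  integral_eq := by
    intro φ hφ hc _
    obtain ⟨ψ, hψ⟩ := exists_bcf_eq hφ.continuous hc
    obtain ⟨ψ', hψ'⟩ := exists_bcf_eq (hφ.continuous_deriv (by simp)) hc.deriv
    refine ext_inner_left ℝ fun e => ?_
    simp only [← hψ, ← hψ']
    rw [inner_neg_right, ← inner_lpMode, ← inner_lpMode]
    have h1 := hy.mapL (innerSL ℝ (lpMode n ψ' e))
    have h2 := (hz.mapL (innerSL ℝ (lpMode n ψ e))).neg
    refine h1.unique ?_
    convert! h2 using 1
    ext k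
    change inner ℝ (lpMode n ψ' e) (lpMode n (sinB k) (a k))
      = -inner ℝ (lpMode n ψ e) (lpMode n (cosB k) (((k : ℝ) + 1) • a k))
    rw [inner_lpMode_lpMode, inner_lpMode_lpMode, real_inner_smul_right]
    simp only [hψ, hψ', sinB_apply, cosB_apply]
    rw [integral_deriv_mul_sinMode k (hφ.of_le (by simp))]
    ring

theorem HasWeakDeriv.congr {E : Type*} [NormedAddCommGroup E] [NormedSpace ℝ E] {f f' g : ℝ → E}
    (h : HasWeakDeriv f g) (hf : f =ᵐ[domainMeasure] f') : HasWeakDeriv f' g where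
  memLp := h.memLp.ae_eq hf
  memLp_deriv := h.memLp_deriv
  integral_eq := by
    intro φ hφ hc hs
    rw [← h.integral_eq φ hφ hc hs]
    refine integral_congr_ae ?_
    filter_upwards [hf] with x hx
    rw [hx]

/-- The embedding of `h¹` in `ℓ¹`, from `p q ≤ p² + q²` with `p = (k+1) ‖a_k‖` and `q = 1 / (k+1)`.
It makes sine series of `H¹₀` functions uniformly convergent, hence meaningful at the point `x₀`. -/
theorem summable_norm_of_summable_sq_mul {a : ℕ → EuclideanSpace ℝ (Fin n)}
    (h : Summable fun k : ℕ => (((k : ℝ) + 1) * ‖a k‖) ^ 2) : Summable fun k => ‖a k‖ := by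
  have h2 : Summable fun k : ℕ => 1 / ((k : ℝ) + 1) ^ 2 := by
    have := (summable_nat_add_iff 1).2 (Real.summable_one_div_nat_pow.2 one_lt_two)
    simpa using this
  refine Summable.of_nonneg_of_le (fun k => norm_nonneg _) (fun k => ?_) (h.add h2)
  have hk : (0 : ℝ) < (k : ℝ) + 1 := by positivity
  have h3 : ‖a k‖ = (((k : ℝ) + 1) * ‖a k‖) * (1 / ((k : ℝ) + 1)) := by field_simp
  have h4 : 1 / ((k : ℝ) + 1) ^ 2 = (1 / ((k : ℝ) + 1)) ^ 2 := by rw [_root_.one_div_pow]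
  rw [h4, h3]
  set p := ((k : ℝ) + 1) * ‖a k‖
  set q := 1 / ((k : ℝ) + 1)
  have e : ((k : ℝ) + 1) * (p * q) = p := by
    simp only [p, q]
    field_simp
  rw [e]
  nlinarith [sq_nonneg (p - q), sq_nonneg p, sq_nonneg q]

/-- A sine series whose coefficients are in `h¹` represents an element of `H¹₀`. -/
theorem isH10_tsum_sinMode {a : ℕ → EuclideanSpace ℝ (Fin n)} {y z : L2Space ℝ n}
    (hy : HasSum (fun k => sinV n k (a k)) y)
    (hz : HasSum (fun k => cosV n k (((k : ℝ) + 1) • a k)) z) :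
    (fun x => ∑' k, sinMode k x • a k) =ᵐ[domainMeasure] y ∧
      IsH10 (fun x => ∑' k, sinMode k x • a k) z := by
  have h1 := (hasSum_norm_sq_of_orthogonalFamily orthogonalFamily_cosV hz).summable
  have h2 : Summable fun k => ‖a k‖ := by
    refine summable_norm_of_summable_sq_mul (h1.congr fun k => ?_)
    rw [norm_smul, Real.norm_of_nonneg (by positivity)]
  have h3 := ae_eq_tsum_sinMode_smul h2 hy
  refine ⟨h3, (hasWeakDeriv_of_hasSum hy hz).congr h3.symm,
    (continuous_tsum_sinMode_smul h2).continuousOn, ?_, ?_⟩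
  · simp [sinMode_zero]
  · simp [sinMode_pi]

theorem toLp_sinCoef_eq {v : ℝ → EuclideanSpace ℝ (Fin n)} (hv : MemLp v 2 domainMeasure) (k : ℕ) :
    sinCoef n k (hv.toLp v) = ∫ x, sinMode k x • v x ∂domainMeasure := by
  rw [sinCoef_eq_integral]
  refine integral_congr_ae ?_
  filter_upwards [hv.coeFn_toLp] with x hx
  rw [hx]

theorem toLp_cosCoef_eq {v : ℝ → EuclideanSpace ℝ (Fin n)} (hv : MemLp v 2 domainMeasure) (k : ℕ) :
    cosCoef n k (hv.toLp v) = ∫ x, cosMode k x • v x ∂domainMeasure := by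
  rw [cosCoef_eq_integral]
  refine integral_congr_ae ?_
  filter_upwards [hv.coeFn_toLp] with x hx
  rw [hx]

theorem IsH10.integral_cosMode_smul {E : Type*} [NormedAddCommGroup E] [NormedSpace ℝ E]
    [CompleteSpace E] {f g : ℝ → E} (h : IsH10 f g) (k : ℕ) :
    ∫ x, cosMode k x • g x ∂domainMeasure
      = ((k : ℝ) + 1) • ∫ x, sinMode k x • f x ∂domainMeasure := by
  rw [h.integral_smul_eq (contDiff_cosMode k), deriv_cosMode, ← integral_neg, ← integral_smul]
  congr 1
  ext x
  rw [neg_smul, neg_neg, mul_smul]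

theorem HasWeakDeriv.integral_sinMode_smul {E : Type*} [NormedAddCommGroup E] [NormedSpace ℝ E]
    [CompleteSpace E] {f g : ℝ → E} (h : HasWeakDeriv f g) (k : ℕ) :
    ∫ x, sinMode k x • g x ∂domainMeasure
      = -(((k : ℝ) + 1) • ∫ x, cosMode k x • f x ∂domainMeasure) := by
  rw [h.integral_smul_eq (contDiff_sinMode k) (sinMode_zero k) (sinMode_pi k), deriv_sinMode,
    ← integral_smul]
  simp only [mul_smul]

/-- The sine coefficients of an `H¹₀` function are in `h¹`. -/
theorem IsH10.summable_sq {v vx : ℝ → EuclideanSpace ℝ (Fin n)} (h : IsH10 v vx) :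
    Summable fun k : ℕ => (((k : ℝ) + 1) * ‖∫ x, sinMode k x • v x ∂domainMeasure‖) ^ 2 := by
  refine (summable_norm_sq_cosCoef (h.weakDeriv.memLp_deriv.toLp vx)).congr fun k => ?_
  rw [toLp_cosCoef_eq, h.integral_cosMode_smul, norm_smul, Real.norm_of_nonneg (by positivity)]

/-- The sine series of an `H¹₀` function converges pointwise to it. -/
theorem IsH10.hasSum_sinMode {v vx : ℝ → EuclideanSpace ℝ (Fin n)} (h : IsH10 v vx) {x : ℝ}
    (hx : x ∈ Set.Icc 0 Real.pi) :
    HasSum (fun k => sinMode k x • ∫ x, sinMode k x • v x ∂domainMeasure) (v x) := by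
  set V := h.weakDeriv.memLp.toLp v
  have h1 := summable_norm_of_summable_sq_mul h.summable_sq
  have h2 := hasSum_sinV V
  simp only [V, toLp_sinCoef_eq] at h2
  have h3 := (ae_eq_tsum_sinMode_smul h1 h2).trans h.weakDeriv.memLp.coeFn_toLp
  have h4 := eqOn_Icc_of_ae_eq (continuous_tsum_sinMode_smul h1).continuousOn h.continuousOn h3 hx
  rw [← h4]
  refine Summable.hasSum (Summable.of_norm_bounded (h1.mul_left √(2 / Real.pi)) fun k => ?_)
  rw [norm_smul]
  exact mul_le_mul_of_nonneg_right (abs_sinMode_le k x) (norm_nonneg _)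

/-- The functional `y ↦ ∫ ⟨M y, v⟩` is represented by an element of `L²`. -/
theorem exists_integral_inner_act_eq (M : Matrix (Fin n) (Fin n) ℝ)
    {v : ℝ → EuclideanSpace ℝ (Fin n)} (hv : MemLp v 2 domainMeasure) :
    ∃ W : L2Space ℝ n, ∀ y : L2Space ℝ n,
      ∫ x, inner ℝ (act M (y x)) (v x) ∂domainMeasure = inner ℝ y W := by
  set A := Matrix.toEuclideanCLM (n := Fin n) (𝕜 := ℝ) M
  have hW : MemLp (fun x => A.adjoint (v x)) 2 domainMeasure := A.adjoint.comp_memLp' hv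
  refine ⟨hW.toLp _, fun y => ?_⟩
  rw [L2.inner_def]
  refine integral_congr_ae ?_
  filter_upwards [hW.coeFn_toLp] with x hx
  rw [hx, ContinuousLinearMap.adjoint_inner_right]
  rfl

theorem integral_inner_act_lpMode (M : Matrix (Fin n) (Fin n) ℝ) (φ : ℝ →ᵇ ℝ)
    {v : ℝ → EuclideanSpace ℝ (Fin n)} (hv : MemLp v 2 domainMeasure)
    (a : EuclideanSpace ℝ (Fin n)) :
    ∫ x, inner ℝ (act M (lpMode n φ a x)) (v x) ∂domainMeasure
      = inner ℝ (act M a) (∫ x, φ x • v x ∂domainMeasure) := by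
  rw [← integral_inner (integrable_smul_domainMeasure φ.continuous (hv.integrable (by norm_num)))]
  refine integral_congr_ae ?_
  filter_upwards [coeFn_lpMode φ a] with x hx
  rw [hx, act_smul, real_inner_smul_left, real_inner_smul_right]

/-- Termwise integration against the image of a mode sum under a matrix. -/
theorem hasSum_integral_inner_act (M : Matrix (Fin n) (Fin n) ℝ) {φ : ℕ → ℝ →ᵇ ℝ}
    {a : ℕ → EuclideanSpace ℝ (Fin n)} {y : L2Space ℝ n}
    (hy : HasSum (fun k => lpMode n (φ k) (a k)) y)
    {v : ℝ → EuclideanSpace ℝ (Fin n)} (hv : MemLp v 2 domainMeasure) :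
    HasSum (fun k => inner ℝ (act M (a k)) (∫ x, φ k x • v x ∂domainMeasure))
      (∫ x, inner ℝ (act M (y x)) (v x) ∂domainMeasure) := by
  obtain ⟨W, hW⟩ := exists_integral_inner_act_eq M hv
  have h := hy.mapL (innerSLFlip ℝ W)
  rw [hW]
  convert! h using 1
  ext k
  rw [← integral_inner_act_lpMode M (φ k) hv, hW]
  rfl

theorem integral_inner_eq_inner_toLp (y : L2Space ℝ n) {v : ℝ → EuclideanSpace ℝ (Fin n)}
    (hv : MemLp v 2 domainMeasure) :
    ∫ x, inner ℝ (y x) (v x) ∂domainMeasure = inner ℝ y (hv.toLp v) := by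
  rw [L2.inner_def]
  refine integral_congr_ae ?_
  filter_upwards [hv.coeFn_toLp] with x hx
  rw [hx]

/-- The spatial part of the weak formulation, in terms of sine coefficients. -/
theorem hasSum_spatial {a : ℕ → EuclideanSpace ℝ (Fin n)} {y z : L2Space ℝ n}
    (hy : HasSum (fun k => sinV n k (a k)) y)
    (hz : HasSum (fun k => cosV n k (((k : ℝ) + 1) • a k)) z)
    {v vx : ℝ → EuclideanSpace ℝ (Fin n)} (hv : IsH10 v vx) :
    HasSum (fun k => inner ℝ (modeOp n d α k (a k)) (∫ x, sinMode k x • v x ∂domainMeasure))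
      ((∫ x, inner ℝ (act (matD n d) (z x)) (vx x) ∂domainMeasure)
        + ∫ x, inner ℝ (act (matA n α) (y x)) (v x) ∂domainMeasure) := by
  have h1 := hasSum_integral_inner_act (matD n d) (φ := cosB) hz hv.weakDeriv.memLp_deriv
  have h2 := hasSum_integral_inner_act (matA n α) (φ := sinB) hy hv.weakDeriv.memLp
  convert! h1.add h2 using 1
  ext k
  simp only [cosB_apply, sinB_apply]
  rw [hv.integral_cosMode_smul, modeOp_eq_act_add, act_smul, inner_add_left, real_inner_smul_left,
    real_inner_smul_left, real_inner_smul_right]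
  ring

/-- Measurability comes from the partial sums; the square norm is a series of nonnegative terms by
Pythagoras, so Tonelli integrates it term by term. -/
theorem memLp_two_of_hasSum_orthogonalFamily {H G : Type*} [NormedAddCommGroup H]
    [InnerProductSpace ℝ H] [CompleteSpace H] [NormedAddCommGroup G] [InnerProductSpace ℝ G]
    {V : ℕ → G →ₗᵢ[ℝ] H} (hV : OrthogonalFamily ℝ (fun _ : ℕ => G) V) {μ : Measure ℝ}
    {a : ℕ → ℝ → G} (ha : ∀ k, Continuous (a k)) {z : ℝ → H}
    (hz : ∀ᵐ t ∂μ, HasSum (fun k => V k (a k t)) (z t)) {b : ℕ → ℝ} (hb : Summable b)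
    (hai : ∀ k, Integrable (fun t => ‖a k t‖ ^ 2) μ) (hab : ∀ k, ∫ t, ‖a k t‖ ^ 2 ∂μ ≤ b k) :
    MemLp z 2 μ := by
  refine ⟨?_, ?_⟩
  · refine aestronglyMeasurable_of_tendsto_ae atTop
      (f := fun N t => ∑ k ∈ Finset.range N, V k (a k t)) (fun N => ?_)
      (hz.mono fun t ht => ht.tendsto_sum_nat)
    exact (continuous_finsetSum _ fun k _ =>
      (V k).continuous.comp (ha k)).aestronglyMeasurable
  · rw [eLpNorm_lt_top_iff_lintegral_rpow_enorm_lt_top two_ne_zero ENNReal.ofNat_ne_top]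
    have h1 : ∀ᵐ t ∂μ, ‖z t‖ₑ ^ (2 : ℝ≥0∞).toReal = ∑' k, ENNReal.ofReal (‖a k t‖ ^ 2) := by
      filter_upwards [hz] with t ht
      have h2 := hasSum_norm_sq_of_orthogonalFamily hV ht
      rw [← ENNReal.ofReal_tsum_of_nonneg (fun k => sq_nonneg _) h2.summable, h2.tsum_eq,
        ENNReal.ofReal_pow (norm_nonneg _), ofReal_norm]
      simp
    have h2 : ∀ k, AEMeasurable (fun t => ENNReal.ofReal (‖a k t‖ ^ 2)) μ := fun k =>
      ((ha k).norm.pow 2).measurable.ennreal_ofReal.aemeasurable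
    rw [lintegral_congr_ae h1, lintegral_tsum h2]
    calc ∑' k, ∫⁻ t, ENNReal.ofReal (‖a k t‖ ^ 2) ∂μ ≤ ∑' k, ENNReal.ofReal (b k) := by
          refine ENNReal.tsum_le_tsum fun k => ?_
          rw [← ofReal_integral_eq_lintegral_ofReal (hai k)
            (Eventually.of_forall fun t => sq_nonneg _)]
          exact ENNReal.ofReal_le_ofReal (hab k)
      _ = ENNReal.ofReal (∑' k, b k) :=
          (ENNReal.ofReal_tsum_of_nonneg
            (fun k => (integral_nonneg fun t => sq_nonneg _).trans (hab k)) hb).symm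
      _ < ⊤ := ENNReal.ofReal_lt_top

variable {u : ℝ → ℝ} (hu : Continuous u)

include hu

/-- The expansion of the final state is recorded along with existence, so that no uniqueness theorem
for weak solutions is needed later. -/
theorem exists_isWeakSolution (hd : 1 ≤ d) (hx₀ : x₀ ∈ Set.Ioo 0 Real.pi) {T : ℝ} (hT : 0 < T)
    (y₀ : L2Space ℝ n) :
    ∃ y : ℝ → L2Space ℝ n, IsWeakSolution n d α x₀ T u y₀ y ∧
      HasSum (fun k => sinV n k (modeSol n d α x₀ k (sinCoef n k y₀) u T)) (y T) := by
  set w : ℕ → EuclideanSpace ℝ (Fin n) := fun k => sinCoef n k y₀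
  set Y : ℕ → ℝ → EuclideanSpace ℝ (Fin n) := fun k => modeSol n d α x₀ k (w k) u
  obtain ⟨C, hC, hY⟩ := exists_norm_modeSol_le (u := u) hu n α x₀ hd T
  replace hY : ∀ k, ∀ t ∈ Set.Icc 0 T, ‖Y k t‖ ≤ C * (Real.exp (-(((k : ℝ) + 1) ^ 2 / 2) * t) * ‖w k‖
        + 1 / ((k : ℝ) + 1) ^ 2) := fun k t ht => hY k (w k) t ht
  have hYc : ∀ k, Continuous (Y k) := fun k => continuous_modeSol hu k (w k)
  have hw : Summable fun k => ‖w k‖ ^ 2 := summable_norm_sq_sinCoef y₀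
  have hq : Summable fun k : ℕ => 1 / ((k : ℝ) + 1) ^ 2 := by
    have := (summable_nat_add_iff 1).2 (Real.summable_one_div_nat_pow.2 one_lt_two)
    simpa using this
  have hq4 : Summable fun k : ℕ => (1 / ((k : ℝ) + 1) ^ 2) ^ 2 := by
    refine Summable.of_nonneg_of_le (fun k => by positivity) (fun k => ?_) hq
    refine pow_le_of_le_one (by positivity) ?_ two_ne_zero
    rw [div_le_one (by positivity)]
    nlinarith [k.cast_nonneg (α := ℝ)]
  have hb : Summable fun k : ℕ => (C * (‖w k‖ + 1 / ((k : ℝ) + 1) ^ 2)) ^ 2 := by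
    refine Summable.of_nonneg_of_le (fun k => sq_nonneg _) (fun k => ?_)
      ((hw.add hq4).mul_left (2 * C ^ 2))
    rw [mul_pow, mul_comm (2 : ℝ), mul_assoc]
    refine mul_le_mul_of_nonneg_left ?_ (sq_nonneg C)
    nlinarith [sq_nonneg (‖w k‖ - 1 / ((k : ℝ) + 1) ^ 2)]
  have hYb : ∀ k, ∀ t ∈ Set.Icc 0 T, ‖Y k t‖ ≤ C * (‖w k‖ + 1 / ((k : ℝ) + 1) ^ 2) := by
    intro k t ht
    refine (hY k t ht).trans ?_
    gcongr
    refine mul_le_of_le_one_left (norm_nonneg _) (Real.exp_le_one_iff.2 ?_)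
    have := ht.1
    have : 0 ≤ (((k : ℝ) + 1) ^ 2 / 2) * t := by positivity
    linarith
  set y : ℝ → L2Space ℝ n := fun t => ∑' k, sinV n k (Y k t)
  have hy : ∀ t ∈ Set.Icc 0 T, HasSum (fun k => sinV n k (Y k t)) (y t) := by
    intro t ht
    refine exists_hasSum_of_orthogonalFamily orthogonalFamily_sinV ?_
    exact Summable.of_nonneg_of_le (fun k => sq_nonneg _)
      (fun k => pow_le_pow_left₀ (norm_nonneg _) (hYb k t ht) 2) hb
  set z : ℝ → L2Space ℝ n := fun t => ∑' k, cosV n k (((k : ℝ) + 1) • Y k t)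
  -- The bound is shaped for time integration: `(k+1)² exp(-(k+1)² t)` has integral at most `1`,
  -- leaving the summable `‖w_k‖²`.
  have hsq : ∀ k : ℕ, ∀ t ∈ Set.Icc 0 T, ‖((k : ℝ) + 1) • Y k t‖ ^ 2
      ≤ 2 * C ^ 2 * (((k : ℝ) + 1) ^ 2 * Real.exp (-((k : ℝ) + 1) ^ 2 * t) * ‖w k‖ ^ 2
        + 1 / ((k : ℝ) + 1) ^ 2) := by
    intro k t ht
    have h1 := pow_le_pow_left₀ (norm_nonneg _) (hY k t ht) 2
    rw [norm_smul, mul_pow, Real.norm_of_nonneg (by positivity)]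
    have e : Real.exp (-((k : ℝ) + 1) ^ 2 * t)
        = Real.exp (-(((k : ℝ) + 1) ^ 2 / 2) * t) ^ 2 := by
      rw [← Real.exp_nat_mul]
      congr 1
      push_cast
      ring
    rw [e]
    set p := Real.exp (-(((k : ℝ) + 1) ^ 2 / 2) * t) * ‖w k‖ with hp
    set κ : ℝ := (k : ℝ) + 1
    have hκ : 0 < κ := by positivity
    calc κ ^ 2 * ‖Y k t‖ ^ 2 ≤ κ ^ 2 * (C * (p + 1 / κ ^ 2)) ^ 2 := by gcongr
      _ ≤ κ ^ 2 * (C ^ 2 * (2 * (p ^ 2 + (1 / κ ^ 2) ^ 2))) := by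
        rw [mul_pow]
        gcongr
        nlinarith [sq_nonneg (p - 1 / κ ^ 2)]
      _ = _ := by
        rw [hp]
        field_simp
  -- Time `0` is excluded since the initial datum is only in `L²`; for `t > 0` the factor `(k+1)²
  -- exp(-(k+1)² t)` is at most `1 / t`.
  have hz : ∀ t ∈ Set.Ioc 0 T, HasSum (fun k => cosV n k (((k : ℝ) + 1) • Y k t)) (z t) := by
    intro t ht
    refine exists_hasSum_of_orthogonalFamily orthogonalFamily_cosV ?_
    have h1 : Summable fun k : ℕ => ((k : ℝ) + 1) ^ 2 * Real.exp (-((k : ℝ) + 1) ^ 2 * t)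
        * ‖w k‖ ^ 2 := by
      refine Summable.of_nonneg_of_le (fun k => by positivity) (fun k => ?_)
        (hw.mul_left (1 / t))
      gcongr
      rw [neg_mul, Real.exp_neg, ← div_eq_mul_inv, div_le_iff₀ (Real.exp_pos _), one_div,
        inv_mul_eq_div, le_div_iff₀ ht.1]
      linarith [Real.add_one_le_exp (((k : ℝ) + 1) ^ 2 * t)]
    exact Summable.of_nonneg_of_le (fun k => sq_nonneg _) (fun k => hsq k t ⟨ht.1.le, ht.2⟩)
      ((h1.add hq).mul_left _)
  refine ⟨y, ⟨?_, ?_, z, ?_, ?_, ?_⟩, hy T (Set.right_mem_Icc.2 hT.le)⟩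
  · exact continuousOn_tsum_of_orthogonalFamily orthogonalFamily_sinV
      (fun k => (hYc k).continuousOn) hb hYb
  · have h0 : (fun k => sinV n k (Y k 0)) = fun k => sinV n k (sinCoef n k y₀) := by
      ext k : 1
      simp only [Y, modeSol_zero, w]
    change ∑' k, sinV n k (Y k 0) = y₀
    rw [h0]
    exact (hasSum_sinV y₀).tsum_eq
  · refine memLp_two_of_hasSum_orthogonalFamily orthogonalFamily_cosV
      (a := fun k t => ((k : ℝ) + 1) • Y k t) (fun k => (hYc k).const_smul ((k : ℝ) + 1))
      ((ae_restrict_iff' measurableSet_Ioo).2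
        (Eventually.of_forall fun t ht => hz t ⟨ht.1, ht.2.le⟩))
      (((hw.add (hq.mul_left T)).mul_left (2 * C ^ 2))) (fun k => ?_) (fun k => ?_)
    · exact ((((hYc k).const_smul ((k : ℝ) + 1)).norm.pow 2).continuousOn.integrableOn_Icc
        (a := 0) (b := T)).mono_set Set.Ioo_subset_Icc_self
    · have hκ : (0 : ℝ) < ((k : ℝ) + 1) ^ 2 := by positivity
      have hci : Continuous fun t : ℝ => ((k : ℝ) + 1) ^ 2
          * Real.exp (-((k : ℝ) + 1) ^ 2 * t) * ‖w k‖ ^ 2 := by fun_prop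
      rw [← integral_Ioc_eq_integral_Ioo, ← intervalIntegral.integral_of_le hT.le]
      calc _ ≤ ∫ t in (0 : ℝ)..T, 2 * C ^ 2 * (((k : ℝ) + 1) ^ 2
              * Real.exp (-((k : ℝ) + 1) ^ 2 * t) * ‖w k‖ ^ 2 + 1 / ((k : ℝ) + 1) ^ 2) := by
            refine intervalIntegral.integral_mono_on hT.le
              ((((hYc k).const_smul ((k : ℝ) + 1)).norm.pow 2).intervalIntegrable _ _)
              ((continuous_const.mul (hci.add continuous_const)).intervalIntegrable _ _)
              fun t ht => hsq k t ht
        _ = 2 * C ^ 2 * (((k : ℝ) + 1) ^ 2 * (∫ t in (0 : ℝ)..T,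
              Real.exp (-((k : ℝ) + 1) ^ 2 * t)) * ‖w k‖ ^ 2 + T * (1 / ((k : ℝ) + 1) ^ 2)) := by
            rw [intervalIntegral.integral_const_mul, intervalIntegral.integral_add
              (hci.intervalIntegrable _ _) (continuous_const.intervalIntegrable _ _),
              intervalIntegral.integral_mul_const, intervalIntegral.integral_const_mul,
              intervalIntegral.integral_const, sub_zero, smul_eq_mul]
        _ ≤ 2 * C ^ 2 * (((k : ℝ) + 1) ^ 2 * (1 / ((k : ℝ) + 1) ^ 2) * ‖w k‖ ^ 2
              + T * (1 / ((k : ℝ) + 1) ^ 2)) := by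
            gcongr
            exact integral_exp_neg_mul_le hκ T
        _ = _ := by
            rw [mul_one_div_cancel hκ.ne', one_mul]
  · refine (ae_restrict_iff' measurableSet_Ioo).2 (Eventually.of_forall fun t ht => ?_)
    obtain ⟨h1, h2⟩ := isH10_tsum_sinMode (hy t ⟨ht.1.le, ht.2.le⟩) (hz t ⟨ht.1, ht.2.le⟩)
    exact ⟨_, h1, h2⟩
  · intro v vx hv t ht
    set vk : ℕ → EuclideanSpace ℝ (Fin n) := fun k => ∫ x, sinMode k x • v x ∂domainMeasure
    have hvk : Summable fun k => ‖vk k‖ ^ 2 := by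
      refine (summable_norm_sq_sinCoef (hv.weakDeriv.memLp.toLp v)).congr fun k => ?_
      rw [toLp_sinCoef_eq]
    have hvk1 : Summable fun k => ‖vk k‖ := summable_norm_of_summable_sq_mul hv.summable_sq
    have hpair : ∀ {a : ℕ → EuclideanSpace ℝ (Fin n)} {p : L2Space ℝ n},
        HasSum (fun k => sinV n k (a k)) p →
        HasSum (fun k => inner ℝ (a k) (vk k)) (∫ x, inner ℝ (p x) (v x) ∂domainMeasure) := by
      intro a p hp
      have h := hp.mapL (innerSLFlip ℝ (hv.weakDeriv.memLp.toLp v))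
      rw [integral_inner_eq_inner_toLp p hv.weakDeriv.memLp]
      convert! h using 1
      ext k
      change _ = inner ℝ (sinV n k (a k)) _
      rw [inner_sinV_left, toLp_sinCoef_eq]
    obtain ⟨CL, hCL, hL⟩ := exists_norm_modeOp_le n d α
    have hFc : ∀ k, Continuous fun s => inner ℝ (modeOp n d α k (Y k s)) (vk k) := fun k =>
      ((modeOp n d α k).continuous.comp (hYc k)).inner continuous_const
    have hFi : ∀ k, Integrable (fun s => inner ℝ (modeOp n d α k (Y k s)) (vk k))
        (volume.restrict (Set.Ioc 0 t)) := fun k =>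
      ((hFc k).continuousOn.integrableOn_Icc (a := 0) (b := t)).mono_set Set.Ioc_subset_Icc_self
    -- The factor `(k+1)²` from `L_k` is compensated by the time integral of the decay on the
    -- initial part and by `1 / (k+1)²` on the forced part. What remains is summable because the
    -- coefficients of `v` are in both `ℓ²` and `ℓ¹`.
    have hFs : Summable fun k => ∫ s in Set.Ioc 0 t,
        ‖inner ℝ (modeOp n d α k (Y k s)) (vk k)‖ := by
      refine Summable.of_nonneg_of_le (fun k => integral_nonneg fun s => norm_nonneg _)
        (fun k => ?_) (((hw.add hvk).add (hvk1.mul_left t)).mul_left (CL * C))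
      have hκ : (0 : ℝ) < ((k : ℝ) + 1) ^ 2 / 2 := by positivity
      have hκ0 : ((k : ℝ) + 1) ≠ 0 := by positivity
      have hci : Continuous fun s : ℝ => Real.exp (-(((k : ℝ) + 1) ^ 2 / 2) * s) * ‖w k‖ := by
        fun_prop
      rw [← intervalIntegral.integral_of_le ht.1]
      calc _ ≤ ∫ s in (0 : ℝ)..t, CL * ((k : ℝ) + 1) ^ 2 * (C *
              (Real.exp (-(((k : ℝ) + 1) ^ 2 / 2) * s) * ‖w k‖ + 1 / ((k : ℝ) + 1) ^ 2))
              * ‖vk k‖ := by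
            refine intervalIntegral.integral_mono_on ht.1 ((hFc k).norm.intervalIntegrable _ _)
              (Continuous.intervalIntegrable (by fun_prop) _ _) fun s hs => ?_
            refine (norm_inner_le_norm _ _).trans ?_
            gcongr
            refine (hL k _).trans ?_
            gcongr
            exact hY k s ⟨hs.1, hs.2.trans ht.2⟩
        _ = CL * ((k : ℝ) + 1) ^ 2 * (C *
              ((∫ s in (0 : ℝ)..t, Real.exp (-(((k : ℝ) + 1) ^ 2 / 2) * s)) * ‖w k‖
                + t * (1 / ((k : ℝ) + 1) ^ 2))) * ‖vk k‖ := by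
            rw [intervalIntegral.integral_mul_const, intervalIntegral.integral_const_mul,
              intervalIntegral.integral_const_mul, intervalIntegral.integral_add
              (hci.intervalIntegrable _ _) (continuous_const.intervalIntegrable _ _),
              intervalIntegral.integral_mul_const,
              intervalIntegral.integral_const, sub_zero, smul_eq_mul]
        _ ≤ CL * ((k : ℝ) + 1) ^ 2 * (C * (1 / (((k : ℝ) + 1) ^ 2 / 2) * ‖w k‖
                + t * (1 / ((k : ℝ) + 1) ^ 2))) * ‖vk k‖ := by
            gcongr
            exact integral_exp_neg_mul_le hκ t
        _ = CL * C * (2 * ‖w k‖ * ‖vk k‖ + t * ‖vk k‖) := by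
            field_simp
        _ ≤ _ := by
            gcongr
            exact two_mul_le_add_sq _ _
    have hspat := hasSum_integral_of_summable_integral_norm hFi hFs
    have hspat2 : ∫ s in Set.Ioc 0 t, ∑' k, inner ℝ (modeOp n d α k (Y k s)) (vk k)
        = ∫ s in (0 : ℝ)..t, ((∫ x, inner ℝ (act (matD n d) (z s x)) (vx x) ∂domainMeasure)
            + ∫ x, inner ℝ (act (matA n α) (y s x)) (v x) ∂domainMeasure) := by
      rw [intervalIntegral.integral_of_le ht.1]
      refine setIntegral_congr_fun measurableSet_Ioc fun s hs => ?_
      exact (hasSum_spatial (hy s ⟨hs.1.le, hs.2.trans ht.2⟩) (hz s ⟨hs.1, hs.2.trans ht.2⟩)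
        hv).tsum_eq
    rw [hspat2] at hspat
    have hleft := ((hpair (hy t ht)).sub (hpair (hasSum_sinV y₀))).add hspat
    have hright := (((hv.hasSum_sinMode (Set.Ioo_subset_Icc_self hx₀)).mapL
      (innerSL ℝ (vecB n)))).mul_left (∫ s in (0 : ℝ)..t, u s)
    rw [intervalIntegral.integral_mul_const]
    refine hleft.unique ?_
    convert! hright using 1
    ext k
    rw [← intervalIntegral.integral_of_le ht.1]
    exact inner_modeSol_eq hu k (w k) (vk k) t

end WeakSolution

/-! ### Sufficiency -/

section Sufficiency

variable {n : ℕ} {d α x₀ : ℝ}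

theorem modeSol_add (k : ℕ) (w w' : EuclideanSpace ℝ (Fin n)) {u u' : ℝ → ℝ} (hu : Continuous u)
    (hu' : Continuous u') (t : ℝ) :
    modeSol n d α x₀ k (w + w') (u + u') t
      = modeSol n d α x₀ k w u t + modeSol n d α x₀ k w' u' t := by
  have hc : ∀ {u : ℝ → ℝ}, Continuous u → IntervalIntegrable (fun s => (sinMode k x₀ * u s) •
      NormedSpace.exp (s • modeOp n d α k) (vecB n)) volume 0 t := fun hu =>
    ((continuous_const.mul hu).smul (continuous_exp_smul_modeOp_apply k _)).intervalIntegrable _ _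
  rw [modeSol, modeSol, modeSol, ← map_add]
  simp only [Pi.add_apply, mul_add, add_smul]
  rw [intervalIntegral.integral_add (hc hu) (hc hu')]
  congr 1
  abel

theorem modeSol_smul (k : ℕ) (c : ℝ) (u : ℝ → ℝ) (t : ℝ) :
    modeSol n d α x₀ k 0 (c • u) t = c • modeSol n d α x₀ k 0 u t := by
  rw [modeSol, modeSol, ← map_smul, zero_add, zero_add, ← intervalIntegral.integral_smul]
  congr 1
  refine intervalIntegral.integral_congr fun s _ => ?_
  simp only [Pi.smul_apply, smul_eq_mul, smul_smul]
  congr 1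
  ring

theorem norm_sinCoef_le (k : ℕ) (y : L2Space ℝ n) : ‖sinCoef n k y‖ ≤ ‖y‖ := by
  refine (ContinuousLinearMap.le_of_opNorm_le (sinCoef n k) ?_ y).trans_eq (one_mul _)
  rw [sinCoef, LinearIsometryEquiv.norm_map]
  exact (sinV n k).norm_toContinuousLinearMap_le

/-- The functional measuring the `k`-th mode of the observation of the adjoint state `ψ`. -/
noncomputable def observation (n : ℕ) (x₀ : ℝ) (ψ : L2Space ℝ n) (k : ℕ) :
    EuclideanSpace ℂ (Fin n) →L[ℂ] ℂ :=
  (sinMode k x₀ : ℂ) • innerSL ℂ (toComplex n (sinCoef n k ψ))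

theorem expTerm_observation (ψ : L2Space ℝ n) (k : ℕ) (t : ℝ) :
    expTerm (modeOpℂ n d α k) (observation n x₀ ψ k) (toComplex n (vecB n)) 1 (t : ℂ)
      = ((sinMode k x₀ * inner ℝ (NormedSpace.exp (-t • modeOp n d α k) (vecB n))
          (sinCoef n k ψ) : ℝ) : ℂ) := by
  rw [expTerm, map_one]
  change observation n x₀ ψ k (NormedSpace.exp (-(t : ℂ) • modeOpℂ n d α k)
    (toComplex n (vecB n))) = _
  rw [exp_modeOpℂ_toComplex, observation]
  change (sinMode k x₀ : ℂ) * inner ℂ (toComplex n (sinCoef n k ψ))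
    (toComplex n (NormedSpace.exp (-t • modeOp n d α k) (vecB n))) = _
  rw [inner_toComplex, real_inner_comm, Complex.ofReal_mul]

theorem inner_modeSol_sinCoef {u : ℝ → ℝ} (hu : Continuous u) (ψ : L2Space ℝ n) (k : ℕ) (T : ℝ) :
    ((inner ℝ (modeSol n d α x₀ k 0 u T) (sinCoef n k ψ) : ℝ) : ℂ)
      = ∫ s in (0 : ℝ)..T, u s • expTerm (modeOpℂ n d α k) (observation n x₀ ψ k)
          (toComplex n (vecB n)) 1 ((T - s : ℝ) : ℂ) := by
  have hc : Continuous fun s => (sinMode k x₀ * u s) •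
      NormedSpace.exp (-(T - s) • modeOp n d α k) (vecB n) :=
    (continuous_const.mul hu).smul ((continuous_exp_smul_modeOp_apply k _).comp
      (continuous_const.sub continuous_id).neg)
  rw [modeSol_eq_add hu, map_zero, zero_add]
  have h := (Complex.ofRealCLM.comp (innerSLFlip ℝ (sinCoef n k ψ))).intervalIntegral_comp_comm
    (hc.intervalIntegrable (μ := volume) 0 T)
  refine h.symm.trans (intervalIntegral.integral_congr fun s _ => ?_)
  simp only [expTerm_observation]
  change ((inner ℝ ((sinMode k x₀ * u s) • NormedSpace.exp (-(T - s) • modeOp n d α k) (vecB n))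
    (sinCoef n k ψ) : ℝ) : ℂ) = _
  rw [real_inner_smul_left, Complex.real_smul, ← Complex.ofReal_mul]
  congr 1
  ring

variable (α) in
/-- A state orthogonal to everything reachable from `0` has identically vanishing observation. -/
theorem tsum_observation_eq_zero {T : ℝ} (hT : 0 < T) {C c : ℝ} (hc : 0 ≤ c)
    {ψ : L2Space ℝ n}
    (hexp : ∀ (k : ℕ) (z : ℂ), 0 ≤ z.re → ‖NormedSpace.exp (-z • modeOpℂ n d α k)‖
      ≤ C * Real.exp (c * ‖z‖ - ((k : ℝ) + 1) ^ 2 * (z.re - ‖z‖ / 2)))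
    (hL : ∀ k : ℕ, ‖modeOpℂ n d α k‖ ≤ C * ((k : ℝ) + 1) ^ 2)
    (hf : ∀ k, ‖observation n x₀ ψ k‖ ≤ C)
    (h : ∀ u : ℝ → ℝ, ContDiff ℝ ∞ u → HasCompactSupport u → tsupport u ⊆ Set.Ioo 0 T →
      HasSum (fun k => inner ℝ (modeSol n d α x₀ k 0 u T) (sinCoef n k ψ)) 0) :
    ∀ t ∈ Set.Ioo 0 T, ∑' k, expTerm (modeOpℂ n d α k) (observation n x₀ ψ k)
      (toComplex n (vecB n)) 1 (t : ℂ) = 0 := by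
  set e : ℕ → ℂ → ℂ := fun k => expTerm (modeOpℂ n d α k) (observation n x₀ ψ k)
      (toComplex n (vecB n)) 1
  set g : ℝ → ℂ := fun t => ∑' k, e k (t : ℂ)
  have hg : ContinuousOn g (Set.Ioi 0) := by
    intro t (ht : 0 < t)
    have h1 := (differentiableOn_tsum_expTerm (b := toComplex n (vecB n)) hc hexp hL hf 1
      (δ := t / 4) (by positivity) (t + 1)).continuousOn
    have hmem : (t : ℂ) ∈ truncatedSector (t / 4) (t + 1) :=
      ofReal_mem_truncatedSector ht.le (by linarith) (by linarith)
    have h2 := h1.continuousAt ((isOpen_truncatedSector _ _).mem_nhds hmem)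
    exact (ContinuousAt.comp (f := fun t : ℝ => (t : ℂ)) h2
      Complex.continuous_ofReal.continuousAt).continuousWithinAt
  have hgT : ContinuousOn (fun s => g (T - s)) (Set.Ioo 0 T) :=
    hg.comp (continuous_const.sub continuous_id).continuousOn fun s hs => by
      simpa using hs.2
  have hec : ∀ k, Continuous (e k) := fun k =>
    continuous_iff_continuousAt.2 fun z => (hasDerivAt_expTerm _ _ _ _ z).continuousAt
  have key : ∀ u : ℝ → ℝ, ContDiff ℝ ∞ u → HasCompactSupport u → tsupport u ⊆ Set.Ioo 0 T →
      ∫ s, u s • g (T - s) = 0 := by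
    intro u hu huc hus
    obtain ⟨M, hM⟩ := huc.exists_bound_of_continuous hu.continuous
    have hM0 : 0 ≤ M := (norm_nonneg _).trans (hM 0)
    have hC : 0 ≤ C := (norm_nonneg _).trans (hf 0)
    set F : ℕ → ℝ → ℂ := fun k s => u s • e k ((T - s : ℝ) : ℂ)
    have hFc : ∀ k, Continuous (F k) := fun k =>
      hu.continuous.smul ((hec k).comp (Complex.continuous_ofReal.comp
        (continuous_const.sub continuous_id)))
    have hFi : ∀ k, Integrable (F k) (volume.restrict (Set.Ioc 0 T)) := fun k =>
      ((hFc k).continuousOn.integrableOn_Icc (a := 0) (b := T)).mono_set Set.Ioc_subset_Icc_self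
    have hq : Summable fun k : ℕ => 1 / ((k : ℝ) + 1) ^ 2 := by
      have := (summable_nat_add_iff 1).2 (Real.summable_one_div_nat_pow.2 one_lt_two)
      simpa using this
    set D := M * (C * (C * Real.exp (c * T) * ‖toComplex n (vecB n)‖))
    -- Pointwise bounds degenerate at `s = T`, but integrating the exponential yields a term of
    -- order `1 / (k+1)²`, so sum and integral may be exchanged.
    have hFs : Summable fun k => ∫ s in Set.Ioc 0 T, ‖F k s‖ := by
      refine Summable.of_nonneg_of_le (fun k => integral_nonneg fun s => norm_nonneg _)
        (fun k => ?_) (hq.mul_left (2 * D))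
      have hκ : (0 : ℝ) < ((k : ℝ) + 1) ^ 2 / 2 := by positivity
      rw [← intervalIntegral.integral_of_le hT.le]
      calc _ ≤ ∫ s in (0 : ℝ)..T, D * Real.exp (-(((k : ℝ) + 1) ^ 2 / 2) * (T - s)) := by
            refine intervalIntegral.integral_mono_on hT.le ((hFc k).norm.intervalIntegrable _ _)
              (Continuous.intervalIntegrable (by fun_prop) _ _) fun s hs => ?_
            have hre : 0 ≤ ((T - s : ℝ) : ℂ).re := by
              rw [Complex.ofReal_re]
              linarith [hs.2]
            have hn : ‖((T - s : ℝ) : ℂ)‖ = T - s := by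
              rw [Complex.norm_real, Real.norm_of_nonneg (by linarith [hs.2])]
            have h1 : ‖NormedSpace.exp (-((T - s : ℝ) : ℂ) • modeOpℂ n d α k)‖
                ≤ C * Real.exp (c * T)
                  * Real.exp (-(((k : ℝ) + 1) ^ 2 / 2) * (T - s)) := by
              refine (hexp k _ hre).trans ?_
              rw [mul_assoc, ← Real.exp_add, hn, Complex.ofReal_re]
              gcongr
              nlinarith [mul_nonneg hc hs.1]
            rw [norm_smul]
            calc _ ≤ M * (C * ((C * Real.exp (c * T)
                  * Real.exp (-(((k : ℝ) + 1) ^ 2 / 2) * (T - s)))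
                    * ‖toComplex n (vecB n)‖)) := by
                  refine mul_le_mul (hM s) ?_ (norm_nonneg _) hM0
                  refine ContinuousLinearMap.le_of_opNorm_le_of_le _ (hf k) ?_
                  rw [map_one]
                  exact ContinuousLinearMap.le_of_opNorm_le _ h1 _
              _ = _ := by
                  simp only [D]
                  ring
        _ ≤ D * (1 / (((k : ℝ) + 1) ^ 2 / 2)) := by
            rw [intervalIntegral.integral_const_mul]
            have hD : 0 ≤ D := by positivity
            gcongr
            exact integral_exp_neg_mul_sub_le hκ T
        _ = _ := by
            field_simp
    have h1 := hasSum_integral_of_summable_integral_norm hFi hFs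
    have h2 : HasSum (fun k => ∫ s in Set.Ioc 0 T, F k s) 0 := by
      have := (h u hu huc hus).mapL Complex.ofRealCLM
      rw [map_zero] at this
      convert! this using 1
      ext k
      rw [← intervalIntegral.integral_of_le hT.le]
      exact (inner_modeSol_sinCoef hu.continuous ψ k T).symm
    rw [← h1.unique h2, ← setIntegral_eq_integral_of_forall_compl_eq_zero (s := Set.Ioc 0 T)]
    · refine setIntegral_congr_fun measurableSet_Ioc fun s hs => ?_
      simp only [F, g]
      rw [tsum_const_smul'']
    · intro s hs
      rw [image_eq_zero_of_notMem_tsupport fun hm => hs (Set.Ioo_subset_Ioc_self (hus hm)),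
        zero_smul]
  -- The controls serve as test functions; continuity of `g` on `(0, ∞)` then upgrades vanishing
  -- almost everywhere to vanishing.
  have hae := isOpen_Ioo.ae_eq_zero_of_integral_contDiff_smul_eq_zero
    (hgT.locallyIntegrableOn measurableSet_Ioo) key
  have heq : Set.EqOn (fun s => g (T - s)) 0 (Set.Ioo 0 T) :=
    Measure.eqOn_open_of_ae_eq ((ae_restrict_iff' measurableSet_Ioo).2 hae) isOpen_Ioo hgT
      continuousOn_const
  intro t ht
  have := heq (x := T - t) ⟨by linarith [ht.2], by linarith [ht.1]⟩
  simpa [g] using this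

/-- Unique continuation for the observation of the adjoint system. -/
theorem eq_zero_of_forall_inner_modeSol (hn : 0 < n) (hd : 1 ≤ d) {T : ℝ} (hT : 0 < T)
    (hdisj : DisjointModeSpectra n d α) (hsin : ∀ k, sinMode k x₀ ≠ 0) {ψ : L2Space ℝ n}
    (h : ∀ u : ℝ → ℝ, ContDiff ℝ ∞ u → HasCompactSupport u → tsupport u ⊆ Set.Ioo 0 T →
      HasSum (fun k => inner ℝ (modeSol n d α x₀ k 0 u T) (sinCoef n k ψ)) 0) : ψ = 0 := by
  obtain ⟨C₁, c, hC₁, hc, hexp⟩ := exists_norm_exp_modeOpℂ_le n α hd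
  obtain ⟨C₂, hC₂, hL⟩ := exists_norm_modeOpℂ_le n d α
  set C₃ := √(2 / Real.pi) * ‖ψ‖
  have hC₃ : 0 ≤ C₃ := by positivity
  set C := C₁ + C₂ + C₃
  have hexp' : ∀ (k : ℕ) (z : ℂ), 0 ≤ z.re → ‖NormedSpace.exp (-z • modeOpℂ n d α k)‖
      ≤ C * Real.exp (c * ‖z‖ - ((k : ℝ) + 1) ^ 2 * (z.re - ‖z‖ / 2)) := by
    intro k z hz
    refine (hexp k z hz).trans (mul_le_mul_of_nonneg_right ?_ (Real.exp_pos _).le)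
    simp only [C]
    linarith
  have hL' : ∀ k : ℕ, ‖modeOpℂ n d α k‖ ≤ C * ((k : ℝ) + 1) ^ 2 := by
    intro k
    refine (hL k).trans (mul_le_mul_of_nonneg_right ?_ (sq_nonneg _))
    simp only [C]
    linarith
  have hf : ∀ k, ‖observation n x₀ ψ k‖ ≤ C := by
    intro k
    have h1 : ‖observation n x₀ ψ k‖ ≤ C₃ := by
      rw [observation, norm_smul, innerSL_apply_norm, norm_toComplex, Complex.norm_real]
      exact mul_le_mul (abs_sinMode_le k x₀) (norm_sinCoef_le k ψ) (norm_nonneg _)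
        (Real.sqrt_nonneg _)
    simp only [C]
    linarith
  have hzero := tsum_observation_eq_zero α hT hc hexp' hL' hf h
  refine eq_zero_of_sinCoef_eq_zero fun m => ?_
  have hm := eq_zero_of_tsum_expTerm_eq_zero hc hexp' hL' hf hT hzero
    (fun k => (modeMatrixℂ n d α k).charpoly) (aeval_modeOpℂ_charpoly n d α)
    (fun k l hkl => hdisj.isUnit_aeval hn hkl) (modeOpℂ_cyclic n d α) m
  -- Evaluating the zero functional at its own vector gives `sin_m(x₀) ‖ψ_m‖² = 0`.
  have h1 : toComplex n (sinCoef n m ψ) = 0 := by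
    have h3 : (sinMode m x₀ : ℂ) * inner ℂ (toComplex n (sinCoef n m ψ))
        (toComplex n (sinCoef n m ψ)) = 0 :=
      congrArg (fun ℓ : EuclideanSpace ℂ (Fin n) →L[ℂ] ℂ => ℓ (toComplex n (sinCoef n m ψ))) hm
    exact inner_self_eq_zero.1 ((mul_eq_zero.1 h3).resolve_left (by exact_mod_cast hsin m))
  rw [← norm_eq_zero, ← norm_toComplex, h1, norm_zero]

/-- The states reachable from `0` with smooth controls supported in `(0, T)`. -/
noncomputable def reachable (n : ℕ) (d α x₀ T : ℝ) : Submodule ℝ (L2Space ℝ n) where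
  carrier := {p | ∃ u : ℝ → ℝ, (ContDiff ℝ ∞ u ∧ HasCompactSupport u ∧ tsupport u ⊆ Set.Ioo 0 T) ∧
    HasSum (fun k => sinV n k (modeSol n d α x₀ k 0 u T)) p}
  add_mem' := by
    rintro p q ⟨u, ⟨hu, huc, hus⟩, hp⟩ ⟨v, ⟨hv, hvc, hvs⟩, hq⟩
    refine ⟨u + v, ⟨hu.add hv, huc.add hvc,
      (tsupport_add u v).trans (Set.union_subset hus hvs)⟩, ?_⟩
    convert! hp.add hq using 1
    ext k : 1
    have := modeSol_add (n := n) (d := d) (α := α) (x₀ := x₀) k 0 0 hu.continuous hv.continuous T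
    rw [add_zero] at this
    rw [this, map_add]
  zero_mem' := by
    refine ⟨0, ⟨contDiff_const, HasCompactSupport.zero, by simp⟩, ?_⟩
    convert! hasSum_zero using 1
    ext k : 1
    simp [modeSol]
  smul_mem' := by
    rintro c p ⟨u, ⟨hu, huc, hus⟩, hp⟩
    refine ⟨c • u, ⟨hu.const_smul c, huc.smul_left (f := fun _ => c),
      (tsupport_smul_subset_right (fun _ => c) u).trans hus⟩, ?_⟩
    convert! hp.const_smul c using 1
    ext k : 1
    rw [modeSol_smul, map_smul]

/-- Linearity reduces the claim to density of the states reachable from `0`, which is unique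
continuation for vectors in the orthogonal complement. The control for a general target then steers
`0` close to `yT - y₁ T`, where `y₁` is the uncontrolled solution. -/
theorem approximatelyControllable_of_disjointModeSpectra (hn : 0 < n) (hd : 1 ≤ d)
    (hx₀ : x₀ ∈ Set.Ioo 0 Real.pi) {T : ℝ} (hT : 0 < T)
    (hdisj : DisjointModeSpectra n d α) (hsin : ∀ k, sinMode k x₀ ≠ 0) :
    ApproximatelyControllable n d α x₀ T := by
  have hdense : (reachable n d α x₀ T).topologicalClosure = ⊤ := by
    rw [Submodule.topologicalClosure_eq_top_iff, Submodule.eq_bot_iff]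
    intro ψ hψ
    refine eq_zero_of_forall_inner_modeSol hn hd hT hdisj hsin fun u hu huc hus => ?_
    obtain ⟨y, -, hy⟩ := exists_isWeakSolution (α := α) hu.continuous hd hx₀ hT (0 : L2Space ℝ n)
    simp only [map_zero] at hy
    have h1 := (Submodule.mem_orthogonal _ _).1 hψ (y T) ⟨u, ⟨hu, huc, hus⟩, hy⟩
    have h2 := hy.mapL (innerSLFlip ℝ ψ)
    change HasSum _ (inner ℝ (y T) ψ) at h2
    rw [h1] at h2
    convert! h2 using 1
    ext k
    exact (inner_sinV_left k _ ψ).symm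
  intro y₀ yT ε hε
  obtain ⟨y₁, -, hy₁⟩ := exists_isWeakSolution (x₀ := x₀) (α := α) (u := fun _ => 0)
    continuous_const hd hx₀ hT y₀
  have hmem : yT - y₁ T ∈ closure (reachable n d α x₀ T : Set (L2Space ℝ n)) := by
    rw [← Submodule.topologicalClosure_coe, hdense]
    trivial
  obtain ⟨p, ⟨u, ⟨hu, huc, hus⟩, hp⟩, hdist⟩ := Metric.mem_closure_iff.1 hmem ε hε
  obtain ⟨y, hy, hyT⟩ := exists_isWeakSolution (x₀ := x₀) (α := α) hu.continuous hd hx₀ hT y₀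
  refine ⟨u, (hu.continuous.memLp_of_hasCompactSupport huc).restrict _, y, hy, ?_⟩
  have hsum : y T = y₁ T + p := by
    refine hyT.unique ?_
    convert! hy₁.add hp using 1
    ext k : 1
    have := modeSol_add (n := n) (d := d) (α := α) (x₀ := x₀) k (sinCoef n k y₀) 0
      (u := fun _ => 0) continuous_const hu.continuous T
    rw [add_zero, show (fun _ => (0 : ℝ)) + u = u from zero_add u] at this
    rw [this, map_add]
  rw [hsum, ← dist_eq_norm]
  rw [dist_eq_norm] at hdist ⊢
  have : y₁ T + p - yT = -(yT - y₁ T - p) := by abel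
  rw [this, norm_neg]
  exact hdist.le

end Sufficiency

/-! ### Necessity -/

section Necessity

variable {n : ℕ} {d α x₀ T : ℝ}

theorem hasWeakDeriv_smul_const {E : Type*} [NormedAddCommGroup E] [NormedSpace ℝ E]
    [CompleteSpace E] {ψ ψ' : ℝ → ℝ} (hψ : ∀ x, HasDerivAt ψ (ψ' x) x) (hψ' : Continuous ψ')
    (e : E) : HasWeakDeriv (fun x => ψ x • e) (fun x => ψ' x • e) := by
  have hc : Continuous ψ := continuous_iff_continuousAt.2 fun x => (hψ x).continuousAt
  have hmem : ∀ {g : ℝ → E}, Continuous g → MemLp g 2 domainMeasure := by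
    intro g hg
    obtain ⟨C, hC⟩ := (isCompact_Icc (a := (0 : ℝ)) (b := Real.pi)).exists_bound_of_continuousOn
      hg.continuousOn
    refine MemLp.of_bound hg.aestronglyMeasurable C ?_
    filter_upwards [ae_restrict_mem measurableSet_Ioo] with x hx
    exact hC x ⟨hx.1.le, hx.2.le⟩
  refine ⟨hmem (hc.smul continuous_const), hmem (hψ'.smul continuous_const), ?_⟩
  intro φ hφ _ hφs
  have hd : Continuous (deriv φ) := hφ.continuous_deriv (by simp)
  have h0 : φ 0 = 0 := image_eq_zero_of_notMem_tsupport fun hm => lt_irrefl _ (hφs hm).1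
  have hpi : φ Real.pi = 0 := image_eq_zero_of_notMem_tsupport fun hm => lt_irrefl _ (hφs hm).2
  have h := intervalIntegral.integral_mul_deriv_eq_deriv_mul (a := 0) (b := Real.pi)
    (u := φ) (v := ψ) (fun x _ => (hφ.differentiable (by simp) x).hasDerivAt)
    (fun x _ => hψ x) (hd.intervalIntegrable _ _) (hψ'.intervalIntegrable _ _)
  rw [h0, hpi, zero_mul, zero_mul, sub_zero, zero_sub] at h
  simp only [smul_smul]
  rw [integral_smul_const, integral_smul_const, ← neg_smul, integral_domainMeasure_eq,
    integral_domainMeasure_eq, h, neg_neg]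

theorem isH10_sinMode_smul {E : Type*} [NormedAddCommGroup E] [NormedSpace ℝ E]
    [CompleteSpace E] (k : ℕ) (e : E) :
    IsH10 (fun x => sinMode k x • e) (fun x => (((k : ℝ) + 1) * cosMode k x) • e) where
  weakDeriv := hasWeakDeriv_smul_const (hasDerivAt_sinMode k)
    (continuous_const.mul (contDiff_cosMode k (m := 0)).continuous) e
  continuousOn := ((contDiff_sinMode k (m := 0)).continuous.smul continuous_const).continuousOn
  left_eq_zero := by rw [sinMode_zero, zero_smul]
  right_eq_zero := by rw [sinMode_pi, zero_smul]

theorem integral_inner_act_smul_const (M : Matrix (Fin n) (Fin n) ℝ) {φ : ℝ → ℝ}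
    (hφ : Continuous φ) (y : L2Space ℝ n) (e : EuclideanSpace ℝ (Fin n)) :
    ∫ x, inner ℝ (act M (y x)) (φ x • e) ∂domainMeasure
      = inner ℝ (act M (∫ x, φ x • y x ∂domainMeasure)) e := by
  have h := ((innerSLFlip ℝ e).comp
    (Matrix.toEuclideanCLM (n := Fin n) (𝕜 := ℝ) M)).integral_comp_comm
    (integrable_smul_domainMeasure hφ y.integrable)
  refine Eq.trans (integral_congr_ae (Eventually.of_forall fun x => ?_)) h
  change inner ℝ (act M (y x)) (φ x • e) = inner ℝ (act M (φ x • y x)) e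
  rw [act_smul, real_inner_smul_left, real_inner_smul_right]

/-- The equation satisfied by the sine coefficients of a weak solution. -/
theorem IsWeakSolution.sinCoef_eq {u : ℝ → ℝ} {y₀ : L2Space ℝ n} {y : ℝ → L2Space ℝ n}
    (h : IsWeakSolution n d α x₀ T u y₀ y) (k : ℕ) {t : ℝ} (ht : t ∈ Set.Icc 0 T) :
    sinCoef n k (y t) - sinCoef n k y₀ + ∫ s in (0 : ℝ)..t, modeOp n d α k (sinCoef n k (y s))
      = (sinMode k x₀ * ∫ s in (0 : ℝ)..t, u s) • vecB n := by
  obtain ⟨z, -, hH, hweak⟩ := h.weak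
  refine ext_inner_right ℝ fun e => ?_
  have hw := hweak _ _ (isH10_sinMode_smul k e) t ht
  have hcs := (contDiff_sinMode k (m := 0)).continuous
  have hpair : ∀ p : L2Space ℝ n,
      ∫ x, inner ℝ (p x) (sinMode k x • e) ∂domainMeasure = inner ℝ (sinCoef n k p) e := by
    intro p
    have := integral_inner_act_smul_const (1 : Matrix (Fin n) (Fin n) ℝ) hcs p e
    simpa [act, sinCoef_eq_integral] using this
  have hci : IntervalIntegrable (fun s => modeOp n d α k (sinCoef n k (y s))) volume 0 t := by
    refine ContinuousOn.intervalIntegrable ?_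
    rw [Set.uIcc_of_le ht.1]
    exact (((modeOp n d α k).comp (sinCoef n k)).continuous.comp_continuousOn h.continuousOn).mono
      (Set.Icc_subset_Icc_right ht.2)
  have hspat : ∫ s in (0 : ℝ)..t,
      ((∫ x, inner ℝ (act (matD n d) (z s x)) ((((k : ℝ) + 1) * cosMode k x) • e) ∂domainMeasure)
        + ∫ x, inner ℝ (act (matA n α) (y s x)) (sinMode k x • e) ∂domainMeasure)
      = inner ℝ (∫ s in (0 : ℝ)..t, modeOp n d α k (sinCoef n k (y s))) e := by
    have h1 := (innerSLFlip ℝ e).intervalIntegral_comp_comm hci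
    refine Eq.trans ?_ h1
    rw [intervalIntegral.integral_of_le ht.1, intervalIntegral.integral_of_le ht.1,
      integral_Ioc_eq_integral_Ioo, integral_Ioc_eq_integral_Ioo]
    refine integral_congr_ae ?_
    filter_upwards [ae_restrict_of_ae_restrict_of_subset (Set.Ioo_subset_Ioo_right ht.2) hH]
      with s ⟨w, hws, hw10⟩
    change _ = inner ℝ (modeOp n d α k (sinCoef n k (y s))) e
    -- A second factor `k + 1` comes from moving the derivative off `z`, using the Dirichlet
    -- condition on `y`.
    have hcos : ∫ x, (((k : ℝ) + 1) * cosMode k x) • z s x ∂domainMeasure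
        = (((k : ℝ) + 1) ^ 2) • sinCoef n k (y s) := by
      simp only [mul_smul]
      rw [integral_smul, hw10.integral_cosMode_smul, smul_smul, ← pow_two, sinCoef_eq_integral]
      congr 1
      refine integral_congr_ae ?_
      filter_upwards [hws] with x hx
      rw [hx]
    have hcc : Continuous fun x => ((k : ℝ) + 1) * cosMode k x :=
      continuous_const.mul (contDiff_cosMode k (m := 0)).continuous
    rw [integral_inner_act_smul_const _ hcc, integral_inner_act_smul_const _ hcs, hcos, ← sinCoef_eq_integral, ← inner_add_left,
      modeOp_eq_act_add, act_smul]
  rw [hpair, hpair, hspat, intervalIntegral.integral_mul_const] at hw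
  rw [inner_add_left, inner_sub_left, hw, real_inner_smul_left, real_inner_smul_right]
  ring

/-- Integrating factor: `exp(μ t) ∫₀ᵗ ζ` has zero derivative. Extending `ζ` by constants beyond `[0,
T]` makes its primitive differentiable on the whole line. -/
theorem eq_zero_of_add_integral_eq_zero {ζ : ℝ → ℂ} (hT : 0 ≤ T)
    (hζ : ContinuousOn ζ (Set.Icc 0 T)) {μ : ℂ}
    (h : ∀ t ∈ Set.Icc 0 T, ζ t + μ * ∫ s in (0 : ℝ)..t, ζ s = 0) : ζ T = 0 := by
  set ξ : ℝ → ℂ := Set.IccExtend hT ((Set.Icc 0 T).domRestrict ζ)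
  have hξ : Continuous ξ := (continuousOn_iff_continuous_domRestrict.1 hζ).Icc_extend'
  have hξζ : ∀ t ∈ Set.Icc 0 T, ξ t = ζ t := fun t ht => by
    simp only [ξ]
    rw [Set.IccExtend_of_mem _ _ ht]
    rfl
  set I : ℝ → ℂ := fun t => ∫ s in (0 : ℝ)..t, ξ s
  have hI : ∀ t ∈ Set.Icc 0 T, I t = ∫ s in (0 : ℝ)..t, ζ s := by
    intro t ht
    refine intervalIntegral.integral_congr fun s hs => hξζ s ?_
    rw [Set.uIcc_of_le ht.1] at hs
    exact ⟨hs.1, hs.2.trans ht.2⟩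
  have hId : ∀ t, HasDerivAt I (ξ t) t := fun t =>
    intervalIntegral.integral_hasDerivAt_right (hξ.intervalIntegrable _ _)
      hξ.stronglyMeasurable.stronglyMeasurableAtFilter hξ.continuousAt
  have hE : ∀ t : ℝ, HasDerivAt (fun t : ℝ => Complex.exp (μ * t) * I t)
      (Complex.exp (μ * t) * (ξ t + μ * I t)) t := by
    intro t
    have h1 : HasDerivAt (fun t : ℝ => Complex.exp (μ * t)) (Complex.exp (μ * t) * (μ * 1)) t :=
      ((Complex.ofRealCLM.hasDerivAt (x := t)).const_mul μ).cexp
    convert! h1.mul (hId t) using 1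
    ring
  have hconst := constant_of_has_deriv_right_zero (a := 0) (b := T)
    (f := fun t : ℝ => Complex.exp (μ * t) * I t)
    (fun t _ => (hE t).continuousAt.continuousWithinAt) (fun t ht => by
      have ht' : t ∈ Set.Icc 0 T := ⟨ht.1, ht.2.le⟩
      have := (hE t).hasDerivWithinAt (s := Set.Ici t)
      rwa [hξζ t ht', hI t ht', h t ht', mul_zero] at this) T (Set.right_mem_Icc.2 hT)
  have hIT : I T = 0 := by
    have h0 : I 0 = 0 := intervalIntegral.integral_same
    simpa [h0, Complex.exp_ne_zero] using hconst
  have hTmem : T ∈ Set.Icc 0 T := Set.right_mem_Icc.2 hT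
  have := h T hTmem
  rwa [← hI T hTmem, hIT, mul_zero, add_zero] at this

/-- Every state reached from `0` lies in the closed proper subspace `ker ℓ`, so a target off it
stays at positive distance. -/
theorem not_approximatelyControllable_of_functional (ℓ : L2Space ℝ n →L[ℝ] ℂ) (hℓ : ℓ ≠ 0)
    (h : ∀ (u : ℝ → ℝ) (y : ℝ → L2Space ℝ n), IsWeakSolution n d α x₀ T u 0 y → ℓ (y T) = 0) :
    ¬ ApproximatelyControllable n d α x₀ T := by
  intro hac
  obtain ⟨yT, hyT⟩ : ∃ yT, ℓ yT ≠ 0 := by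
    by_contra hcon
    push Not at hcon
    exact hℓ (ContinuousLinearMap.ext hcon)
  have hpos : 0 < ‖ℓ yT‖ := norm_pos_iff.2 hyT
  set ε := ‖ℓ yT‖ / (2 * (‖ℓ‖ + 1))
  obtain ⟨u, -, y, hy, hle⟩ := hac 0 yT ε (by positivity)
  have h1 := h u y hy
  have h2 : ‖ℓ yT‖ ≤ ‖ℓ‖ * ε := by
    calc ‖ℓ yT‖ = ‖ℓ (y T - yT)‖ := by rw [map_sub, h1, zero_sub, norm_neg]
      _ ≤ ‖ℓ‖ * ε := ℓ.le_opNorm_of_le hle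
  have h3 : ‖ℓ‖ * ε ≤ ‖ℓ yT‖ / 2 := by
    simp only [ε]
    rw [mul_div_assoc', div_le_div_iff₀ (by positivity) two_pos]
    nlinarith [norm_nonneg ℓ]
  linarith

/-- The pairing of `ℝⁿ` with a complex vector. -/
noncomputable def dotCLM (V : Fin n → ℂ) : EuclideanSpace ℝ (Fin n) →L[ℝ] ℂ :=
  ∑ i, V i • (Complex.ofRealCLM.comp (EuclideanSpace.proj i))

theorem dotCLM_apply (V : Fin n → ℂ) (p : EuclideanSpace ℝ (Fin n)) :
    dotCLM V p = V ⬝ᵥ (toComplex n p).ofLp := by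
  simp [dotCLM, dotProduct, toComplex_apply]

theorem dotCLM_modeOp {V : Fin n → ℂ} {μ : ℂ} {k : ℕ}
    (hV : V ᵥ* modeMatrixℂ n d α k = μ • V) (p : EuclideanSpace ℝ (Fin n)) :
    dotCLM V (modeOp n d α k p) = μ * dotCLM V p := by
  have h : (toComplex n (modeOp n d α k p)).ofLp
      = modeMatrixℂ n d α k *ᵥ (toComplex n p).ofLp := by
    ext i
    simp [toComplex_apply, modeOp, modeMatrixℂ, mulVec, dotProduct]
  rw [dotCLM_apply, dotCLM_apply, h, dotProduct_mulVec, hV, smul_dotProduct, smul_eq_mul]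

theorem sinCoef_sinV (j k : ℕ) (v : EuclideanSpace ℝ (Fin n)) :
    sinCoef n j (sinV n k v) = if k = j then v else 0 :=
  adjoint_apply_of_orthogonalFamily orthogonalFamily_sinV j k v

/-- A common eigenvalue of two modes that the control sees only through one combination is an
obstruction to approximate controllability. -/
theorem not_approximatelyControllable_of_vecMul_eq (hT : 0 < T) {k l : ℕ} (hkl : k ≠ l)
    {V W : Fin n → ℂ} {μ : ℂ} (hV : V ᵥ* modeMatrixℂ n d α k = μ • V)
    (hW : W ᵥ* modeMatrixℂ n d α l = μ • W) (hV0 : V ≠ 0)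
    (hB : sinMode k x₀ * (V ⬝ᵥ (toComplex n (vecB n)).ofLp)
      + sinMode l x₀ * (W ⬝ᵥ (toComplex n (vecB n)).ofLp) = 0) :
    ¬ ApproximatelyControllable n d α x₀ T := by
  set ℓ : L2Space ℝ n →L[ℝ] ℂ :=
    (dotCLM V).comp (sinCoef n k) + (dotCLM W).comp (sinCoef n l) with hℓ
  refine not_approximatelyControllable_of_functional ℓ ?_ ?_
  · obtain ⟨i, hi⟩ := Function.ne_iff.1 hV0
    intro h0
    apply hi
    have h1 := DFunLike.congr_fun h0 (sinV n k (EuclideanSpace.single i 1))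
    have h2 : ℓ (sinV n k (EuclideanSpace.single i 1)) = V i := by
      rw [hℓ]
      change dotCLM V (sinCoef n k _) + dotCLM W (sinCoef n l _) = _
      rw [sinCoef_sinV, sinCoef_sinV, if_pos rfl, if_neg hkl, map_zero, add_zero, dotCLM_apply]
      simp [dotProduct, toComplex_apply, apply_ite]
    rw [← h2, h1]
    rfl
  · intro u y hy
    have hc : ContinuousOn (fun t => ℓ (y t)) (Set.Icc 0 T) :=
      ℓ.continuous.comp_continuousOn hy.continuousOn
    refine eq_zero_of_add_integral_eq_zero (ζ := fun t => ℓ (y t)) (μ := μ) hT.le hc fun t ht => ?_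
    have key : ∀ (j : ℕ) (U : Fin n → ℂ), U ᵥ* modeMatrixℂ n d α j = μ • U →
        dotCLM U (sinCoef n j (y t)) + μ * ∫ s in (0 : ℝ)..t, dotCLM U (sinCoef n j (y s))
          = (∫ s in (0 : ℝ)..t, u s : ℝ) *
            (sinMode j x₀ * (U ⬝ᵥ (toComplex n (vecB n)).ofLp)) := by
      intro j U hU
      have h1 := congrArg (dotCLM U) (hy.sinCoef_eq j ht)
      have hci : IntervalIntegrable (fun s => modeOp n d α j (sinCoef n j (y s))) volume 0 t := by
        refine ContinuousOn.intervalIntegrable ?_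
        rw [Set.uIcc_of_le ht.1]
        exact (((modeOp n d α j).comp (sinCoef n j)).continuous.comp_continuousOn
          hy.continuousOn).mono (Set.Icc_subset_Icc_right ht.2)
      rw [map_zero, sub_zero, map_add, ← (dotCLM U).intervalIntegral_comp_comm hci] at h1
      simp only [dotCLM_modeOp hU] at h1
      rw [intervalIntegral.integral_const_mul, map_smul, dotCLM_apply U (vecB n)] at h1
      rw [h1, Complex.real_smul]
      push_cast
      ring
    have hint : ∀ (j : ℕ) (U : Fin n → ℂ),
        IntervalIntegrable (fun s => dotCLM U (sinCoef n j (y s))) volume 0 t := by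
      intro j U
      refine ContinuousOn.intervalIntegrable ?_
      rw [Set.uIcc_of_le ht.1]
      exact (((dotCLM U).comp (sinCoef n j)).continuous.comp_continuousOn
        hy.continuousOn).mono (Set.Icc_subset_Icc_right ht.2)
    change dotCLM V (sinCoef n k (y t)) + dotCLM W (sinCoef n l (y t))
      + μ * (∫ s in (0 : ℝ)..t, (dotCLM V (sinCoef n k (y s)) + dotCLM W (sinCoef n l (y s)))) = 0
    rw [intervalIntegral.integral_add (hint k V) (hint l W)]
    -- The two modes share `μ`, so their equations add up to a single scalar one, and `hB` cancels
    -- the control.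
    linear_combination key k V hV + key l W hW + (∫ s in (0 : ℝ)..t, u s : ℝ) * hB

theorem ApproximatelyControllable.sinMode_ne_zero (hn : 0 < n) (hT : 0 < T)
    (h : ApproximatelyControllable n d α x₀ T) (k : ℕ) : sinMode k x₀ ≠ 0 := by
  intro h0
  have : Nonempty (Fin n) := ⟨⟨0, hn⟩⟩
  obtain ⟨μ, hμ⟩ := spectrum.nonempty_of_isAlgClosed_of_finiteDimensional ℂ
    (modeMatrixℂ n d α k)
  obtain ⟨V, hV0, hV⟩ := (mem_spectrum_iff_exists_vecMul n _ μ).1 hμ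
  exact not_approximatelyControllable_of_vecMul_eq (W := 0) hT k.succ_ne_self.symm hV
    (by simp) hV0 (by simp [h0]) h

theorem ApproximatelyControllable.disjointModeSpectra (hn : 0 < n) (hT : 0 < T)
    (h : ApproximatelyControllable n d α x₀ T) : DisjointModeSpectra n d α := by
  intro k l hkl
  rw [Set.disjoint_left]
  intro μ hk hl
  obtain ⟨V, hV0, hV⟩ := (mem_spectrum_iff_exists_vecMul n _ μ).1 hk
  obtain ⟨W, hW0, hW⟩ := (mem_spectrum_iff_exists_vecMul n _ μ).1 hl
  have hWB : W ⬝ᵥ (toComplex n (vecB n)).ofLp ≠ 0 := fun h0 =>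
    hW0 (eq_zero_of_vecMul_eq n d α hW h0)
  have hsl : (sinMode l x₀ : ℂ) ≠ 0 := Complex.ofReal_ne_zero.2 (h.sinMode_ne_zero hn hT l)
  -- The weights are crosswise so that the contributions of `B` cancel; the first weight is nonzero
  -- by the Hautus test for `W` and because mode `l` is seen at `x₀`.
  refine not_approximatelyControllable_of_vecMul_eq (μ := μ) hT hkl
    (V := (sinMode l x₀ * (W ⬝ᵥ (toComplex n (vecB n)).ofLp)) • V)
    (W := (-(sinMode k x₀ * (V ⬝ᵥ (toComplex n (vecB n)).ofLp))) • W) ?_ ?_ ?_ ?_ h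
  · rw [smul_vecMul, hV, smul_comm]
  · rw [smul_vecMul, hW, smul_comm]
  · exact smul_ne_zero (mul_ne_zero hsl hWB) hV0
  · rw [smul_dotProduct, smul_dotProduct, smul_eq_mul, smul_eq_mul]
    ring

theorem sinMode_ne_zero_iff_irrational (hx₀ : x₀ ∈ Set.Ioo 0 Real.pi) :
    (∀ k, sinMode k x₀ ≠ 0) ↔ ∀ r : ℚ, r ∈ Set.Ioo (0 : ℚ) 1 → x₀ ≠ (r : ℝ) * Real.pi := by
  constructor
  · rintro h r - rfl
    -- Mode `r.den - 1` has frequency `r.den`, which turns `r π` into an integer multiple of `π`.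
    refine h (r.den - 1) ((sinMode_eq_zero_iff _ _).2 (Real.sin_eq_zero_iff.2 ⟨r.num, ?_⟩))
    have h1 : (((r.den - 1 : ℕ) : ℝ) + 1) = r.den := by
      exact_mod_cast Nat.succ_pred_eq_of_pos r.den_pos
    have h2 : (r.den : ℝ) * r = r.num := by exact_mod_cast Rat.den_mul_eq_num r
    rw [h1, ← mul_assoc, h2]
  · intro h k hk
    obtain ⟨m, hm⟩ := Real.sin_eq_zero_iff.1 ((sinMode_eq_zero_iff _ _).1 hk)
    have hk0 : (0 : ℝ) < k + 1 := by positivity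
    have hx : x₀ = (((m : ℚ) / ((k : ℚ) + 1) : ℚ) : ℝ) * Real.pi := by
      push_cast
      field_simp
      linarith
    refine h _ ⟨?_, ?_⟩ hx
    · have := hx₀.1
      rw [hx] at this
      exact_mod_cast pos_of_mul_pos_left this Real.pi_pos.le
    · have := hx₀.2
      rw [hx] at this
      have h2 := (mul_lt_iff_lt_one_left Real.pi_pos).1 this
      exact_mod_cast h2

theorem approximatelyControllable_iff (hn : 0 < n) (hd : 1 ≤ d) (hx₀ : x₀ ∈ Set.Ioo 0 Real.pi)
    (hT : 0 < T) :
    ApproximatelyControllable n d α x₀ T ↔ DisjointModeSpectra n d α ∧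
      ∀ r : ℚ, r ∈ Set.Ioo (0 : ℚ) 1 → x₀ ≠ (r : ℝ) * Real.pi := by
  rw [← sinMode_ne_zero_iff_irrational hx₀]
  exact ⟨fun h => ⟨h.disjointModeSpectra hn hT, h.sinMode_ne_zero hn hT⟩,
    fun h => approximatelyControllable_of_disjointModeSpectra hn hd hx₀ hT h.1 h.2⟩

end Necessity

/-! ### The eigenvalues of the adjoint operator -/

section Adjoint

variable {n : ℕ} {d α : ℝ}

theorem act_conjTranspose_map_ofReal (M : Matrix (Fin n) (Fin n) ℝ)
    (v : EuclideanSpace ℂ (Fin n)) :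
    act (M.map Complex.ofReal)ᴴ v = WithLp.toLp 2 (v.ofLp ᵥ* M.map Complex.ofReal) := by
  have h : (M.map Complex.ofReal)ᴴ = (M.map Complex.ofReal)ᵀ := by
    ext i j
    simp
  rw [act, h, mulVec_transpose]

theorem vecMul_modeMatrixℂ (k : ℕ) (v : EuclideanSpace ℂ (Fin n)) :
    WithLp.toLp 2 (v.ofLp ᵥ* modeMatrixℂ n d α k)
      = ((k : ℝ) + 1) ^ 2 • act ((matD n d).map Complex.ofReal)ᴴ v
        + act ((matA n α).map Complex.ofReal)ᴴ v := by
  have h : modeMatrixℂ n d α k = (((k : ℝ) + 1) ^ 2) • (matD n d).map Complex.ofReal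
      + (matA n α).map Complex.ofReal := by
    ext i j
    simp [modeMatrixℂ, modeMatrix]
  rw [act_conjTranspose_map_ofReal, act_conjTranspose_map_ofReal, h, vecMul_add, vecMul_smul,
    WithLp.toLp_add, WithLp.toLp_smul]

theorem integral_smul_act (M : Matrix (Fin n) (Fin n) ℂ) {φ : ℝ → ℝ} (hφ : Continuous φ)
    {f : ℝ → EuclideanSpace ℂ (Fin n)} (hf : Integrable f domainMeasure) :
    ∫ x, φ x • act M (f x) ∂domainMeasure = act M (∫ x, φ x • f x ∂domainMeasure) := by
  have h := (Matrix.toEuclideanCLM (n := Fin n) (𝕜 := ℂ) M).integral_comp_comm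
    (integrable_smul_domainMeasure hφ hf)
  refine Eq.trans (integral_congr_ae (Eventually.of_forall fun x => ?_)) h
  change φ x • act M (f x) = Matrix.toEuclideanCLM (n := Fin n) (𝕜 := ℂ) M (φ x • f x)
  rw [← Complex.coe_smul, ← Complex.coe_smul, map_smul]
  rfl

theorem integrable_act (M : Matrix (Fin n) (Fin n) ℂ)
    {f : ℝ → EuclideanSpace ℂ (Fin n)} (hf : Integrable f domainMeasure) :
    Integrable (fun x => act M (f x)) domainMeasure :=
  (Matrix.toEuclideanCLM (n := Fin n) (𝕜 := ℂ) M).integrable_comp hf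

/-- The sine coefficients of an element of `L²(0, π; ℂⁿ)`. -/
noncomputable def sinCoefℂ (k : ℕ) : L2Space ℂ n →ₗ[ℂ] EuclideanSpace ℂ (Fin n) where
  toFun Φ := ∫ x, sinMode k x • Φ x ∂domainMeasure
  map_add' Φ Ψ := by
    have hc := (contDiff_sinMode k (m := 0)).continuous
    rw [← integral_add (integrable_smul_domainMeasure hc Φ.integrable)
      (integrable_smul_domainMeasure hc Ψ.integrable)]
    refine integral_congr_ae ?_
    filter_upwards [Lp.coeFn_add Φ Ψ] with x hx
    rw [hx, Pi.add_apply, smul_add]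
  map_smul' c Φ := by
    rw [RingHom.id_apply, ← integral_smul]
    refine integral_congr_ae ?_
    filter_upwards [Lp.coeFn_smul c Φ] with x hx
    rw [hx, Pi.smul_apply, smul_comm]

theorem exists_sinCoefℂ_ne_zero {Φ : L2Space ℂ n} (hΦ : Φ ≠ 0) : ∃ k, sinCoefℂ k Φ ≠ 0 := by
  by_contra! h
  exact hΦ ((Lp.eq_zero_iff_ae_eq_zero).2 (ae_eq_zero_of_integral_sinMode_smul_vec (Lp.memLp Φ) h))

/-- Two integrations by parts against a sine: the first uses that the sine vanishes at the ends, the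
second that the eigenfunction does. Together they turn `-∂_xx` into `(k+1)²`. -/
theorem sinCoefℂ_vecMul_eq {Φ : L2Space ℂ n} {μ : ℂ} (hΦ : Φ ∈ adjointEigenspace n d α μ)
    (k : ℕ) : (sinCoefℂ k Φ).ofLp ᵥ* modeMatrixℂ n d α k = μ • (sinCoefℂ k Φ).ofLp := by
  obtain ⟨f, f₁, f₂, hf, h0, h2, he⟩ : ∃ f f₁ f₂ : ℝ → EuclideanSpace ℂ (Fin n),
    f =ᵐ[domainMeasure] Φ ∧ IsH10 f f₁ ∧ HasWeakDeriv f₁ f₂ ∧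
    ∀ᵐ x ∂domainMeasure,
      (μ • Φ : L2Space ℂ n) x = - act ((matD n d).map Complex.ofReal)ᴴ (f₂ x)
        + act ((matA n α).map Complex.ofReal)ᴴ (f x) := hΦ
  have hc := (contDiff_sinMode k (m := 0)).continuous
  have hcoef : sinCoefℂ k Φ = ∫ x, sinMode k x • f x ∂domainMeasure := by
    refine integral_congr_ae ?_
    filter_upwards [hf] with x hx
    rw [hx]
  have hf2 : ∫ x, sinMode k x • f₂ x ∂domainMeasure
      = -((((k : ℝ) + 1) ^ 2) • sinCoefℂ k Φ) := by
    rw [h2.integral_sinMode_smul, h0.integral_cosMode_smul, hcoef, smul_smul, pow_two]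
  have h1 : μ • sinCoefℂ k Φ
      = ((k : ℝ) + 1) ^ 2 • act ((matD n d).map Complex.ofReal)ᴴ (sinCoefℂ k Φ)
        + act ((matA n α).map Complex.ofReal)ᴴ (sinCoefℂ k Φ) := by
    have hI1 := integrable_act ((matD n d).map Complex.ofReal)ᴴ h2.integrable_deriv
    have hI2 := integrable_act ((matA n α).map Complex.ofReal)ᴴ h0.weakDeriv.integrable
    calc μ • sinCoefℂ k Φ = sinCoefℂ k (μ • Φ) := (map_smul _ _ _).symm
      _ = ∫ x, (sinMode k x • act ((matA n α).map Complex.ofReal)ᴴ (f x)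
            - sinMode k x • act ((matD n d).map Complex.ofReal)ᴴ (f₂ x)) ∂domainMeasure := by
          refine integral_congr_ae ?_
          filter_upwards [he] with x hx
          rw [hx, smul_add, smul_neg, neg_add_eq_sub]
      _ = _ := by
          rw [integral_sub (integrable_smul_domainMeasure hc hI2)
            (integrable_smul_domainMeasure hc hI1), integral_smul_act _ hc h2.integrable_deriv,
            integral_smul_act _ hc h0.weakDeriv.integrable, hf2, ← hcoef, ← neg_smul,
            ← Complex.coe_smul, act_smul, Complex.coe_smul, neg_smul, sub_neg_eq_add, add_comm]
  have h3 := h1.trans (vecMul_modeMatrixℂ (d := d) (α := α) k (sinCoefℂ k Φ)).symm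
  exact (congrArg WithLp.ofLp h3).symm

theorem memLp_sinMode_smul (k : ℕ) (v : EuclideanSpace ℂ (Fin n)) :
    MemLp (fun x => sinMode k x • v) 2 domainMeasure :=
  (isH10_sinMode_smul k v).weakDeriv.memLp

/-- The element `x ↦ sin ((k+1) x) v` of `L²(0, π; ℂⁿ)`, normalized. -/
noncomputable def sinVℂ (k : ℕ) (v : EuclideanSpace ℂ (Fin n)) : L2Space ℂ n :=
  (memLp_sinMode_smul k v).toLp

theorem sinCoefℂ_sinVℂ (j k : ℕ) (v : EuclideanSpace ℂ (Fin n)) :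
    sinCoefℂ j (sinVℂ k v) = if j = k then v else 0 := by
  have h : sinCoefℂ j (sinVℂ k v)
      = ∫ x, (sinMode j x * sinMode k x) • v ∂domainMeasure := by
    refine integral_congr_ae ?_
    filter_upwards [(memLp_sinMode_smul k v).coeFn_toLp] with x hx
    rw [sinVℂ, hx, smul_smul]
  rw [h, integral_smul_const, integral_sinMode_mul]
  split_ifs <;> simp

theorem sinVℂ_mem_adjointEigenspace {k : ℕ} {v : EuclideanSpace ℂ (Fin n)} {μ : ℂ}
    (hv : v.ofLp ᵥ* modeMatrixℂ n d α k = μ • v.ofLp) :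
    sinVℂ k v ∈ adjointEigenspace n d α μ := by
  have hcos : ∀ x, HasDerivAt (fun x => ((k : ℝ) + 1) * cosMode k x)
      (-(((k : ℝ) + 1) ^ 2 * sinMode k x)) x := fun x => by
    convert! (hasDerivAt_cosMode k x).const_mul ((k : ℝ) + 1) using 1
    ring
  have hcs := (contDiff_sinMode k (m := 0)).continuous
  refine ⟨_, _, _, (memLp_sinMode_smul k v).coeFn_toLp.symm, isH10_sinMode_smul k v,
    hasWeakDeriv_smul_const hcos (continuous_const.mul hcs).neg v, ?_⟩
  have h1 : μ • v = ((k : ℝ) + 1) ^ 2 • act ((matD n d).map Complex.ofReal)ᴴ v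
        + act ((matA n α).map Complex.ofReal)ᴴ v := by
    rw [← vecMul_modeMatrixℂ, hv]
    rfl
  filter_upwards [Lp.coeFn_smul μ (sinVℂ k v), (memLp_sinMode_smul k v).coeFn_toLp] with x hx hx'
  change (μ • sinVℂ k v : L2Space ℂ n) x = _
  rw [hx, Pi.smul_apply, sinVℂ, hx', smul_comm, h1, smul_add, smul_smul, ← Complex.coe_smul,
    ← Complex.coe_smul, ← Complex.coe_smul, ← Complex.coe_smul, act_smul, act_smul,
    ← neg_smul]
  push_cast
  ring_nf

/-- A shared eigenvalue would carry two eigenfunctions living on different sine modes, hence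
linearly independent. -/
theorem SimpleEigenvalues.disjointModeSpectra (h : SimpleEigenvalues n d α) :
    DisjointModeSpectra n d α := by
  intro k l hkl
  rw [Set.disjoint_left]
  intro μ hk hl
  obtain ⟨V, hV0, hV⟩ := (mem_spectrum_iff_exists_vecMul n _ μ).1 hk
  obtain ⟨W, hW0, hW⟩ := (mem_spectrum_iff_exists_vecMul n _ μ).1 hl
  have hΦ : sinVℂ k (WithLp.toLp 2 V) ∈ adjointEigenspace n d α μ :=
    sinVℂ_mem_adjointEigenspace hV
  have hΨ : sinVℂ l (WithLp.toLp 2 W) ∈ adjointEigenspace n d α μ :=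
    sinVℂ_mem_adjointEigenspace hW
  have hΦ0 : sinVℂ k (WithLp.toLp 2 V) ≠ 0 := by
    intro h0
    have h1 := congrArg (sinCoefℂ k) h0
    rw [sinCoefℂ_sinVℂ, if_pos rfl, map_zero] at h1
    exact hV0 (congrArg WithLp.ofLp h1)
  have hne : adjointEigenspace n d α μ ≠ ⊥ := fun hbot =>
    hΦ0 ((Submodule.mem_bot ℂ).1 (hbot ▸ hΦ))
  obtain ⟨c, hc⟩ := exists_smul_eq_of_finrank_eq_one (h μ hne) (x := ⟨_, hΦ⟩)
    (fun h0 => hΦ0 (congrArg Subtype.val h0)) ⟨_, hΨ⟩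
  have h1 := congrArg (sinCoefℂ l) (congrArg Subtype.val hc)
  change sinCoefℂ l (c • sinVℂ k (WithLp.toLp 2 V)) = sinCoefℂ l (sinVℂ l (WithLp.toLp 2 W)) at h1
  rw [map_smul, sinCoefℂ_sinVℂ, sinCoefℂ_sinVℂ, if_pos rfl, if_neg hkl.symm, smul_zero] at h1
  exact hW0 (congrArg WithLp.ofLp h1).symm

theorem DisjointModeSpectra.simpleEigenvalues (h : DisjointModeSpectra n d α) :
    SimpleEigenvalues n d α := by
  intro μ hne
  obtain ⟨Φ, hΦ, hΦ0⟩ := Submodule.exists_mem_ne_zero_of_ne_bot hne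
  obtain ⟨k, hk⟩ := exists_sinCoefℂ_ne_zero hΦ0
  have hspec : ∀ {Ψ : L2Space ℂ n}, Ψ ∈ adjointEigenspace n d α μ → ∀ j, sinCoefℂ j Ψ ≠ 0 →
      μ ∈ spectrum ℂ (modeMatrixℂ n d α j) := fun hΨ j hj =>
    (mem_spectrum_iff_exists_vecMul n _ μ).2
      ⟨_, fun h0 => hj ((WithLp.ofLp_eq_zero 2).1 h0), sinCoefℂ_vecMul_eq hΨ j⟩
  have hother : ∀ {Ψ : L2Space ℂ n}, Ψ ∈ adjointEigenspace n d α μ → ∀ j, j ≠ k →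
      sinCoefℂ j Ψ = 0 := fun hΨ j hj => by
    by_contra h0
    exact Set.disjoint_left.1 (h j k hj) (hspec hΨ j h0) (hspec hΦ k hk)
  -- Disjointness leaves the single mode `k` for the whole eigenspace, and on that mode a left
  -- eigenvector is determined by its product with `B`. This scalar functional is therefore
  -- injective, which bounds the dimension by `1`.
  set F : adjointEigenspace n d α μ →ₗ[ℂ] ℂ :=
    (dotProductBilin ℂ ℂ ((toComplex n (vecB n)).ofLp)).comp
      ((WithLp.linearEquiv 2 ℂ (Fin n → ℂ)).toLinearMap.comp
        ((sinCoefℂ k).comp (adjointEigenspace n d α μ).subtype)) with hF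
  have hFapply : ∀ Ψ, F Ψ = (sinCoefℂ k (Ψ : L2Space ℂ n)).ofLp ⬝ᵥ (toComplex n (vecB n)).ofLp := by
    intro Ψ
    rw [dotProduct_comm]
    rfl
  have hinj : Function.Injective F := by
    rw [← LinearMap.ker_eq_bot, LinearMap.ker_eq_bot']
    rintro ⟨Ψ, hΨ⟩ h0
    rw [hFapply] at h0
    have h1 := eq_zero_of_vecMul_eq n d α (sinCoefℂ_vecMul_eq hΨ k) h0
    have h2 : sinCoefℂ k Ψ = 0 := (WithLp.ofLp_eq_zero 2).1 h1
    by_contra hΨ0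
    obtain ⟨j, hj⟩ := exists_sinCoefℂ_ne_zero fun h3 => hΨ0 (Subtype.ext h3)
    rcases eq_or_ne j k with rfl | hjk
    · exact hj h2
    · exact hj (hother hΨ j hjk)
  have hfin : Module.Finite ℂ (adjointEigenspace n d α μ) := Module.Finite.of_injective F hinj
  have hnt : Nontrivial (adjointEigenspace n d α μ) :=
    Submodule.nontrivial_iff_ne_bot.2 hne
  have hle := LinearMap.finrank_le_finrank_of_injective hinj
  rw [Module.finrank_self] at hle
  exact le_antisymm hle Module.finrank_pos

theorem simpleEigenvalues_iff : SimpleEigenvalues n d α ↔ DisjointModeSpectra n d α :=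
  ⟨SimpleEigenvalues.disjointModeSpectra, DisjointModeSpectra.simpleEigenvalues⟩

end Adjoint

end PointwiseControl

theorem mainTheorem5 (n : ℕ) (hn : 2 ≤ n) (d α : ℝ) (hd : 1 ≤ d) (hodd : 0 < α → Odd n)
    (x₀ : ℝ) (hx₀ : x₀ ∈ Set.Ioo (0 : ℝ) Real.pi) (T : ℝ) (hT : 0 < T) :
    (α ≠ 0 →
      (PointwiseControl.ApproximatelyControllable n d α x₀ T ↔
        (PointwiseControl.SimpleEigenvalues n d α ∧
          ∀ r : ℚ, r ∈ Set.Ioo (0 : ℚ) 1 → x₀ ≠ (r : ℝ) * Real.pi))) ∧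
    (α = 0 →
      (PointwiseControl.ApproximatelyControllable n d α x₀ T ↔
        ∀ r : ℚ, r ∈ Set.Ioo (0 : ℚ) 1 → x₀ ≠ (r : ℝ) * Real.pi)) := by
  have h := PointwiseControl.approximatelyControllable_iff (n := n) (α := α) (by omega) hd hx₀ hT
  refine ⟨fun _ => ?_, fun hα => ?_⟩
  · rw [h, PointwiseControl.simpleEigenvalues_iff]
  · subst hα
    rw [h]
    exact and_iff_right (PointwiseControl.disjointModeSpectra_of_eq_zero n (by linarith))
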